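/- An \emph{instance} is a finite, nonempty, undirected multigraph $G=(V,E)$ (parallel edges and self-loops allowed), given by its list of vertices and its list of edges, together with a rational probability $p_e\in[0,1]$ for each edge $e\in E$, written in binary as a fraction. Let $\mathrm{FAIL}(G,p)$ be the probability that the graph becomes disconnected when every edge $e$ fails (is removed) independently with its own probability $p_e$, that is, $$\mathrm{FAIL}(G,p)=\sum_{S\subseteq E:\ (V,E\setminus S)\text{ not connected}}\ \prod_{e\in S}p_e\prod_{e\in E\setminus S}(1-p_e).$$ \textbf{Theorem.} There is a fully polynomial randomized approximation scheme (FPRAS) for the all-terminal network reliability problem with varying edge failure probabilities. That is, there are one randomized algorithm $A$, using independent fair coin flips and elementary integer operations charged by bit length, and one polynomial $P$, such that for every instance $(G,p)$ and every rational $\varepsilon>0$ (written in binary as a fraction), the following hold. 1. On input $(G,p,\varepsilon)$ the algorithm $A$ always halts within $P(L+\lceil 1/\varepsilon\rceil)$ steps, where $L$ is the length of the input. 2. With probability at least $3/4$ over its coin flips, $A$ returns a rational number $r$, written as a fraction, with $$(1-\varepsilon)\,\mathrm{FAIL}(G,p)\le r\le(1+\varepsilon)\,\mathrm{FAIL}(G,p).$$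 -/

import Mathlib

namespace NetRel

/-! ### A randomized programming language with a bit-cost step count

Data are binary trees whose leaves carry natural numbers, written in binary.
Programs are built from elementary operations, fair coin flips, sequencing, pairing, branching and
two kinds of `for` loop. Every construct is charged the number of symbols that it reads and writes,
so that running times agree, up to a polynomial, with those of a probabilistic Turing machine. -/

/-- Data: binary trees with natural numbers at the leaves. -/
inductive Val : Type where
  | num (n : ℕ) : Val
  | pair (a b : Val) : Val

namespace Val

/-- The number of symbols needed to write a datum, numbers being written in binary. -/
def size : Val → ℕ
  | num n => Nat.size n + 1
  | pair a b => a.size + b.size + 1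

/-- Left component (`0` for a number). -/
def fst : Val → Val
  | num _ => num 0
  | pair a _ => a

/-- Right component (`0` for a number). -/
def snd : Val → Val
  | num _ => num 0
  | pair _ b => b

/-- The number at a leaf (`0` for a pair). -/
def toNat : Val → ℕ
  | num n => n
  | pair _ _ => 0

/-- `1` for a number, `0` for a pair. -/
def isNum : Val → Val
  | num _ => num 1
  | pair _ _ => num 0

/-- The list `[v₁, …, vₖ]` as the datum `(v₁, (v₂, … (vₖ, 0)))`. -/
def ofList : List Val → Val
  | [] => num 0
  | v :: l => pair v (ofList l)

/-- A nonnegative rational number as the pair of its numerator and its denominator. -/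
def ofRat (q : ℚ) : Val :=
  pair (num q.num.toNat) (num q.den)

end Val

/-- Elementary operations. The arithmetic ones act on a pair of numbers. -/
inductive Op : Type where
  | id : Op
  | const (n : ℕ) : Op
  | fst : Op
  | snd : Op
  | isNum : Op
  | add : Op
  | sub : Op
  | mul : Op
  | div : Op
  | le : Op

/-- The result of an elementary operation. Subtraction is truncated, division is rounded down
(and gives `0` for divisor `0`), and comparison returns `1` or `0`. -/
def Op.apply : Op → Val → Val
  | .id, x => x
  | .const n, _ => .num n
  | .fst, x => x.fst
  | .snd, x => x.snd
  | .isNum, x => x.isNum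
  | .add, x => .num (x.fst.toNat + x.snd.toNat)
  | .sub, x => .num (x.fst.toNat - x.snd.toNat)
  | .mul, x => .num (x.fst.toNat * x.snd.toNat)
  | .div, x => .num (x.fst.toNat / x.snd.toNat)
  | .le, x => .num (if x.fst.toNat ≤ x.snd.toNat then 1 else 0)

/-- The outcome of a randomized computation: the joint distribution of the returned datum and of
the number of steps taken. -/
abbrev Run : Type := PMF (Val × ℕ)

/-- Run a computation, hand its result on to the next one, add up the two step counts and charge
`k` further steps. -/
noncomputable def Run.andThen (k : ℕ) (r : Run) (f : Val → Run) : Run :=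
  r.bind fun a => (f a.1).map fun b => (b.1, a.2 + b.2 + k)

/-- Return a datum, at the price of writing it. -/
noncomputable def Run.ret (v : Val) : Run :=
  PMF.pure (v, v.size + 1)

/-- Repeat `f` on the state `s`, `n` times. -/
noncomputable def Run.iterate (f : Val → Run) : ℕ → Val → Run
  | 0, s => Run.ret s
  | n + 1, s => (f s).andThen (s.size + Nat.size n + 1) (Run.iterate f n)

/-- For each entry `h` of a list, from the first to the last, replace the state `s` by the result
of `f` on `(h, s)`. -/
noncomputable def Run.foldl (f : Val → Run) : Val → Val → Run
  | .num _, s => Run.ret s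
  | .pair h t, s => (f (.pair h s)).andThen (h.size + t.size + s.size + 1) (Run.foldl f t)

/-- Programs.
* `op o`: an elementary operation;
* `flip`: a fair coin, returning `0` or `1`;
* `seq p q`: first `p`, then `q` on the result of `p`;
* `pair p q`: run `p` and `q` on the same input and return the pair of the results;
* `ite c p q`: run `p` if `c` returns a nonzero number, and `q` otherwise;
* `iter p`: on input `(n, s)` apply `p` to the state `s`, `n` times;
* `fold p`: on input `(l, s)` run through the list `l`, updating the state `s` by `p`. -/
inductive Prog : Type where
  | op (o : Op) : Prog
  | flip : Prog
  | seq (p q : Prog) : Prog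
  | pair (p q : Prog) : Prog
  | ite (c p q : Prog) : Prog
  | iter (p : Prog) : Prog
  | fold (p : Prog) : Prog

/-- The distribution of result and step count of a program on a given input; different coin flips
are independent. -/
noncomputable def Prog.eval : Prog → Val → Run
  | .op o, x => PMF.pure (o.apply x, x.size + (o.apply x).size + 1)
  | .flip, x => (PMF.uniformOfFintype Bool).map fun b => (Val.num b.toNat, x.size + 3)
  | .seq p q, x => (p.eval x).andThen 1 q.eval
  | .pair p q, x =>
      (p.eval x).andThen x.size fun y => (q.eval x).andThen 1 fun z => Run.ret (.pair y z)
  | .ite c p q, x =>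
      (c.eval x).andThen x.size fun b => if b.toNat = 0 then q.eval x else p.eval x
  | .iter p, x => (Run.ret x).andThen 1 fun y => Run.iterate p.eval y.fst.toNat y.snd
  | .fold p, x => (Run.ret x).andThen 1 fun y => Run.foldl p.eval y.fst y.snd

/-! ### Fully polynomial randomized approximation schemes -/

/-- The datum `v` is a fraction `a / b`, `b > 0`, in the range `(1 ± ε) r`. -/
def IsApprox (ε r : ℚ) (v : Val) : Prop :=
  ∃ a b : ℕ, v = .pair (.num a) (.num b) ∧ 0 < b ∧
    (1 - ε) * r ≤ (a : ℚ) / b ∧ (a : ℚ) / b ≤ (1 + ε) * r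

/-- The input of an approximation scheme: an encoded instance together with the error parameter. -/
def schemeInput {α : Type} (encode : α → Val) (x : α) (ε : ℚ) : Val :=
  .pair (encode x) (.ofRat ε)

/-- `A` is a fully polynomial randomized approximation scheme for the quantity `f`: for every
instance and every rational `ε > 0` it always halts within a number of steps that is polynomial in
the length of the input and `1 / ε`, and it returns a `(1 ± ε)`-approximation with probability at
least `3 / 4`. -/
def IsFPRAS {α : Type} (encode : α → Val) (f : α → ℚ) (A : Prog) : Prop :=
  (∃ P : Polynomial ℕ, ∀ (x : α) (ε : ℚ), 0 < ε →
    ∀ r ∈ (A.eval (schemeInput encode x ε)).support,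
      r.2 ≤ P.eval ((schemeInput encode x ε).size + ⌈ε⁻¹⌉₊)) ∧
  ∀ (x : α) (ε : ℚ), 0 < ε →
    (3 / 4 : ENNReal) ≤
      (A.eval (schemeInput encode x ε)).toOuterMeasure {r | IsApprox ε (f x) r.1}

/-! ### All-terminal network reliability -/

/-- A finite nonempty undirected multigraph with vertices `0, …, n - 1` and edges `0, …, m - 1`,
in which edge `e` joins the two entries of `ends e` (in either order) and carries a rational
failure probability. -/
structure Network : Type where
  n : ℕ
  n_pos : 0 < n
  m : ℕ
  ends : Fin m → Fin n × Fin n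
  prob : Fin m → ℚ
  prob_nonneg : ∀ e, 0 ≤ prob e
  prob_le_one : ∀ e, prob e ≤ 1

namespace Network

/-- The graph that remains when exactly the edges in `S` fail. Two vertices are adjacent if some
surviving edge joins them. -/
def surviving (N : Network) (S : Finset (Fin N.m)) : SimpleGraph (Fin N.n) :=
  SimpleGraph.fromEdgeSet {d | ∃ e, e ∉ S ∧ d = s((N.ends e).1, (N.ends e).2)}

open scoped Classical in
/-- The probability that the network becomes disconnected when the edges fail independently, each
edge `e` with its own probability. -/
noncomputable def failProb (N : Network) : ℚ :=
  ∑ S : Finset (Fin N.m),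
    if (N.surviving S).Connected then 0
    else (∏ e ∈ S, N.prob e) * ∏ e ∈ Sᶜ, (1 - N.prob e)

/-- A network as a datum: the list of its vertices, and the list of its edges, each given by its
two endpoints and its failure probability. -/
def encode (N : Network) : Val :=
  .pair (.ofList (List.ofFn fun v : Fin N.n => .num v))
    (.ofList (List.ofFn fun e : Fin N.m =>
      .pair (.pair (.num (N.ends e).1) (.num (N.ends e).2)) (.ofRat (N.prob e))))

end Network

end NetRel

/-! Write `n`, `m` for the numbers of vertices and edges, `F` for the failure probability and `k`
for an integer with `1 / k ≤ ε`. If `F` is at least an inverse polynomial, direct simulation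
suffices. The difficulty is a small `F`.

A cut is represented by a 2-coloring of the vertices, so every cut occurs twice; `cp` is the
probability that all edges across it fail. Let `q` be the bottleneck probability, the largest number
such that some cut has only edges with failure probability at least `q`. Each `p_e` is replaced by
an integer weight, about `D * log_q p_e` with `D = 6 (m + 1)`. The least weight `c` of a cut lies
between `D` and `D * m`, so rounding costs at most the fraction `1 / 6` of `c` (`isScale`,
`exists_isScale_min`). Karger's contraction argument, applied to colorings with four colors, shows
that at most `(4 n) ^ j` of them have weight at most `j c / 2` (`card_small_le`). Hence, if the
failure probability `P` of a cut of least weight is below a fixed inverse polynomial, all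
4-colorings of weight at least `3 c / 2` together contribute at most `P / (8 k)` (`sum_heavy_le`,
`heavy_bound`). Two different cuts split the vertices into at least three blocks, and three blocks
have weight at least `3 c / 2`; so the joint failure of two cuts is negligible. Therefore `2 F` is
close to the sum of `cp` over all cuts, and already to the sum over the cuts of weight below `3 c /
2` (`failR_approx`).

That sum is estimated by contracting random edges, chosen in proportion to weight, until three
blocks remain, and coloring these at random. The resulting cut, of weight `c'`, contributes `cp`
times the inverse of the probability that the performed contractions spare it: one factor `W / (W -
c')` per step, where `W` is the remaining weight. A run in which some step with `r` blocks has `r c'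
> 3 W` is discarded. Up to the bias of the random digits, each cut of weight below `3 c / 2` is then
counted with the correct expectation and no cut with a larger one (`le_avg_colorTerm`,
`avg_colorTerm_le`). The kept factors are at most `r / (r - 3)`, and their product telescopes to a
binomial coefficient, so the estimator never exceeds `4 n ^ 3 F` (`zVal_le`). Chebyshev's inequality
then needs only polynomially many samples.

It remains to decide which estimate to return. A sample mean of the contraction estimator that is
not small certifies that `F` is large, whatever the coin flips, and simulation is used; a small mean
certifies, when it is close to its expectation, that `P` is small, and then the mean itself is
accurate (`card_est_le`).

For the running time, the result is a deterministic function of the input and of one uniform number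
whose binary digits are the coin flips (`exists_prog_of_comp`). Functions computed in polynomial
time are handled by closure properties of `Comp`. -/

namespace NetRel

/-! ### Polynomially bounded functions -/

/-- The function `f` is bounded by a polynomial in `s`. -/
def PB {α : Type} (s f : α → ℕ) : Prop :=
  ∃ P : Polynomial ℕ, ∀ a, f a ≤ P.eval (s a)

namespace PB

variable {α β : Type} {s f g : α → ℕ}

theorem self (s : α → ℕ) : PB s s := ⟨Polynomial.X, fun a => by simp⟩

theorem const (c : ℕ) : PB s (fun _ => c) := ⟨Polynomial.C c, fun a => by simp⟩

theorem mono (hf : PB s f) (h : ∀ a, g a ≤ f a) : PB s g :=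
  let ⟨P, hP⟩ := hf
  ⟨P, fun a => (h a).trans (hP a)⟩

theorem add (hf : PB s f) (hg : PB s g) : PB s (fun a => f a + g a) :=
  let ⟨P, hP⟩ := hf
  let ⟨Q, hQ⟩ := hg
  ⟨P + Q, fun a => by rw [Polynomial.eval_add]; exact add_le_add (hP a) (hQ a)⟩

theorem mul (hf : PB s f) (hg : PB s g) : PB s (fun a => f a * g a) :=
  let ⟨P, hP⟩ := hf
  let ⟨Q, hQ⟩ := hg
  ⟨P * Q, fun a => by rw [Polynomial.eval_mul]; exact Nat.mul_le_mul (hP a) (hQ a)⟩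

theorem pow (hf : PB s f) (k : ℕ) : PB s (fun a => f a ^ k) :=
  let ⟨P, hP⟩ := hf
  ⟨P ^ k, fun a => by rw [Polynomial.eval_pow]; exact Nat.pow_le_pow_left (hP a) k⟩

theorem comap (hf : PB s f) (π : β → α) : PB (fun b => s (π b)) (fun b => f (π b)) :=
  let ⟨P, hP⟩ := hf
  ⟨P, fun b => hP (π b)⟩

theorem up {m : α → Type} (hf : PB s f) :
    PB (fun b : Σ a, m a => s b.1) (fun b => f b.1) :=
  hf.comap Sigma.fst

/-- A family bounded uniformly in the second index. -/
theorem uniform {m : α → Type} {F : (Σ a, m a) → ℕ} (h : PB (fun b : Σ a, m a => s b.1) F) :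
    ∃ B : α → ℕ, PB s B ∧ ∀ a (k : m a), F ⟨a, k⟩ ≤ B a :=
  let ⟨P, hP⟩ := h
  ⟨fun a => P.eval (s a), ⟨P, fun _ => le_rfl⟩, fun a k => hP ⟨a, k⟩⟩

end PB

/-! ### Functions computed by deterministic programs in polynomial time -/

/-- Some deterministic program maps `i a` to `o a`, for every index `a`, within a time that is
polynomial in `s a`; the data involved have size polynomial in `s a`. -/
def Comp {α : Type} (s : α → ℕ) (i o : α → Val) : Prop :=
  ∃ (p : Prog) (t : α → ℕ), (∀ a, p.eval (i a) = PMF.pure (o a, t a)) ∧ PB s t ∧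
    PB s (fun a => (i a).size) ∧ PB s (fun a => (o a).size)

/-- `Comp` for functions with values in the natural numbers. -/
abbrev CompN {α : Type} (s : α → ℕ) (i : α → Val) (f : α → ℕ) : Prop :=
  Comp s i (fun a => .num (f a))

theorem Run.andThen_pure {k t t' : ℕ} {v u : Val} {f : Val → Run}
    (h : f v = PMF.pure (u, t')) :
    Run.andThen k (PMF.pure (v, t)) f = PMF.pure (u, t + t' + k) := by
  unfold Run.andThen
  rw [PMF.pure_bind, h, PMF.pure_map]

theorem Nat.size_add_le (x y : ℕ) : Nat.size (x + y) ≤ Nat.size x + Nat.size y + 1 := by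
  rw [Nat.size_le]
  have hx := Nat.lt_size_self x
  have hy := Nat.lt_size_self y
  have h1 : 2 ^ Nat.size x ≤ 2 ^ (Nat.size x + Nat.size y) := Nat.pow_le_pow_right (by simp) (by omega)
  have h2 : 2 ^ Nat.size y ≤ 2 ^ (Nat.size x + Nat.size y) := Nat.pow_le_pow_right (by simp) (by omega)
  rw [pow_succ]; omega

theorem Nat.size_mul_le (x y : ℕ) : Nat.size (x * y) ≤ Nat.size x + Nat.size y := by
  rw [Nat.size_le, pow_add]
  exact Nat.mul_lt_mul'' (Nat.lt_size_self x) (Nat.lt_size_self y)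

theorem Nat.size_le_self' (x : ℕ) : Nat.size x ≤ x := by
  rw [Nat.size_le]; exact Nat.lt_two_pow_self

theorem Val.size_fst_le (v : Val) : v.fst.size ≤ v.size := by
  cases v <;> simp [Val.size, Val.fst, Nat.size_zero]; omega

theorem Val.size_snd_le (v : Val) : v.snd.size ≤ v.size := by
  cases v <;> simp [Val.size, Val.snd, Nat.size_zero]; omega

theorem Val.size_ofList_ofFn_le {n B : ℕ} {g : Fin n → Val} (h : ∀ k, (g k).size ≤ B) :
    (Val.ofList (List.ofFn g)).size ≤ n * (B + 1) + 1 := by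
  induction n with
  | zero => simp [Val.ofList, Val.size, Nat.size_zero]
  | succ n ih =>
    rw [List.ofFn_succ]
    simp only [Val.ofList, Val.size]
    have := ih (g := fun k => g k.succ) (fun k => h _)
    have h0 := h 0
    rw [Nat.succ_mul]; omega

theorem Val.le_size_ofList_ofFn {n : ℕ} (g : Fin n → Val) (k : Fin n) :
    (g k).size ≤ (Val.ofList (List.ofFn g)).size := by
  induction n with
  | zero => exact k.elim0
  | succ n ih =>
    rw [List.ofFn_succ]
    simp only [Val.ofList, Val.size]
    refine Fin.cases ?_ (fun j => ?_) k
    · omega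
    · have := ih (g := fun k => g k.succ) j
      omega

theorem Val.length_le_size_ofList (l : List Val) : l.length ≤ (Val.ofList l).size := by
  induction l with
  | nil => simp
  | cons a l ih => simp only [Val.ofList, Val.size, List.length_cons]; omega

namespace Comp

variable {α β : Type} {s : α → ℕ} {i o u v : α → Val}

theorem pb_in (h : Comp s i o) : PB s (fun a => (i a).size) := by
  obtain ⟨_, _, _, _, h, _⟩ := h; exact h

theorem pb_out (h : Comp s i o) : PB s (fun a => (o a).size) := by
  obtain ⟨_, _, _, _, _, h⟩ := h; exact h

theorem ofOp (op : Op) (hi : PB s (fun a => (i a).size))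
    (ho : PB s (fun a => (op.apply (i a)).size)) : Comp s i (fun a => op.apply (i a)) :=
  ⟨.op op, _, fun _ => rfl, (hi.add ho).add (PB.const 1), hi, ho⟩

theorem refl (hi : PB s (fun a => (i a).size)) : Comp s i i := ofOp .id hi hi

theorem input (h : Comp s i o) : Comp s i i := refl h.pb_in

theorem trans (h : Comp s i o) (h' : Comp s o u) : Comp s i u := by
  obtain ⟨p, t, h1, h2, h3, h4⟩ := h
  obtain ⟨q, t', h1', h2', h3', h4'⟩ := h'
  refine ⟨.seq p q, fun a => t a + t' a + 1, fun a => ?_, (h2.add h2').add (PB.const 1), h3, h4'⟩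
  rw [Prog.eval, h1, Run.andThen_pure (h1' a)]

theorem comap (h : Comp s i o) (π : β → α) :
    Comp (fun b => s (π b)) (fun b => i (π b)) (fun b => o (π b)) := by
  obtain ⟨p, t, h1, h2, h3, h4⟩ := h
  exact ⟨p, fun b => t (π b), fun b => h1 _, h2.comap π, h3.comap π, h4.comap π⟩

theorem up {m : α → Type} {j : (Σ a, m a) → Val} (h : Comp s i o)
    (hE : Comp (fun b : Σ a, m a => s b.1) j (fun b => i b.1)) :
    Comp (fun b : Σ a, m a => s b.1) j (fun b => o b.1) :=
  hE.trans (h.comap Sigma.fst)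

theorem pair (h : Comp s i u) (h' : Comp s i v) : Comp s i (fun a => .pair (u a) (v a)) := by
  obtain ⟨p, t, h1, h2, h3, h4⟩ := h
  obtain ⟨q, t', h1', h2', h3', h4'⟩ := h'
  refine ⟨.pair p q, fun a => t a + (t' a + ((Val.pair (u a) (v a)).size + 1) + 1) + (i a).size,
    fun a => ?_, ?_, h3, ?_⟩
  · rw [Prog.eval, h1]
    refine Run.andThen_pure ?_
    rw [h1']
    exact Run.andThen_pure rfl
  · exact (h2.add ((h2'.add (((h4.add h4').add (PB.const 1)).add (PB.const 1))).add
      (PB.const 1))).add h3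
  · exact (h4.add h4').add (PB.const 1)

theorem fst (h : Comp s i (fun a => .pair (u a) (v a))) : Comp s i u :=
  h.trans (ofOp .fst h.pb_out (h.pb_out.mono fun a => Val.size_fst_le (.pair (u a) (v a))))

theorem snd (h : Comp s i (fun a => .pair (u a) (v a))) : Comp s i v :=
  h.trans (ofOp .snd h.pb_out (h.pb_out.mono fun a => Val.size_snd_le (.pair (u a) (v a))))

theorem const (hi : PB s (fun a => (i a).size)) (n : ℕ) : CompN s i (fun _ => n) :=
  ofOp (.const n) hi (PB.const _)

variable {f g c : α → ℕ}

theorem add (hf : CompN s i f) (hg : CompN s i g) : CompN s i (fun a => f a + g a) :=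
  (hf.pair hg).trans (ofOp .add (hf.pair hg).pb_out
    (((hf.pb_out.add hg.pb_out).add (PB.const 1)).mono fun a => by
      have := Nat.size_add_le (f a) (g a)
      simp only [Op.apply, Val.size, Val.fst, Val.snd, Val.toNat]; omega))

theorem mul (hf : CompN s i f) (hg : CompN s i g) : CompN s i (fun a => f a * g a) :=
  (hf.pair hg).trans (ofOp .mul (hf.pair hg).pb_out
    (((hf.pb_out.add hg.pb_out).add (PB.const 1)).mono fun a => by
      have := Nat.size_mul_le (f a) (g a)
      simp only [Op.apply, Val.size, Val.fst, Val.snd, Val.toNat]; omega))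

theorem sub (hf : CompN s i f) (hg : CompN s i g) : CompN s i (fun a => f a - g a) :=
  (hf.pair hg).trans (ofOp .sub (hf.pair hg).pb_out
    (hf.pb_out.mono fun a => by
      have := Nat.size_le_size (Nat.sub_le (f a) (g a))
      simp only [Op.apply, Val.size, Val.fst, Val.snd, Val.toNat]; omega))

theorem div (hf : CompN s i f) (hg : CompN s i g) : CompN s i (fun a => f a / g a) :=
  (hf.pair hg).trans (ofOp .div (hf.pair hg).pb_out
    (hf.pb_out.mono fun a => by
      have := Nat.size_le_size (Nat.div_le_self (f a) (g a))
      simp only [Op.apply, Val.size, Val.fst, Val.snd, Val.toNat]; omega))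

theorem congr {o' : α → Val} (h : Comp s i o) (e : ∀ a, o' a = o a) : Comp s i o' := by
  rwa [show o' = o from funext e]

theorem mod (hf : CompN s i f) (hg : CompN s i g) : CompN s i (fun a => f a % g a) :=
  (hf.sub (hg.mul (hf.div hg))).congr fun _ => congrArg Val.num (Nat.mod_eq_sub_mul_div)

/-- The truth value of a proposition as a number. -/
abbrev ind (c : Prop) [Decidable c] : ℕ := if c then 1 else 0

theorem le (hf : CompN s i f) (hg : CompN s i g) : CompN s i (fun a => ind (f a ≤ g a)) :=
  (hf.pair hg).trans (ofOp .le (hf.pair hg).pb_out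
    ((PB.const 2).mono fun a => by
      by_cases h : f a ≤ g a <;>
        simp [Op.apply, Val.size, Val.fst, Val.snd, Val.toNat, h]))

theorem ite' (hc : CompN s i c) (hu : Comp s i u) (hv : Comp s i v) :
    Comp s i (fun a => if c a = 0 then v a else u a) := by
  obtain ⟨r, tr, r1, r2, r3, r4⟩ := hc
  obtain ⟨p, t, h1, h2, h3, h4⟩ := hu
  obtain ⟨q, t', h1', h2', h3', h4'⟩ := hv
  refine ⟨.ite r p q, fun a => tr a + (if c a = 0 then t' a else t a) + (i a).size,
    fun a => ?_, ?_, h3, ?_⟩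
  · rw [Prog.eval, r1]
    refine Run.andThen_pure ?_
    by_cases h : c a = 0 <;> simp [Val.toNat, h, h1, h1']
  · exact ((r2.add (h2'.add h2)).mono fun a => by split <;> omega).add h3
  · exact (h4.add h4').mono fun a => by dsimp only; split <;> omega

theorem ite {P : α → Prop} [∀ a, Decidable (P a)] (hc : CompN s i (fun a => ind (P a)))
    (hu : Comp s i u) (hv : Comp s i v) : Comp s i (fun a => if P a then u a else v a) :=
  (ite' hc hu hv).congr fun a => by by_cases h : P a <;> simp [h, ind]

theorem iteN {P : α → Prop} [∀ a, Decidable (P a)] (hc : CompN s i (fun a => ind (P a)))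
    (hu : CompN s i f) (hv : CompN s i g) : CompN s i (fun a => if P a then f a else g a) :=
  (ite hc hu hv).congr fun a => by by_cases h : P a <;> simp [h]

section logic
variable {P Q : α → Prop} [∀ a, Decidable (P a)] [∀ a, Decidable (Q a)]

theorem and (hP : CompN s i (fun a => ind (P a))) (hQ : CompN s i (fun a => ind (Q a))) :
    CompN s i (fun a => ind (P a ∧ Q a)) :=
  (hP.mul hQ).congr fun a => by by_cases h : P a <;> by_cases h' : Q a <;> simp [h, h', ind]

theorem not (hP : CompN s i (fun a => ind (P a))) : CompN s i (fun a => ind (¬ P a)) :=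
  ((const hP.pb_in 1).sub hP).congr fun a => by by_cases h : P a <;> simp [h, ind]

theorem lt (hf : CompN s i f) (hg : CompN s i g) : CompN s i (fun a => ind (f a < g a)) :=
  (hg.le hf).not.congr fun a => by simp [ind]

theorem eq (hf : CompN s i f) (hg : CompN s i g) : CompN s i (fun a => ind (f a = g a)) :=
  ((hf.le hg).and (hg.le hf)).congr fun a => by
    congr 1
    exact if_congr le_antisymm_iff rfl rfl

end logic

/-! #### Loops -/

theorem _root_.NetRel.Run.iterate_pure {F : Val → Run} {st : ℕ → Val} {t : ℕ → ℕ} {B : ℕ}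
    (n k : ℕ) (hF : ∀ j, k ≤ j → j < k + n → F (st j) = PMF.pure (st (j + 1), t j))
    (ht : ∀ j, k ≤ j → j < k + n → t j ≤ B) (hs : ∀ j, j ≤ k + n → (st j).size ≤ B) :
    ∃ T ≤ n * (2 * B + n + 1) + B + 1, Run.iterate F n (st k) = PMF.pure (st (k + n), T) := by
  induction n generalizing k with
  | zero => exact ⟨_, by have := hs k (by omega); omega, rfl⟩
  | succ n ih =>
    obtain ⟨T, hT, h⟩ := ih (k + 1) (fun j h1 h2 => hF j (by omega) (by omega))
      (fun j h1 h2 => ht j (by omega) (by omega)) (fun j h => hs j (by omega))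
    refine ⟨?T, ?h1, ?h2⟩
    case h2 =>
      rw [Run.iterate, hF k le_rfl (by omega), Run.andThen_pure h,
        show k + 1 + n = k + (n + 1) by omega]
    case h1 =>
      have h1 := ht k le_rfl (by omega)
      have h2 := hs k (by omega)
      have h3 := Nat.size_le_self' n
      have h4 : n * (2 * B + n + 1) ≤ n * (2 * B + (n + 1) + 1) :=
        Nat.mul_le_mul_left _ (by omega)
      rw [Nat.succ_mul]
      omega

/-- The bound `B` on every intermediate state is indispensable, since a body that is polynomial in
its own input could make the state grow exponentially. Passing to the index type `Σ a, Fin (n a)`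
makes one polynomial serve all rounds of all instances. The body `hb` receives its own input as an
argument, from which it projects what it needs. -/
theorem iter {n : α → ℕ} {st : α → ℕ → Val} (B : α → ℕ) (hn : CompN s i n) (hpn : PB s n)
    (h0 : Comp s i (fun a => st a 0)) (hB : PB s B)
    (hs : ∀ a k, k ≤ n a → (st a k).size ≤ B a)
    (hb : Comp (fun b : Σ a, Fin (n a) => s b.1) (fun b => .pair (i b.1) (st b.1 b.2))
        (fun b => .pair (i b.1) (st b.1 b.2)) →
      Comp (fun b : Σ a, Fin (n a) => s b.1) (fun b => .pair (i b.1) (st b.1 b.2))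
        (fun b => st b.1 (b.2 + 1))) :
    Comp s i (fun a => st a (n a)) := by
  have hE : PB (fun b : Σ a, Fin (n a) => s b.1)
      (fun b => (Val.pair (i b.1) (st b.1 b.2)).size) :=
    ((hn.pb_in.up.add hB.up).add (PB.const 1)).mono fun b => by
      have := hs b.1 b.2 b.2.2.le
      simp only [Val.size]; omega
  -- Programs have no variables, so the environment `i` is carried along in the loop state and
  -- returned unchanged by each round.
  have hbody := (refl hE).fst.pair (hb (refl hE))
  obtain ⟨p, t, h1, h2, -, -⟩ := hbody
  obtain ⟨T, hT, hT'⟩ := h2.uniform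
  have hin := hn.pair (hn.input.pair h0)
  have key : ∀ a, ∃ t', (Prog.iter p).eval (.pair (.num (n a)) (.pair (i a) (st a 0))) =
      PMF.pure (.pair (i a) (st a (n a)), t') ∧
      t' ≤ ((Val.pair (.num (n a)) (.pair (i a) (st a 0))).size + 1) +
        (n a * (2 * (T a + ((i a).size + B a + 1)) + n a + 1) +
          (T a + ((i a).size + B a + 1)) + 1) + 1 := by
    intro a
    obtain ⟨T', hT1, hT2⟩ := Run.iterate_pure (F := p.eval) (st := fun k => .pair (i a) (st a k))
      (t := fun k => if h : k < n a then t ⟨a, k, h⟩ else 0) (B := T a + ((i a).size + B a + 1))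
      (n a) 0
      (fun j _ hj => by
        rw [zero_add] at hj
        rw [dif_pos hj]
        exact h1 ⟨a, j, hj⟩)
      (fun j _ hj => by
        rw [zero_add] at hj
        rw [dif_pos hj]
        exact (hT' a ⟨j, hj⟩).trans (by omega))
      (fun j hj => by
        have := hs a j (by omega)
        simp only [Val.size]; omega)
    rw [zero_add] at hT2
    refine ⟨?T, ?h1, ?h2⟩
    case h1 =>
      rw [Prog.eval, Run.ret]
      exact Run.andThen_pure (v := .pair (.num (n a)) (.pair (i a) (st a 0)))
        (f := fun y => Run.iterate p.eval y.fst.toNat y.snd) hT2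
    case h2 =>
      exact Nat.add_le_add_right (Nat.add_le_add_left hT1 _) 1
  choose t' ht' hle using key
  have hX : PB s (fun a => T a + ((i a).size + B a + 1)) :=
    hT.add ((hn.pb_in.add hB).add (PB.const 1))
  have hout : PB s (fun a => (Val.pair (i a) (st a (n a))).size) :=
    ((hn.pb_in.add hB).add (PB.const 1)).mono fun a => by
      have := hs a (n a) le_rfl
      simp only [Val.size]; omega
  have hloop : Comp s (fun a => .pair (.num (n a)) (.pair (i a) (st a 0)))
      (fun a => .pair (i a) (st a (n a))) :=
    ⟨.iter p, t', ht', PB.mono (((hin.pb_out.add (PB.const 1)).add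
      (((hpn.mul ((((PB.const 2).mul hX).add hpn).add (PB.const 1))).add hX).add
        (PB.const 1))).add (PB.const 1)) hle, hin.pb_out, hout⟩
  exact (hin.trans hloop).snd

theorem _root_.NetRel.Run.foldl_pure {F : Val → Run} {B : ℕ}
    (n : ℕ) (g : Fin n → Val) (st : ℕ → Val) (t : ℕ → ℕ)
    (hF : ∀ j : Fin n, F (.pair (g j) (st j)) = PMF.pure (st (j + 1), t j))
    (ht : ∀ j : Fin n, t j ≤ B) (hs : ∀ j, j ≤ n → (st j).size ≤ B)
    (hl : (Val.ofList (List.ofFn g)).size ≤ B) :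
    ∃ T ≤ n * (3 * B + 1) + B + 1,
      Run.foldl F (Val.ofList (List.ofFn g)) (st 0) = PMF.pure (st n, T) := by
  induction n generalizing st t with
  | zero => exact ⟨_, by have := hs 0 (by omega); omega, rfl⟩
  | succ n ih =>
    rw [List.ofFn_succ] at hl ⊢
    simp only [Val.ofList, Val.size] at hl
    obtain ⟨T, hT, h⟩ := ih (fun k => g k.succ) (fun j => st (j + 1)) (fun j => t (j + 1))
      (fun j => hF j.succ) (fun j => ht j.succ) (fun j hj => hs _ (by omega)) (by omega)
    refine ⟨?T, ?h1, ?h2⟩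
    case h2 =>
      have h0 : F (.pair (g 0) (st 0)) = PMF.pure (st 1, t 0) := hF 0
      rw [Val.ofList, Run.foldl, h0]
      exact Run.andThen_pure h
    case h1 =>
      have h1 : t 0 ≤ B := ht 0
      have h2 := hs 0 (by omega)
      rw [Nat.succ_mul]
      omega

theorem fold {n : α → ℕ} {g : ∀ a, Fin (n a) → Val} {st : α → ℕ → Val} (B : α → ℕ)
    (hl : Comp s i (fun a => Val.ofList (List.ofFn (g a))))
    (h0 : Comp s i (fun a => st a 0)) (hB : PB s B)
    (hs : ∀ a k, k ≤ n a → (st a k).size ≤ B a)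
    (hb : Comp (fun b : Σ a, Fin (n a) => s b.1)
        (fun b => .pair (i b.1) (.pair (g b.1 b.2) (st b.1 b.2)))
        (fun b => .pair (i b.1) (.pair (g b.1 b.2) (st b.1 b.2))) →
      Comp (fun b : Σ a, Fin (n a) => s b.1)
        (fun b => .pair (i b.1) (.pair (g b.1 b.2) (st b.1 b.2)))
        (fun b => st b.1 (b.2 + 1))) :
    Comp s i (fun a => st a (n a)) := by
  have hpn : PB s n := hl.pb_out.mono fun a => by
    simpa using Val.length_le_size_ofList (List.ofFn (g a))
  have hin := hl.pair (hl.input.pair h0)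
  have hE : PB (fun b : Σ a, Fin (n a) => s b.1)
      (fun b => (Val.pair (i b.1) (.pair (g b.1 b.2) (st b.1 b.2))).size) :=
    ((hl.pb_in.up.add (hl.pb_out.up.add hB.up)).add (PB.const 2)).mono fun b => by
      have := hs b.1 b.2 b.2.2.le
      have := Val.le_size_ofList_ofFn (g b.1) b.2
      simp only [Val.size]; omega
  have hE' : PB (fun b : Σ a, Fin (n a) => s b.1)
      (fun b => (Val.pair (g b.1 b.2) (.pair (i b.1) (st b.1 b.2))).size) :=
    hE.mono fun b => by simp only [Val.size]; omega
  -- The loop presents the entry first and the environment inside the state; `hb` expects the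
  -- environment first.
  have r := refl hE'
  have r' := r.snd.fst.pair (r.fst.pair r.snd.snd)
  have hbody := r.snd.fst.pair (r'.trans (hb (refl hE)))
  obtain ⟨p, t, h1, h2, -, -⟩ := hbody
  obtain ⟨T, hT, hT'⟩ := h2.uniform
  have key : ∀ a, ∃ t', (Prog.fold p).eval
      (.pair (Val.ofList (List.ofFn (g a))) (.pair (i a) (st a 0))) =
      PMF.pure (.pair (i a) (st a (n a)), t') ∧
      t' ≤ ((Val.pair (Val.ofList (List.ofFn (g a))) (.pair (i a) (st a 0))).size + 1) +
        (n a * (3 * (T a + ((i a).size + B a + 1) + (Val.ofList (List.ofFn (g a))).size) + 1) +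
          (T a + ((i a).size + B a + 1) + (Val.ofList (List.ofFn (g a))).size) + 1) + 1 := by
    intro a
    obtain ⟨T', hT1, hT2⟩ := Run.foldl_pure (F := p.eval)
      (B := T a + ((i a).size + B a + 1) + (Val.ofList (List.ofFn (g a))).size)
      (n a) (g a) (fun k => .pair (i a) (st a k))
      (fun k => if h : k < n a then t ⟨a, k, h⟩ else 0)
      (fun j => by
        rw [dif_pos j.2]
        exact h1 ⟨a, j⟩)
      (fun j => by
        rw [dif_pos j.2]
        exact (hT' a j).trans (by omega))
      (fun j hj => by
        have := hs a j (by omega)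
        simp only [Val.size]; omega) (by omega)
    refine ⟨?T, ?h1, ?h2⟩
    case h1 =>
      rw [Prog.eval, Run.ret]
      exact Run.andThen_pure
        (v := .pair (Val.ofList (List.ofFn (g a))) (.pair (i a) (st a 0)))
        (f := fun y => Run.foldl p.eval y.fst y.snd) hT2
    case h2 =>
      exact Nat.add_le_add_right (Nat.add_le_add_left hT1 _) 1
  choose t' ht' hle using key
  have hX : PB s (fun a => T a + ((i a).size + B a + 1) + (Val.ofList (List.ofFn (g a))).size) :=
    (hT.add ((hl.pb_in.add hB).add (PB.const 1))).add hl.pb_out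
  have hout : PB s (fun a => (Val.pair (i a) (st a (n a))).size) :=
    ((hl.pb_in.add hB).add (PB.const 1)).mono fun a => by
      have := hs a (n a) le_rfl
      simp only [Val.size]; omega
  have hloop : Comp s (fun a => .pair (Val.ofList (List.ofFn (g a))) (.pair (i a) (st a 0)))
      (fun a => .pair (i a) (st a (n a))) :=
    ⟨.fold p, t', ht', PB.mono (((hin.pb_out.add (PB.const 1)).add
      (((hpn.mul (((PB.const 3).mul hX).add (PB.const 1))).add hX).add
        (PB.const 1))).add (PB.const 1)) hle, hin.pb_out, hout⟩
  exact (hin.trans hloop).snd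

end Comp
-- Sums, products, maps and lookup over lists
namespace Comp

variable {α : Type} {s : α → ℕ} {i : α → Val}

section lists
variable {n : α → ℕ} {g : ∀ a, Fin (n a) → Val}

theorem pb_length (hl : Comp s i (fun a => Val.ofList (List.ofFn (g a)))) : PB s n :=
  hl.pb_out.mono fun a => by simpa using Val.length_le_size_ofList (List.ofFn (g a))

/-- The input of the body of a loop over a list: the environment and an entry of the list. -/
abbrev entry (i : α → Val) (g : ∀ a, Fin (n a) → Val) : (Σ a, Fin (n a)) → Val :=
  fun b => .pair (i b.1) (g b.1 b.2)

theorem pb_entry (hl : Comp s i (fun a => Val.ofList (List.ofFn (g a)))) :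
    PB (fun b : Σ a, Fin (n a) => s b.1) (fun b => (entry i g b).size) :=
  ((hl.pb_in.up.add hl.pb_out.up).add (PB.const 1)).mono fun b => by
    have := Val.le_size_ofList_ofFn (g b.1) b.2
    simp only [Val.size]; omega

theorem size_sum_range_le {f : ℕ → ℕ} {B k : ℕ} (h : ∀ j < k, Nat.size (f j) ≤ B) :
    Nat.size (∑ j ∈ Finset.range k, f j) ≤ k * (B + 1) := by
  induction k with
  | zero => simp [Nat.size_zero]
  | succ k ih =>
    rw [Finset.sum_range_succ, Nat.succ_mul]
    have := ih fun j hj => h j (by omega)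
    have := h k (by omega)
    have := Nat.size_add_le (∑ j ∈ Finset.range k, f j) (f k)
    omega

theorem size_prod_range_le {f : ℕ → ℕ} {B k : ℕ} (h : ∀ j < k, Nat.size (f j) ≤ B) :
    Nat.size (∏ j ∈ Finset.range k, f j) ≤ k * B + 1 := by
  induction k with
  | zero => simp [Nat.size_one]
  | succ k ih =>
    rw [Finset.prod_range_succ, Nat.succ_mul]
    have := ih fun j hj => h j (by omega)
    have := h k (by omega)
    have := Nat.size_mul_le (∏ j ∈ Finset.range k, f j) (f k)
    omega

variable {f : ∀ a, Fin (n a) → ℕ}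

theorem sum (hl : Comp s i (fun a => Val.ofList (List.ofFn (g a))))
    (hf : Comp (fun b : Σ a, Fin (n a) => s b.1) (entry i g) (entry i g) →
      CompN (fun b : Σ a, Fin (n a) => s b.1) (entry i g) (fun b => f b.1 b.2)) :
    CompN s i (fun a => ∑ k, f a k) := by
  have hf' := hf (refl hl.pb_entry)
  obtain ⟨T, hT, hT'⟩ := hf'.pb_out.uniform
  let F : ∀ a, ℕ → ℕ := fun a j => if h : j < n a then f a ⟨j, h⟩ else 0
  have hF : ∀ a (j : Fin (n a)), F a j = f a j := fun a j => dif_pos j.2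
  have hB : PB s (fun a => n a * (T a + 1) + 1) :=
    (hl.pb_length.mul (hT.add (PB.const 1))).add (PB.const 1)
  refine (fold (st := fun a k => .num (∑ j ∈ Finset.range k, F a j)) _ hl
    ((const hl.pb_in 0).congr fun a => by simp) hB (fun a k hk => ?_) (fun hE => ?_)).congr
    fun a => ?_
  · have := size_sum_range_le (f := F a) (B := T a) (k := k) fun j hj => by
      have := hT' a ⟨j, by omega⟩
      simp only [Val.size] at this
      have e := hF a ⟨j, by omega⟩
      simp only at e
      rw [e]; omega
    have h2 : k * (T a + 1) ≤ n a * (T a + 1) := Nat.mul_le_mul_right _ hk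
    simp only [Val.size]; omega
  · refine (hE.snd.snd.add ((hE.fst.pair hE.snd.fst).trans hf')).congr fun b => ?_
    simp only
    rw [Finset.sum_range_succ, hF]
  · rw [Finset.sum_range]
    simp only [hF]

theorem prod (hl : Comp s i (fun a => Val.ofList (List.ofFn (g a))))
    (hf : Comp (fun b : Σ a, Fin (n a) => s b.1) (entry i g) (entry i g) →
      CompN (fun b : Σ a, Fin (n a) => s b.1) (entry i g) (fun b => f b.1 b.2)) :
    CompN s i (fun a => ∏ k, f a k) := by
  have hf' := hf (refl hl.pb_entry)
  obtain ⟨T, hT, hT'⟩ := hf'.pb_out.uniform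
  let F : ∀ a, ℕ → ℕ := fun a j => if h : j < n a then f a ⟨j, h⟩ else 0
  have hF : ∀ a (j : Fin (n a)), F a j = f a j := fun a j => dif_pos j.2
  have hB : PB s (fun a => n a * T a + 2) :=
    (hl.pb_length.mul hT).add (PB.const 2)
  refine (fold (st := fun a k => .num (∏ j ∈ Finset.range k, F a j)) _ hl
    ((const hl.pb_in 1).congr fun a => by simp) hB (fun a k hk => ?_) (fun hE => ?_)).congr
    fun a => ?_
  · have := size_prod_range_le (f := F a) (B := T a) (k := k) fun j hj => by
      have := hT' a ⟨j, by omega⟩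
      simp only [Val.size] at this
      have e := hF a ⟨j, by omega⟩
      simp only at e
      rw [e]; omega
    have h2 : k * T a ≤ n a * T a := Nat.mul_le_mul_right _ hk
    simp only [Val.size]; omega
  · refine (hE.snd.snd.mul ((hE.fst.pair hE.snd.fst).trans hf')).congr fun b => ?_
    simp only
    rw [Finset.prod_range_succ, hF]
  · rw [Finset.prod_range]
    simp only [hF]

theorem length (hl : Comp s i (fun a => Val.ofList (List.ofFn (g a)))) : CompN s i n :=
  (sum (f := fun _ _ => 1) hl fun hE => const hE.pb_in 1).congr fun a => by simp

/-- A fold builds its result by prepending, so the entries come out in reverse order. Applying this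
twice gives `map`. -/
theorem map_rev {f : ∀ a, Fin (n a) → Val}
    (hl : Comp s i (fun a => Val.ofList (List.ofFn (g a))))
    (hf : Comp (fun b : Σ a, Fin (n a) => s b.1) (entry i g) (entry i g) →
      Comp (fun b : Σ a, Fin (n a) => s b.1) (entry i g) (fun b => f b.1 b.2)) :
    Comp s i (fun a => Val.ofList (List.ofFn fun k => f a k.rev)) := by
  have hf' := hf (refl hl.pb_entry)
  obtain ⟨T, hT, hT'⟩ := hf'.pb_out.uniform
  let F : ∀ a, ℕ → Val := fun a j => if h : j < n a then f a ⟨j, h⟩ else .num 0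
  have hF : ∀ a (j : Fin (n a)), F a j = f a j := fun a j => dif_pos j.2
  have hB : PB s (fun a => n a * (T a + 1) + 1) :=
    (hl.pb_length.mul (hT.add (PB.const 1))).add (PB.const 1)
  refine (fold (st := fun a k => Val.ofList (List.ofFn fun j : Fin k => F a (k - 1 - j))) _ hl
    ((const hl.pb_in 0).congr fun a => by simp [Val.ofList]) hB (fun a k hk => ?_)
    (fun hE => ?_)).congr fun a => ?_
  · refine (Val.size_ofList_ofFn_le (B := T a) fun j => ?_).trans
      (Nat.succ_le_succ (Nat.mul_le_mul_right _ hk))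
    have hj : k - 1 - j < n a := by have := j.2; omega
    have e := hF a ⟨k - 1 - j, hj⟩
    simp only at e
    rw [e]
    exact hT' a _
  · refine (((hE.fst.pair hE.snd.fst).trans hf').pair hE.snd.snd).congr fun b => ?_
    rw [List.ofFn_succ, Val.ofList]
    simp only [Fin.val_zero, add_tsub_cancel_right, tsub_zero, hF, Fin.val_succ]
    congr 4
    funext j
    congr 1
    omega
  · congr 2
    funext k
    have e := hF a k.rev
    rw [Fin.val_rev] at e
    rw [← e]
    congr 1
    omega

theorem map {f : ∀ a, Fin (n a) → Val}
    (hl : Comp s i (fun a => Val.ofList (List.ofFn (g a))))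
    (hf : Comp (fun b : Σ a, Fin (n a) => s b.1) (entry i g) (entry i g) →
      Comp (fun b : Σ a, Fin (n a) => s b.1) (entry i g) (fun b => f b.1 b.2)) :
    Comp s i (fun a => Val.ofList (List.ofFn (f a))) :=
  (map_rev (f := fun a k => f a k.rev) (map_rev hl hf) fun hE => hE.snd).congr fun a => by
    simp only [Fin.rev_rev]

/-- The entry at position `u` of a list of numbers, each preceded by its position. -/
theorem lookup (u : ∀ a, Fin (n a))
    (hl : Comp s i (fun a => Val.ofList (List.ofFn fun k => .pair (.num (k : ℕ)) (.num (f a k)))))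
    (hu : CompN s i (fun a => (u a : ℕ))) : CompN s i (fun a => f a (u a)) :=
  -- In place of random access, the whole list is summed with every other position masked by zero.
  (sum (f := fun a k => if (k : ℕ) = u a then f a k else 0) hl fun hE =>
    iteN (hE.snd.fst.eq (hu.up hE.fst)) hE.snd.snd (const hE.pb_in 0)).congr fun a => by
      simp only [Fin.val_inj, Finset.sum_ite_eq', Finset.mem_univ, if_true]

end lists

/-- The value of the exponent, not just its length, has to be polynomially bounded: it is both the
number of rounds and a factor of the length of the result. -/
theorem pow {x y : α → ℕ} (hx : CompN s i x) (hy : CompN s i y) (hpy : PB s y) :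
    CompN s i (fun a => x a ^ y a) := by
  have hB : PB s (fun a => y a * Nat.size (x a) + 2) :=
    (hpy.mul (hx.pb_out.mono fun a => by simp only [Val.size]; omega)).add (PB.const 2)
  refine iter (st := fun a k => .num (x a ^ k)) _ hy hpy
    ((const hx.pb_in 1).congr fun a => by simp) hB (fun a k hk => ?_) fun hE =>
    (hE.snd.mul (hx.up hE.fst)).congr fun b => ?_
  · have := size_prod_range_le (f := fun _ => x a) (B := Nat.size (x a)) (k := k)
      fun j hj => le_rfl
    have h2 : k * Nat.size (x a) ≤ y a * Nat.size (x a) := Nat.mul_le_mul_right _ hk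
    simp only [Finset.prod_const, Finset.card_range] at this
    simp only [Val.size]; omega
  · simp only [pow_succ]

end Comp

/-! ### Coin flips -/

open PMF

theorem Run.andThen_map {ι : Type} {p : PMF ι} {F : ι → Val × ℕ} {k : ℕ} {f : Val → Run}
    {u : ι → Val} {t : ι → ℕ} (h : ∀ y, f (F y).1 = PMF.pure (u y, t y)) :
    Run.andThen k (p.map F) f = p.map (fun y => (u y, (F y).2 + t y + k)) := by
  unfold Run.andThen
  rw [PMF.bind_map, ← PMF.bind_pure_comp]
  congr 1
  funext y
  simp only [Function.comp, h, PMF.pure_map]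

theorem Run.andThen_pure_map {ι : Type} {p : PMF ι} {G : ι → Val × ℕ} {k t : ℕ} {v : Val}
    {f : Val → Run} (h : f v = p.map G) :
    Run.andThen k (PMF.pure (v, t)) f = p.map (fun y => ((G y).1, t + (G y).2 + k)) := by
  unfold Run.andThen
  rw [PMF.pure_bind, h, PMF.map_comp]
  rfl

theorem Run.andThen_map_map {ι κ : Type} {p : PMF ι} {q : PMF κ} {F : ι → Val × ℕ} {k : ℕ}
    {f : Val → Run} {G : ι → κ → Val × ℕ} (h : ∀ y, f (F y).1 = q.map (G y)) :
    Run.andThen k (p.map F) f =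
      p.bind fun y => q.map fun z => ((G y z).1, (F y).2 + (G y z).2 + k) := by
  unfold Run.andThen
  rw [PMF.bind_map]
  congr 1
  funext y
  simp only [Function.comp, h, PMF.map_comp]
  rfl

/-- Merges two independent uniform draws into one uniform draw from a set in bijection with the
pairs. -/
theorem uniform_bind_map {A B C : Type} [Fintype A] [Nonempty A] [Fintype B] [Nonempty B]
    [Fintype C] [Nonempty C] {δ : Type} (e : A × B ≃ C) (H : A → B → δ) (G : C → δ)
    (hG : ∀ a b, G (e (a, b)) = H a b) :
    ((uniformOfFintype A).bind fun a => (uniformOfFintype B).map (H a)) =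
      (uniformOfFintype C).map G := by
  classical
  ext d
  rw [PMF.bind_apply, PMF.map_apply, ← e.tsum_eq, ENNReal.tsum_prod']
  refine tsum_congr fun a => ?_
  rw [PMF.map_apply, ← ENNReal.tsum_mul_left]
  refine tsum_congr fun b => ?_
  rw [hG, mul_ite, mul_zero]
  refine if_congr Iff.rfl ?_ rfl
  rw [uniformOfFintype_apply, uniformOfFintype_apply, uniformOfFintype_apply,
    ← Fintype.card_congr e, Fintype.card_prod, Nat.cast_mul, ENNReal.mul_inv (by simp) (by simp)]

/-- Each round appends a random bit to the state. After `j` flips the state is below `2 ^ j`, which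
bounds its length throughout; the remaining `k` flips append a uniform `k`-bit number. The step
count may depend on the flips, so it is a function of `y` with a uniform bound. -/
theorem iterate_flips {F : Val → Run} {K T : ℕ}
    (hF : ∀ x < 2 ^ K, ∃ c : Bool → ℕ, (∀ b, c b ≤ T) ∧
      F (.num x) = (uniformOfFintype Bool).map fun b => (.num (2 * x + b.toNat), c b))
    (k : ℕ) : ∀ j x, k + j ≤ K → x < 2 ^ j →
      ∃ t : Fin (2 ^ k) → ℕ, (∀ y, t y ≤ k * (T + 2 * K + 3) + K + 3) ∧
        Run.iterate F k (.num x) =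
          (uniformOfFintype (Fin (2 ^ k))).map fun y => (.num (x * 2 ^ k + y), t y) := by
  induction k with
  | zero =>
    intro j x hj hx
    refine ⟨fun _ => (Val.num x).size + 1, fun _ => ?_, ?_⟩
    · have : Nat.size x ≤ j := Nat.size_le.2 hx
      simp only [Val.size]; omega
    · have : (fun y : Fin (2 ^ 0) => (Val.num (x * 2 ^ 0 + y), (Val.num x).size + 1)) =
          Function.const _ (Val.num x, (Val.num x).size + 1) := by
        funext y
        have := y.2
        simp only [Function.const, Prod.mk.injEq, Val.num.injEq, and_true]
        omega
      rw [this, PMF.map_const]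
      rfl
  | succ k ih =>
    intro j x hj hx
    have hxK : x < 2 ^ K := hx.trans_le (Nat.pow_le_pow_right (by simp) (by omega))
    obtain ⟨c, hc, h⟩ := hF x hxK
    have hstep : ∀ b : Bool, 2 * x + b.toNat < 2 ^ (j + 1) := fun b => by
      rw [pow_succ]; cases b <;> simp <;> omega
    choose t ht h' using fun b : Bool => ih (j + 1) (2 * x + b.toNat) (by omega) (hstep b)
    -- The bit drawn first ends up above the `k` bits drawn later.
    let e : Bool × Fin (2 ^ k) ≃ Fin (2 ^ (k + 1)) :=
      ((finTwoEquiv.symm.prodCongr (Equiv.refl _)).trans finProdFinEquiv).trans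
        (finCongr (by rw [pow_succ, mul_comm]))
    have he : ∀ b y, (e (b, y) : ℕ) = y + 2 ^ k * b.toNat := by
      intro b y
      cases b <;> rfl
    refine ⟨fun z => c (e.symm z).1 + t (e.symm z).1 (e.symm z).2 +
      ((Val.num x).size + Nat.size k + 1), fun z => ?_, ?_⟩
    · have h1 : Nat.size x ≤ j := Nat.size_le.2 hx
      have h2 := Nat.size_le_self' k
      have h3 := hc (e.symm z).1
      have h4 := ht (e.symm z).1 (e.symm z).2
      rw [Nat.succ_mul]
      simp only [Val.size]; omega
    · rw [Run.iterate, h, Run.andThen_map_map h']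
      refine uniform_bind_map e _ _ fun b y => ?_
      simp only [Equiv.symm_apply_apply, he, Prod.mk.injEq, Val.num.injEq, and_true]
      rw [pow_succ]
      ring

/-- A deterministic program that is given `K` random bits, as a number below `2 ^ K`, yields a
randomized program. -/
theorem exists_prog_of_comp {α : Type} {s : α → ℕ} {i : α → Val} {K : α → ℕ}
    {out : (Σ a, Fin (2 ^ K a)) → Val} (hK : CompN s i K) (hpK : PB s K)
    (h : Comp (fun b : Σ a, Fin (2 ^ K a) => s b.1) (fun b => .pair (i b.1) (.num b.2)) out) :
    ∃ (A : Prog) (T : α → ℕ), PB s T ∧ ∀ a, ∃ t : Fin (2 ^ K a) → ℕ, (∀ y, t y ≤ T a) ∧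
      A.eval (i a) = (uniformOfFintype (Fin (2 ^ K a))).map fun y => (out ⟨a, y⟩, t y) := by
  have hx : PB (fun b : Σ a, Fin (2 ^ K a) => s b.1) (fun b => (Val.num b.2).size) :=
    (hpK.up.add (PB.const 1)).mono fun b => by
      have : Nat.size b.2 ≤ K b.1 := Nat.size_le.2 b.2.2
      simp only [Val.size]; omega
  have hd : CompN (fun b : Σ a, Fin (2 ^ K a) => s b.1) (fun b => .num b.2)
      (fun b => b.2 + b.2) := (Comp.refl hx).add (Comp.refl hx)
  obtain ⟨p, tp, p1, p2, -, p4⟩ := hd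
  have hin : PB (fun b : (Σ a, Fin (2 ^ K a)) × Bool => s b.1.1)
      (fun b => (Val.pair (.num (b.1.2 + b.1.2)) (.num b.2.toNat)).size) :=
    ((p4.comap Prod.fst).add (PB.const 3)).mono fun b => by
      have : Nat.size b.2.toNat ≤ b.2.toNat := Nat.size_le_self' _
      have := b.2.toNat_le
      simp only [Val.size]; omega
  have ha : CompN (fun b : (Σ a, Fin (2 ^ K a)) × Bool => s b.1.1)
      (fun b => .pair (.num (b.1.2 + b.1.2)) (.num b.2.toNat))
      (fun b => b.1.2 + b.1.2 + b.2.toNat) := (Comp.refl hin).fst.add (Comp.refl hin).snd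
  obtain ⟨q, tq, q1, q2, -, -⟩ := ha
  have hflip : ∃ U : α → ℕ, PB s U ∧ ∀ a, ∀ x < 2 ^ K a, ∃ c : Bool → ℕ, (∀ b, c b ≤ U a) ∧
      (Prog.seq (.pair p .flip) q).eval (.num x) =
        (uniformOfFintype Bool).map fun b => (.num (2 * x + b.toNat), c b) := by
    have hc : PB (fun b : (Σ a, Fin (2 ^ K a)) × Bool => s b.1.1) (fun b =>
        (tp b.1 + ((Val.num b.1.2).size + 3 +
          ((Val.pair (.num (b.1.2 + b.1.2)) (.num b.2.toNat)).size + 1) + 1) +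
          (Val.num b.1.2).size) + tq b + 1) :=
      (((((p2.comap Prod.fst).add ((((hx.comap Prod.fst).add (PB.const 3)).add
        (hin.add (PB.const 1))).add (PB.const 1)))).add (hx.comap Prod.fst)).add q2).add
        (PB.const 1)
    obtain ⟨P, hP⟩ := hc
    refine ⟨fun a => P.eval (s a), ⟨P, fun _ => le_rfl⟩, fun a x hx =>
      ⟨_, fun b => hP (⟨a, x, hx⟩, b), ?_⟩⟩
    have e1 : p.eval (.num x) = PMF.pure (.num (x + x), tp ⟨a, x, hx⟩) := p1 ⟨a, x, hx⟩
    have e2 : ((Prog.flip.eval (.num x)).andThen 1 fun z =>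
        Run.ret (.pair (.num (x + x)) z)) = (uniformOfFintype Bool).map fun b =>
          (.pair (.num (x + x)) (.num b.toNat), (Val.num x).size + 3 +
            ((Val.pair (.num (x + x)) (.num b.toNat)).size + 1) + 1) :=
      Run.andThen_map fun b => rfl
    rw [Prog.eval, Prog.eval, e1, Run.andThen_pure_map
      (f := fun y => (Prog.flip.eval (.num x)).andThen 1 fun z => Run.ret (.pair y z)) e2,
      Run.andThen_map fun b => q1 (⟨a, x, hx⟩, b)]
    simp only [two_mul]
  obtain ⟨U, hU, hU'⟩ := hflip
  have hKin : Comp s i (fun a => .pair (.num (K a)) (.num 0)) := hK.pair (Comp.const hK.pb_in 0)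
  have hK4 := hKin.pb_out
  obtain ⟨r, tr, r1, r2, r3, -⟩ := hKin
  obtain ⟨w, tw, w1, w2, w3, -⟩ := h
  obtain ⟨W, hW, hW'⟩ := w2.uniform
  -- The program keeps a copy of the input, generates the random number next to it, and hands the
  -- pair to the deterministic program `w`.
  refine ⟨.seq (.pair (.op .id) (.seq r (.iter (.seq (.pair p .flip) q)))) w,
    fun a => ((i a).size + (i a).size + 1) + ((tr a + ((Val.pair (.num (K a)) (.num 0)).size + 1 +
      (K a * (U a + 2 * K a + 3) + K a + 3) + 1) + 1) +
      (((i a).size + (K a + 1) + 1) + 1) + 1) + (i a).size + W a + 1, ?_, fun a => ?_⟩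
  · have hA : PB s (fun a => K a * (U a + 2 * K a + 3) + K a + 3) :=
      ((hpK.mul ((hU.add ((PB.const 2).mul hpK)).add (PB.const 3))).add hpK).add (PB.const 3)
    exact (((((r3.add r3).add (PB.const 1)).add ((((r2.add (((hK4.add (PB.const 1)).add hA).add
      (PB.const 1))).add (PB.const 1)).add (((r3.add (hpK.add (PB.const 1))).add
      (PB.const 1)).add (PB.const 1))).add (PB.const 1))).add r3).add hW).add (PB.const 1)
  · obtain ⟨t, ht, h'⟩ := iterate_flips (hU' a) (K a) 0 0 (by omega) (by simp)
    have e1 : (Prog.iter (.seq (.pair p .flip) q)).eval (.pair (.num (K a)) (.num 0)) =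
        (uniformOfFintype (Fin (2 ^ K a))).map fun y => (.num (0 * 2 ^ K a + y),
          (Val.pair (.num (K a)) (.num 0)).size + 1 + t y + 1) := by
      rw [Prog.eval, Run.ret]
      exact Run.andThen_pure_map (v := .pair (.num (K a)) (.num 0))
        (f := fun y => Run.iterate (Prog.seq (.pair p .flip) q).eval y.fst.toNat y.snd) h'
    have e2 : (Prog.seq r (.iter (.seq (.pair p .flip) q))).eval (i a) =
        (uniformOfFintype (Fin (2 ^ K a))).map fun y => (.num (0 * 2 ^ K a + y),
          tr a + ((Val.pair (.num (K a)) (.num 0)).size + 1 + t y + 1) + 1) := by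
      rw [Prog.eval, r1]
      exact Run.andThen_pure_map e1
    have e3 : ((Prog.seq r (.iter (.seq (.pair p .flip) q))).eval (i a)).andThen 1
        (fun z => Run.ret (.pair (i a) z)) =
        (uniformOfFintype (Fin (2 ^ K a))).map fun y => (.pair (i a) (.num (0 * 2 ^ K a + y)),
          tr a + ((Val.pair (.num (K a)) (.num 0)).size + 1 + t y + 1) + 1 +
          ((Val.pair (i a) (.num (0 * 2 ^ K a + y))).size + 1) + 1) := by
      rw [e2]
      exact Run.andThen_map fun b => rfl
    have e4 : (Prog.pair (.op .id) (.seq r (.iter (.seq (.pair p .flip) q)))).eval (i a) =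
        (uniformOfFintype (Fin (2 ^ K a))).map fun y => (.pair (i a) (.num (0 * 2 ^ K a + y)),
          ((i a).size + (i a).size + 1) +
          (tr a + ((Val.pair (.num (K a)) (.num 0)).size + 1 + t y + 1) + 1 +
          ((Val.pair (i a) (.num (0 * 2 ^ K a + y))).size + 1) + 1) + (i a).size) := by
      rw [Prog.eval, Prog.eval]
      exact Run.andThen_pure_map (v := i a) (f := fun y => ((Prog.seq r (.iter (.seq (.pair p
        .flip) q))).eval (i a)).andThen 1 (fun z => Run.ret (.pair y z))) e3
    refine ⟨?t, ?h1, ?h2⟩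
    case h2 =>
      rw [Prog.eval, e4]
      refine Run.andThen_map (t := fun y => tw ⟨a, y⟩) fun y => ?_
      simp only [zero_mul, zero_add]
      exact w1 ⟨a, y⟩
    case h1 =>
      intro y
      have h1 := ht y
      have h2 := hW' a y
      have h3 : Nat.size (0 * 2 ^ K a + y) ≤ K a := Nat.size_le.2 (by simp)
      simp only [Val.size] at *
      omega


/-! ### Cuts, colorings and contractions -/

section cuts

variable {V ι κ μ : Type} (ends : ι → V × V)

/-- The edge `e` joins vertices of different colors. -/
def Cross (χ : V → κ) (e : ι) : Prop := χ (ends e).1 ≠ χ (ends e).2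

instance [DecidableEq κ] (χ : V → κ) (e : ι) : Decidable (Cross ends χ e) :=
  inferInstanceAs (Decidable (_ ≠ _))

/-- The coloring uses at least two colors. -/
def Nonconst (χ : V → κ) : Prop := ∃ x y, χ x ≠ χ y

instance [Fintype V] [DecidableEq κ] (χ : V → κ) : Decidable (Nonconst χ) :=
  inferInstanceAs (Decidable (∃ _, _))

/-- The coloring `ψ` is constant on the blocks of the labelling `l`. -/
def Compat (l : V → μ) (ψ : V → κ) : Prop := ∀ x y, l x = l y → ψ x = ψ y

instance [Fintype V] [DecidableEq κ] [DecidableEq μ] (l : V → μ) (ψ : V → κ) :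
    Decidable (Compat l ψ) :=
  inferInstanceAs (Decidable (∀ _, _))

/-- The labelling obtained from `l` by merging the blocks joined by the edge `e`. -/
def merge [DecidableEq μ] (l : V → μ) (e : ι) : V → μ :=
  fun x => if l x = l (ends e).1 then l (ends e).2 else l x

/-- The weight of the edges that join vertices of different colors. -/
def wt [Fintype ι] [DecidableEq κ] (w : ι → ℕ) (χ : V → κ) : ℕ :=
  ∑ e, if Cross ends χ e then w e else 0

/-- The probability that all edges joining vertices of different colors fail. -/
noncomputable def cp [Fintype ι] [DecidableEq κ] (p : ι → ℝ) (χ : V → κ) : ℝ :=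
  ∏ e, if Cross ends χ e then p e else 1

/-- The number of blocks of a labelling. -/
def blocks [Fintype V] [DecidableEq μ] (l : V → μ) : ℕ := (Finset.univ.image l).card

variable {ends}

/-- This turns contraction into a statement about colorings: contracting `e` keeps precisely those
colorings that `e` does not cross. All contraction arguments below use only this and the block
count. -/
theorem compat_merge [DecidableEq μ] {l : V → μ} {e : ι} {ψ : V → κ} :
    Compat (merge ends l e) ψ ↔ Compat l ψ ∧ ¬ Cross ends ψ e := by
  constructor
  · intro h
    refine ⟨fun x y hxy => h x y (by simp only [merge, hxy]), ?_⟩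
    rw [Cross, not_not]
    refine h _ _ ?_
    simp only [merge, if_true]
    split <;> rfl
  · rintro ⟨h, he⟩ x y hxy
    rw [Cross, not_not] at he
    simp only [merge] at hxy
    split_ifs at hxy with h1 h2 h2
    · exact h _ _ (h1.trans h2.symm)
    · rw [h _ _ h1, he, h _ _ hxy]
    · rw [h _ _ hxy, ← he, h _ _ h2]
    · exact h _ _ hxy

/-- Exactly the label of the first end of `e` disappears; all other labels are still in use. -/
theorem blocks_merge [Fintype V] [DecidableEq μ] {l : V → μ} {e : ι} (he : Cross ends l e) :
    blocks (merge ends l e) + 1 = blocks l := by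
  have : Finset.univ.image (merge ends l e) = (Finset.univ.image l).erase (l (ends e).1) := by
    ext b
    simp only [Finset.mem_image, Finset.mem_univ, true_and, Finset.mem_erase, merge]
    constructor
    · rintro ⟨x, rfl⟩
      split_ifs with h
      · exact ⟨he.symm, _, rfl⟩
      · exact ⟨h, _, rfl⟩
    · rintro ⟨hb, x, rfl⟩
      exact ⟨x, by rw [if_neg hb]⟩
  rw [blocks, this, Finset.card_erase_add_one (by simp), blocks]

theorem Compat.cross [Fintype V] {l : V → μ} {ψ : V → κ} (h : Compat l ψ) {e : ι}
    (he : Cross ends ψ e) : Cross ends l e := fun h' => he (h _ _ h')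

theorem nonconst_of_two_le_blocks [Fintype V] [DecidableEq μ] {l : V → μ} (h : 2 ≤ blocks l) :
    Nonconst l := by
  obtain ⟨a, ha, b, hb, hab⟩ := Finset.one_lt_card.1 h
  simp only [Finset.mem_image, Finset.mem_univ, true_and] at ha hb
  obtain ⟨x, rfl⟩ := ha
  obtain ⟨y, rfl⟩ := hb
  exact ⟨x, y, hab⟩

variable [Fintype V] [Fintype ι] [DecidableEq κ] [DecidableEq μ]

/-- An edge across `ψ` also joins different blocks of `l`. The second summand is the weight of those
contractions that spare `ψ`. -/
theorem wt_compat {w : ι → ℕ} {l : V → μ} {ψ : V → κ} (h : Compat l ψ) :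
    wt ends w ψ + ∑ e, (if Cross ends l e ∧ ¬ Cross ends ψ e then w e else 0) =
      wt ends w l := by
  rw [wt, wt, ← Finset.sum_add_distrib]
  refine Finset.sum_congr rfl fun e _ => ?_
  by_cases h1 : Cross ends ψ e
  · simp [h1, h.cross h1]
  · by_cases h2 : Cross ends l e <;> simp [h1, h2]

/-- A labelling with `k` blocks cuts at least `k / 2` times the weight of a minimum cut. -/
theorem blocks_mul_le {w : ι → ℕ} {c : ℕ}
    (hc : ∀ χ : V → Fin 2, Nonconst χ → c ≤ wt ends w χ) {l : V → μ} (hl : Nonconst l) :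
    blocks l * c ≤ 2 * wt ends w l := by
  -- `χ b` separates the block `b` from the rest. Summed over the blocks, an edge between two blocks
  -- is counted twice, once for each of its end blocks.
  let χ : μ → V → Fin 2 := fun b v => if l v = b then 1 else 0
  have h1 : ∀ b ∈ Finset.univ.image l, c ≤ wt ends w (χ b) := by
    intro b hb
    refine hc _ ?_
    simp only [Finset.mem_image, Finset.mem_univ, true_and] at hb
    obtain ⟨v, rfl⟩ := hb
    obtain ⟨x, y, hxy⟩ := hl
    by_cases hx : l x = l v
    · exact ⟨v, y, by simp [χ, ← hx, Ne.symm hxy]⟩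
    · exact ⟨v, x, by simp [χ, hx]⟩
  have h2 := Finset.card_nsmul_le_sum _ _ _ h1
  rw [smul_eq_mul] at h2
  refine h2.trans (le_of_eq ?_)
  simp only [wt]
  rw [Finset.sum_comm, Finset.mul_sum]
  refine Finset.sum_congr rfl fun e _ => ?_
  by_cases h : Cross ends l e
  · have : (Finset.univ.image l).filter (fun b => Cross ends (χ b) e) =
        {l (ends e).1, l (ends e).2} := by
      ext b
      simp only [Finset.mem_filter, Finset.mem_image, Finset.mem_univ, true_and,
        Finset.mem_insert, Finset.mem_singleton]
      simp only [Cross, χ] at h ⊢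
      constructor
      · rintro ⟨-, h'⟩
        by_contra hcon
        push Not at hcon
        simp [hcon.1.symm, hcon.2.symm] at h'
      · rintro (rfl | rfl)
        · exact ⟨⟨_, rfl⟩, by simp [Ne.symm h]⟩
        · exact ⟨⟨_, rfl⟩, by simp [h]⟩
    rw [← Finset.sum_filter, this, Finset.sum_pair h, if_pos h]
    ring
  · rw [if_neg h, mul_zero]
    refine Finset.sum_eq_zero fun b _ => if_neg ?_
    rw [Cross, not_not] at h
    simp [Cross, χ, h]

/-- A compatible coloring is determined by its values on one representative per block. -/
theorem card_compat_le [Fintype κ] [DecidableEq V] (l : V → μ) :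
    (Finset.univ.filter fun ψ : V → κ => Compat l ψ).card ≤ Fintype.card κ ^ blocks l := by
  classical
  let I := {b // b ∈ Finset.univ.image l}
  have i1 : Fintype I := inferInstanceAs (Fintype {b // b ∈ Finset.univ.image l})
  have i2 : DecidableEq I := Subtype.instDecidableEq
  have : Fintype.card κ ^ blocks l =
      Fintype.card (I → κ) := by
    rw [Fintype.card_fun, Fintype.card_coe, blocks]
  have hex : ∀ b : I, ∃ v, l v = b := fun b =>
    let ⟨v, _, hv⟩ := Finset.mem_image.1 b.2
    ⟨v, hv⟩
  choose v hv using hex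
  rw [this, ← Finset.card_univ]
  refine Finset.card_le_card_of_injOn (fun ψ b => ψ (v b)) (fun _ _ => Finset.mem_univ _) ?_
  intro ψ hψ φ hφ h
  simp only [Finset.coe_filter, Finset.mem_univ, true_and, Set.mem_ofPred_eq] at hψ hφ
  funext x
  have hx := congrFun h ⟨l x, by simp⟩
  have e := hv ⟨l x, by simp⟩
  rw [← hψ _ _ e, ← hφ _ _ e]
  exact hx

/-- The number of colorings of small weight that are constant on the blocks of a labelling. -/
theorem card_small_le_choose [Fintype κ] [Nonempty κ] [DecidableEq V] {w : ι → ℕ} {c : ℕ}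
    (hc0 : 0 < c) (hc : ∀ χ : V → Fin 2, Nonconst χ → c ≤ wt ends w χ) {j : ℕ} (hj : 0 < j)
    (d : ℕ) : ∀ l : V → μ, blocks l = j + d →
      (Finset.univ.filter fun ψ : V → κ => Compat l ψ ∧ 2 * wt ends w ψ ≤ j * c).card ≤
        Fintype.card κ ^ j * (j + d).choose j := by
  induction d with
  | zero =>
    intro l hl
    rw [add_zero] at hl
    rw [add_zero, Nat.choose_self, mul_one, ← hl]
    refine (Finset.card_le_card fun ψ => ?_).trans (card_compat_le (κ := κ) l)
    simp only [Finset.mem_filter, Finset.mem_univ, true_and]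
    exact And.left
  | succ d ih =>
    intro l hl
    set A := Finset.univ.filter fun ψ : V → κ => Compat l ψ ∧ 2 * wt ends w ψ ≤ j * c with hA
    have hn : Nonconst l := nonconst_of_two_le_blocks (by omega)
    have hb := blocks_mul_le hc hn
    have hW : 0 < wt ends w l := by
      have : 0 < blocks l * c := Nat.mul_pos (by omega) hc0
      omega
    -- Double counting of the pairs of a light coloring `ψ` and an edge `e` whose contraction spares
    -- `ψ`, weighted by `w e`. For fixed `e` the colorings are compatible with the merged labelling,
    -- which has `j + d` blocks, and the induction hypothesis applies.
    have h1 : ∑ ψ ∈ A, ∑ e, (if Cross ends l e ∧ ¬ Cross ends ψ e then w e else 0) ≤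
        wt ends w l * (Fintype.card κ ^ j * (j + d).choose j) := by
      rw [Finset.sum_comm, wt, Finset.sum_mul]
      refine Finset.sum_le_sum fun e _ => ?_
      by_cases he : Cross ends l e
      · have hm := ih (merge ends l e) (by have := blocks_merge he; omega)
        simp only [he, true_and, if_true]
        rw [← Finset.sum_filter, Finset.sum_const, smul_eq_mul, mul_comm]
        refine Nat.mul_le_mul_left _ (le_trans (Finset.card_le_card fun ψ => ?_) hm)
        simp only [hA, Finset.mem_filter, Finset.mem_univ, true_and, compat_merge]
        tauto
      · simp [he]
    -- For fixed `ψ`, the contractions that spare it carry at least the fraction `(d + 1) / (j + d +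
    -- 1)` of the weight `W` of `l`, because `2 wt ψ ≤ j c` and `(j + d + 1) c ≤ 2 W`.
    have h2 : ∀ ψ ∈ A, (d + 1) * wt ends w l ≤ (j + (d + 1)) *
        ∑ e, (if Cross ends l e ∧ ¬ Cross ends ψ e then w e else 0) := by
      intro ψ hψ
      simp only [hA, Finset.mem_filter, Finset.mem_univ, true_and] at hψ
      have e := wt_compat (ends := ends) (w := w) hψ.1
      set R := ∑ e, (if Cross ends l e ∧ ¬ Cross ends ψ e then w e else 0)
      have h3 := hψ.2
      rw [hl] at hb
      nlinarith [Nat.mul_le_mul_left (j + (d + 1)) h3, Nat.mul_le_mul_left j hb]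
    have h3 := Finset.card_nsmul_le_sum _ _ _ h2
    rw [← Finset.mul_sum, smul_eq_mul] at h3
    have h4 : (A.card * (d + 1)) * wt ends w l ≤
        ((Fintype.card κ ^ j * (j + (d + 1)).choose j) * (d + 1)) * wt ends w l := by
      have h5 := Nat.choose_mul_succ_eq (j + d) j
      have h6 : j + d + 1 - j = d + 1 := by omega
      rw [h6] at h5
      calc A.card * (d + 1) * wt ends w l
          = A.card * ((d + 1) * wt ends w l) := by ring
        _ ≤ (j + (d + 1)) * (wt ends w l * (Fintype.card κ ^ j * (j + d).choose j)) :=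
            h3.trans (Nat.mul_le_mul_left _ h1)
        _ = Fintype.card κ ^ j * ((j + d).choose j * (j + d + 1)) * wt ends w l := by ring
        _ = _ := by rw [h5, ← add_assoc]; ring
    exact Nat.le_of_mul_le_mul_right (Nat.le_of_mul_le_mul_right h4 hW) (Nat.succ_pos d)

theorem card_small_le [Fintype κ] [Nonempty κ] [Nonempty V] [DecidableEq V] {w : ι → ℕ} {c : ℕ}
    (hc0 : 0 < c) (hc : ∀ χ : V → Fin 2, Nonconst χ → c ≤ wt ends w χ) {j : ℕ} (hj : 0 < j) :
    (Finset.univ.filter fun ψ : V → κ => 2 * wt ends w ψ ≤ j * c).card ≤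
      (Fintype.card κ * Fintype.card V) ^ j := by
  have hb : blocks (id : V → V) = Fintype.card V := by simp [blocks]
  have hκ : 0 < Fintype.card κ := Fintype.card_pos
  have hV : 0 < Fintype.card V := Fintype.card_pos
  rw [mul_pow]
  by_cases h : j ≤ Fintype.card V
  · have := card_small_le_choose (κ := κ) hc0 hc hj (Fintype.card V - j) (id : V → V)
      (by rw [hb]; omega)
    rw [show j + (Fintype.card V - j) = Fintype.card V by omega] at this
    refine le_trans (Finset.card_le_card fun ψ => ?_)
      (this.trans (Nat.mul_le_mul_left _ (Nat.choose_le_pow _ _)))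
    simp only [Finset.mem_filter, Finset.mem_univ, true_and]
    exact fun h => ⟨fun x y hxy => congrArg ψ hxy, h⟩
  -- For `j` larger than the number of vertices the bound exceeds the number of all colorings.
  · refine (Finset.card_filter_le _ _).trans ?_
    rw [Finset.card_univ, Fintype.card_fun]
    exact (Nat.pow_le_pow_right hκ (by omega)).trans
      (Nat.le_mul_of_pos_right _ (Nat.pow_pos hV))

/-- Colorings of weight at least `3 / 2` times the minimum contribute little. -/
theorem sum_heavy_le [Fintype κ] [Nonempty κ] [Nonempty V] [DecidableEq V] {w : ι → ℕ} {c : ℕ}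
    (hc0 : 0 < c) (hc : ∀ χ : V → Fin 2, Nonconst χ → c ≤ wt ends w χ) {f : (V → κ) → ℝ}
    {b : ℝ} (hb0 : 0 ≤ b) (hb1 : b ≤ 1) (hf : ∀ ψ, f ψ ≤ b ^ (2 * wt ends w ψ))
    (hu : 2 * ((Fintype.card κ * Fintype.card V : ℕ) * b ^ c) ≤ 1) :
    ∑ ψ with 3 * c ≤ 2 * wt ends w ψ, f ψ ≤
      2 * (Fintype.card κ * Fintype.card V : ℕ) *
        ((Fintype.card κ * Fintype.card V : ℕ) * b ^ c) ^ 3 := by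
  set M : ℕ := Fintype.card κ * Fintype.card V
  set z := b ^ c
  have hz : 0 ≤ z := pow_nonneg hb0 _
  set S := Finset.univ.filter fun ψ : V → κ => 3 * c ≤ 2 * wt ends w ψ
  set J := S.sup (fun ψ => 2 * wt ends w ψ / c) + 1
  have hmap : ∀ ψ ∈ S, 2 * wt ends w ψ / c ∈ Finset.Ico 3 J := by
    intro ψ hψ
    rw [Finset.mem_Ico]
    refine ⟨?_, Nat.lt_succ_of_le (Finset.le_sup (f := fun ψ => 2 * wt ends w ψ / c) hψ)⟩
    rw [Nat.le_div_iff_mul_le hc0]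
    exact (Finset.mem_filter.1 hψ).2
  rw [← Finset.sum_fiberwise_of_maps_to hmap]
  -- The colorings are grouped by `j = ⌊2 wt / c⌋ ≥ 3`. Each member of a group contributes at most
  -- `z ^ j`, and there are at most `M ^ (j + 1)` of them, so the groups are dominated by a
  -- geometric series with ratio `M z ≤ 1 / 2`.
  have hfib : ∀ j ∈ Finset.Ico 3 J,
      ∑ ψ ∈ S with 2 * wt ends w ψ / c = j, f ψ ≤ M * ((M : ℝ) * z) ^ j := by
    intro j _
    have h1 : ∀ ψ ∈ S.filter (fun ψ => 2 * wt ends w ψ / c = j), f ψ ≤ z ^ j := by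
      intro ψ hψ
      have hj := (Finset.mem_filter.1 hψ).2
      refine (hf ψ).trans ?_
      rw [← pow_mul]
      refine pow_le_pow_of_le_one hb0 hb1 ?_
      rw [← hj]
      exact Nat.mul_div_le _ _
    refine (Finset.sum_le_card_nsmul _ _ _ h1).trans ?_
    have h2 : (S.filter (fun ψ => 2 * wt ends w ψ / c = j)).card ≤ M ^ (j + 1) := by
      refine le_trans (Finset.card_le_card fun ψ hψ => ?_)
        (card_small_le (κ := κ) hc0 hc (Nat.succ_pos j))
      have hj := (Finset.mem_filter.1 hψ).2
      simp only [Finset.mem_filter, Finset.mem_univ, true_and]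
      rw [← hj]
      rw [mul_comm (_ + 1)]
      exact (Nat.lt_mul_div_succ _ hc0).le
    rw [nsmul_eq_mul, mul_pow, ← mul_assoc, ← pow_succ']
    refine mul_le_mul_of_nonneg_right ?_ (pow_nonneg hz _)
    exact_mod_cast h2
  refine (Finset.sum_le_sum hfib).trans ?_
  rw [← Finset.mul_sum]
  have hu0 : 0 ≤ (M : ℝ) * z := by positivity
  have hg := geom_sum_Ico_le_of_lt_one (m := 3) (n := J) hu0 (by linarith)
  have h3 : ((M : ℝ) * z) ^ 3 / (1 - M * z) ≤ 2 * ((M : ℝ) * z) ^ 3 := by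
    rw [div_le_iff₀ (by linarith)]
    nlinarith [pow_nonneg hu0 3]
  calc (M : ℝ) * _ ≤ M * (2 * ((M : ℝ) * z) ^ 3) :=
        mul_le_mul_of_nonneg_left (hg.trans h3) (Nat.cast_nonneg _)
    _ = _ := by ring

end cuts

set_option linter.unusedSectionVars false

/-! ### The failure probability -/

section fail

variable {V ι κ μ : Type} [Fintype V] [DecidableEq κ] [DecidableEq μ] [DecidableEq ι]
  {ends : ι → V × V}

open scoped Classical in
/-- The probability that the blocks of the labelling `l` do not get connected by the edges in `A`,
each edge failing with its own probability. -/
noncomputable def failOn (ends : ι → V × V) (p : ι → ℝ) (A : Finset ι) (l : V → μ) : ℝ :=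
  ∑ S ∈ A.powerset, ((∏ e ∈ S, p e) * ∏ e ∈ A \ S, (1 - p e)) *
    if ∃ χ : V → Fin 2, Nonconst χ ∧ Compat l χ ∧ ∀ e ∈ A \ S, ¬ Cross ends χ e then 1 else 0

/-- The same probability, conditioning on the edges in a list one by one. -/
noncomputable def failRec (ends : ι → V × V) (p : ι → ℝ) : List ι → (V → μ) → ℝ
  | [], l => if Nonconst l then 1 else 0
  | e :: L, l => p e * failRec ends p L l + (1 - p e) * failRec ends p L (merge ends l e)

theorem exists_compat_iff {l : V → μ} :
    (∃ χ : V → Fin 2, Nonconst χ ∧ Compat l χ) ↔ Nonconst l := by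
  constructor
  · rintro ⟨χ, ⟨x, y, h⟩, hc⟩
    exact ⟨x, y, fun h' => h (hc _ _ h')⟩
  · rintro ⟨x, y, h⟩
    refine ⟨fun v => if l v = l x then 0 else 1, ⟨x, y, ?_⟩, fun a b hab => ?_⟩
    · simp [Ne.symm h]
    · simp only [hab]

theorem failOn_empty (p : ι → ℝ) (l : V → μ) :
    failOn ends p ∅ l = if Nonconst l then 1 else 0 := by
  simp only [failOn, Finset.powerset_empty, Finset.sum_singleton, Finset.prod_empty,
    Finset.sdiff_self, Finset.notMem_empty, false_imp_iff, implies_true, and_true, one_mul,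
    exists_compat_iff]

/-- Conditioning on `e`: if it fails it imposes no condition, and if it survives the coloring must
not cross it, which is compatibility with the merged labelling. -/
theorem failOn_insert (p : ι → ℝ) {A : Finset ι} {e : ι} (he : e ∉ A) (l : V → μ) :
    failOn ends p (insert e A) l =
      p e * failOn ends p A l + (1 - p e) * failOn ends p A (merge ends l e) := by
  classical
  rw [failOn, Finset.sum_powerset_insert he, failOn, failOn, Finset.mul_sum, Finset.mul_sum,
    add_comm]
  congr 1 <;> refine Finset.sum_congr rfl fun S hS => ?_
  · have heS : e ∉ S := fun h => he (Finset.mem_powerset.1 hS h)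
    rw [Finset.insert_sdiff_insert, Finset.sdiff_insert_of_notMem he, Finset.prod_insert heS]
    ring
  · have heS : e ∉ S := fun h => he (Finset.mem_powerset.1 hS h)
    rw [Finset.insert_sdiff_of_notMem _ heS, Finset.prod_insert (fun h => he (by simp_all))]
    simp only [compat_merge, Finset.forall_mem_insert, ← and_assoc]
    simp only [and_assoc]
    ring

theorem failRec_eq (p : ι → ℝ) (L : List ι) (hL : L.Nodup) (l : V → μ) :
    failRec ends p L l = failOn ends p L.toFinset l := by
  induction L generalizing l with
  | nil => rw [List.toFinset_nil, failOn_empty, failRec]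
  | cons e L ih =>
    rw [List.nodup_cons] at hL
    rw [List.toFinset_cons, failOn_insert p (by simpa using hL.1), failRec, ih hL.2, ih hL.2]

theorem failRec_nonneg {p : ι → ℝ} (h0 : ∀ e, 0 ≤ p e) (h1 : ∀ e, p e ≤ 1) (L : List ι)
    (l : V → μ) : 0 ≤ failRec ends p L l := by
  induction L generalizing l with
  | nil => rw [failRec]; split <;> norm_num
  | cons e L ih =>
    exact add_nonneg (mul_nonneg (h0 e) (ih _)) (mul_nonneg (sub_nonneg.2 (h1 e)) (ih _))

theorem failRec_le_one {p : ι → ℝ} (h0 : ∀ e, 0 ≤ p e) (h1 : ∀ e, p e ≤ 1) (L : List ι)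
    (l : V → μ) : failRec ends p L l ≤ 1 := by
  induction L generalizing l with
  | nil => rw [failRec]; split <;> norm_num
  | cons e L ih =>
    rw [failRec]
    nlinarith [ih l, ih (merge ends l e), h0 e, h1 e]

/-- The failure probability is affine in each `p e`, and its slope is a difference of two
conditional probabilities, hence at most `1` in absolute value. Changing the probabilities one edge
at a time costs `δ` per edge. -/
theorem failRec_sub_le {p p' : ι → ℝ} (h0 : ∀ e, 0 ≤ p e) (h1 : ∀ e, p e ≤ 1)
    (h0' : ∀ e, 0 ≤ p' e) (h1' : ∀ e, p' e ≤ 1) {δ : ℝ} (h : ∀ e, |p' e - p e| ≤ δ) (L : List ι)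
    (l : V → μ) : |failRec ends p' L l - failRec ends p L l| ≤ L.length * δ := by
  induction L generalizing l with
  | nil => simp [failRec]
  | cons e L ih =>
    have a0 := failRec_nonneg (ends := ends) h0 h1 L l
    have a1 := failRec_le_one (ends := ends) h0 h1 L l
    have b0 := failRec_nonneg (ends := ends) h0 h1 L (merge ends l e)
    have b1 := failRec_le_one (ends := ends) h0 h1 L (merge ends l e)
    have ha := ih l
    have hb := ih (merge ends l e)
    have he := h e
    simp only [failRec, List.length_cons, Nat.cast_add, Nat.cast_one]
    set A := failRec ends p L l
    set A' := failRec ends p' L l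
    set B := failRec ends p L (merge ends l e)
    set B' := failRec ends p' L (merge ends l e)
    have e1 : p' e * A' + (1 - p' e) * B' - (p e * A + (1 - p e) * B) =
        p' e * (A' - A) + (1 - p' e) * (B' - B) + (p' e - p e) * (A - B) := by ring
    rw [e1]
    have h2 : |p' e * (A' - A)| ≤ p' e * (L.length * δ) := by
      rw [abs_mul, abs_of_nonneg (h0' e)]
      exact mul_le_mul_of_nonneg_left ha (h0' e)
    have h3 : |(1 - p' e) * (B' - B)| ≤ (1 - p' e) * (L.length * δ) := by
      rw [abs_mul, abs_of_nonneg (sub_nonneg.2 (h1' e))]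
      exact mul_le_mul_of_nonneg_left hb (sub_nonneg.2 (h1' e))
    have h4 : |(p' e - p e) * (A - B)| ≤ δ := by
      rw [abs_mul]
      have : |A - B| ≤ 1 := abs_le.2 ⟨by linarith, by linarith⟩
      nlinarith [abs_nonneg (p' e - p e), abs_nonneg (A - B)]
    calc _ ≤ |p' e * (A' - A)| + |(1 - p' e) * (B' - B)| + |(p' e - p e) * (A - B)| :=
          abs_add_three _ _ _
      _ ≤ p' e * (L.length * δ) + (1 - p' e) * (L.length * δ) + δ := by gcongr
      _ = _ := by ring

/-- Whether the failure probability vanishes depends only on which edges have probability `0` or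
`1`. This covers the case in which an additive error bound says nothing about relative error. -/
theorem failRec_eq_zero {p p' : ι → ℝ} (h0 : ∀ e, 0 ≤ p e) (h1 : ∀ e, p e ≤ 1)
    (hz : ∀ e, p e = 0 → p' e = 0) (ho : ∀ e, p e = 1 → p' e = 1) (L : List ι)
    (l : V → μ) (h : failRec ends p L l = 0) : failRec ends p' L l = 0 := by
  induction L generalizing l with
  | nil => exact h
  | cons e L ih =>
    rw [failRec, add_eq_zero_iff_of_nonneg (mul_nonneg (h0 e) (failRec_nonneg h0 h1 _ _))
      (mul_nonneg (sub_nonneg.2 (h1 e)) (failRec_nonneg h0 h1 _ _)), mul_eq_zero,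
      mul_eq_zero, sub_eq_zero] at h
    rw [failRec]
    have t1 : p' e * failRec ends p' L l = 0 := by
      rcases h.1 with h | h
      · rw [hz e h, zero_mul]
      · rw [ih _ h, mul_zero]
    have t2 : (1 - p' e) * failRec ends p' L (merge ends l e) = 0 := by
      rcases h.2 with h | h
      · rw [ho e h.symm, sub_self, zero_mul]
      · rw [ih _ h, mul_zero]
    rw [t1, t2, add_zero]

variable [Fintype ι] {p : ι → ℝ}

/-- The probability that exactly the edges in `S` fail. -/
noncomputable def pw (p : ι → ℝ) (S : Finset ι) : ℝ := (∏ e ∈ S, p e) * ∏ e ∈ Sᶜ, (1 - p e)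

theorem pw_nonneg (h0 : ∀ e, 0 ≤ p e) (h1 : ∀ e, p e ≤ 1) (S : Finset ι) : 0 ≤ pw p S :=
  mul_nonneg (Finset.prod_nonneg fun e _ => h0 e)
    (Finset.prod_nonneg fun e _ => sub_nonneg.2 (h1 e))

/-- Expand the product over all edges of `p e` plus `1 - p e`, the latter dropped for crossing
edges, according to the set `S` of edges from which `p e` is taken. -/
theorem sum_pw_eq_cp (p : ι → ℝ) (ψ : V → κ) :
    ∑ S, pw p S * (if ∀ e ∉ S, ¬ Cross ends ψ e then 1 else 0) = cp ends p ψ := by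
  have h := Finset.prod_add p (fun e => if Cross ends ψ e then 0 else 1 - p e) Finset.univ
  have h2 : ∀ e, p e + (if Cross ends ψ e then 0 else 1 - p e) =
      if Cross ends ψ e then p e else 1 := fun e => by split <;> ring
  simp only [h2] at h
  rw [cp, h, Finset.powerset_univ]
  refine Finset.sum_congr rfl fun S _ => ?_
  rw [pw, ← Finset.compl_eq_univ_sdiff, mul_assoc]
  congr 1
  split_ifs with hS
  · rw [mul_one]
    exact Finset.prod_congr rfl fun e he => by rw [if_neg (hS e (Finset.mem_compl.1 he))]
  · push Not at hS
    obtain ⟨e, he, hc⟩ := hS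
    rw [mul_zero]
    have hz := Finset.prod_eq_zero (f := fun e => if Cross ends ψ e then 0 else 1 - p e)
      (Finset.mem_compl.2 he) (by simp only [if_pos hc])
    exact hz.symm

variable [DecidableEq V]

/-- The probability that the network becomes disconnected. -/
noncomputable def failR (ends : ι → V × V) (p : ι → ℝ) : ℝ :=
  failOn ends p Finset.univ (id : V → V)

/-- The cuts, given as colorings, all of whose edges belong to `S`. -/
def cutsIn (ends : ι → V × V) (S : Finset ι) : Finset (V → Fin 2) :=
  Finset.univ.filter fun χ => Nonconst χ ∧ ∀ e ∉ S, ¬ Cross ends χ e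

/-- The pairs of distinct cuts. -/
def cutPairs : Finset (V → Fin 2 × Fin 2) :=
  Finset.univ.filter fun ψ => Nonconst (fun v => (ψ v).1) ∧ Nonconst (fun v => (ψ v).2) ∧
    (fun v => (ψ v).2) ≠ (fun v => (ψ v).1) ∧ (fun v => (ψ v).2) ≠ (fun v => (ψ v).1 + 1)

theorem failR_eq (p : ι → ℝ) :
    failR ends p = ∑ S, pw p S * (if (cutsIn ends S).Nonempty then 1 else 0) := by
  classical
  rw [failR, failOn, Finset.powerset_univ]
  refine Finset.sum_congr rfl fun S _ => ?_
  rw [pw, ← Finset.compl_eq_univ_sdiff]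
  congr 1
  have hiff : (∃ χ : V → Fin 2, Nonconst χ ∧ Compat (id : V → V) χ ∧
      ∀ e ∈ Sᶜ, ¬ Cross ends χ e) ↔ (cutsIn ends S).Nonempty := by
    rw [Finset.Nonempty]
    refine exists_congr fun χ => ?_
    simp only [cutsIn, Finset.mem_filter, Finset.mem_univ, true_and, Finset.mem_compl]
    exact ⟨fun h => ⟨h.1, h.2.2⟩, fun h => ⟨h.1, fun x y hxy => congrArg χ hxy, h.2⟩⟩
  by_cases h : (cutsIn ends S).Nonempty
  · rw [if_pos h, if_pos (hiff.2 h)]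
  · rw [if_neg h, if_neg (mt hiff.1 h)]

theorem sum_cp_eq (p : ι → ℝ) (A : Finset (V → κ)) :
    ∑ ψ ∈ A, cp ends p ψ =
      ∑ S, pw p S * (A.filter fun ψ => ∀ e ∉ S, ¬ Cross ends ψ e).card := by
  simp only [← sum_pw_eq_cp]
  rw [Finset.sum_comm]
  refine Finset.sum_congr rfl fun S _ => ?_
  rw [← Finset.mul_sum]
  congr 1
  rw [Finset.card_filter]
  push_cast
  rfl

theorem fin_two_ne_iff {a b : Fin 2} : a ≠ b ↔ a = b + 1 := by
  revert a b; decide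

theorem cutsIn_add_one {S : Finset ι} {χ : V → Fin 2} (h : χ ∈ cutsIn ends S) :
    (fun v => χ v + 1) ∈ cutsIn ends S := by
  rw [cutsIn, Finset.mem_filter] at h ⊢
  simpa only [Finset.mem_univ, true_and, Nonconst, Cross, ne_eq, add_left_inj] using h

theorem add_one_ne {χ : V → Fin 2} (h : Nonconst χ) : (fun v => χ v + 1) ≠ χ := by
  obtain ⟨x, -⟩ := h
  intro h
  have := congrFun h x
  revert this
  generalize χ x = a
  revert a; decide

theorem two_le_card_cutsIn {S : Finset ι} (h : (cutsIn ends S).Nonempty) :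
    2 ≤ (cutsIn ends S).card := by
  obtain ⟨χ, hχ⟩ := h
  have hn : Nonconst χ := (Finset.mem_filter.1 hχ).2.1
  exact Finset.one_lt_card.2 ⟨_, cutsIn_add_one hχ, _, hχ, add_one_ne hn⟩

/-- Fix one failing cut `χ`. Every failing cut other than `χ` and its complement forms a pair with
`χ`, and distinct cuts give distinct pairs. -/
theorem card_cutsIn_le {S : Finset ι} (h : (cutsIn ends S).Nonempty) :
    (cutsIn ends S).card ≤
      2 + ((cutPairs (V := V)).filter fun ψ => ∀ e ∉ S, ¬ Cross ends ψ e).card := by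
  obtain ⟨χ, hχ⟩ := h
  have hχ' := Finset.mem_filter.1 hχ
  have h1 : (((cutsIn ends S).erase χ).erase (fun v => χ v + 1)).card ≤
      ((cutPairs (V := V)).filter fun ψ => ∀ e ∉ S, ¬ Cross ends ψ e).card := by
    refine Finset.card_le_card_of_injOn (fun φ v => (χ v, φ v)) ?_ ?_
    · intro φ hφ
      simp only [Finset.coe_erase, Set.mem_sdiff, Set.mem_singleton_iff, Finset.mem_coe] at hφ
      obtain ⟨⟨hφ, hne⟩, hne'⟩ := hφ
      have hφ' := Finset.mem_filter.1 hφ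
      simp only [Finset.coe_filter, Set.mem_ofPred_eq, cutPairs, Finset.mem_filter,
        Finset.mem_univ, true_and]
      refine ⟨⟨hχ'.2.1, hφ'.2.1, hne, hne'⟩, fun e he hc => ?_⟩
      have a := hχ'.2.2 e he
      have b := hφ'.2.2 e he
      rw [Cross, not_not] at a b
      exact hc (Prod.ext a b)
    · intro φ _ φ' _ h
      funext v
      exact congrArg Prod.snd (congrFun h v)
  have h2 := Finset.pred_card_le_card_erase (s := (cutsIn ends S).erase χ)
    (a := fun v => χ v + 1)
  have h3 := Finset.card_erase_of_mem hχ
  omega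

theorem cp_le_failR (h0 : ∀ e, 0 ≤ p e) (h1 : ∀ e, p e ≤ 1) {χ : V → Fin 2} (hχ : Nonconst χ) :
    cp ends p χ ≤ failR ends p := by
  rw [← sum_pw_eq_cp, failR_eq]
  refine Finset.sum_le_sum fun S _ => mul_le_mul_of_nonneg_left ?_ (pw_nonneg h0 h1 S)
  split_ifs with h2 h3 h3
  · exact le_rfl
  · exact absurd ⟨χ, by simp only [cutsIn, Finset.mem_filter, Finset.mem_univ, true_and]
                        exact ⟨hχ, h2⟩⟩ h3
  · exact zero_le_one
  · exact le_rfl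

/-- The union bound; the factor `2` appears because a failing cut comes with its complementary
coloring. -/
theorem failR_le (h0 : ∀ e, 0 ≤ p e) (h1 : ∀ e, p e ≤ 1) :
    2 * failR ends p ≤ ∑ χ : V → Fin 2 with Nonconst χ, cp ends p χ := by
  rw [sum_cp_eq, failR_eq, Finset.mul_sum]
  refine Finset.sum_le_sum fun S _ => ?_
  rw [mul_left_comm]
  refine mul_le_mul_of_nonneg_left ?_ (pw_nonneg h0 h1 S)
  rw [Finset.filter_filter]
  change _ ≤ ((cutsIn ends S).card : ℝ)
  split_ifs with h
  · have := two_le_card_cutsIn h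
    rw [mul_one]
    exact_mod_cast this
  · rw [mul_zero]
    exact Nat.cast_nonneg _

/-- Truncated inclusion and exclusion: taking expectations in `card_cutsIn_le` bounds the overcount
by the expected number of failing pairs of cuts. -/
theorem sum_cp_le (h0 : ∀ e, 0 ≤ p e) (h1 : ∀ e, p e ≤ 1) :
    ∑ χ : V → Fin 2 with Nonconst χ, cp ends p χ ≤
      2 * failR ends p + ∑ ψ ∈ cutPairs (V := V), cp ends p ψ := by
  rw [sum_cp_eq, sum_cp_eq, failR_eq, Finset.mul_sum, ← Finset.sum_add_distrib]
  refine Finset.sum_le_sum fun S _ => ?_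
  rw [mul_left_comm, ← mul_add]
  refine mul_le_mul_of_nonneg_left ?_ (pw_nonneg h0 h1 S)
  rw [Finset.filter_filter]
  change ((cutsIn ends S).card : ℝ) ≤ _
  split_ifs with h
  · have := card_cutsIn_le h
    rw [mul_one]
    exact_mod_cast this
  · rw [Finset.not_nonempty_iff_eq_empty.1 h, Finset.card_empty, Nat.cast_zero]
    positivity

/-- If the pair took only two values, each coordinate would be a bijective function of the other,
and the second cut would be the first or its complement. -/
theorem three_le_blocks {ψ : V → Fin 2 × Fin 2} (h : ψ ∈ cutPairs (V := V)) : 3 ≤ blocks ψ := by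
  simp only [cutPairs, Finset.mem_filter, Finset.mem_univ, true_and] at h
  obtain ⟨⟨x, y, hxy⟩, ⟨x', y', hxy'⟩, h1, h2⟩ := h
  by_contra hlt
  have hsub : ({ψ x, ψ y} : Finset _) ⊆ Finset.univ.image ψ := by
    intro b hb
    simp only [Finset.mem_insert, Finset.mem_singleton] at hb
    rcases hb with rfl | rfl <;> simp
  have hne : ψ x ≠ ψ y := fun h => hxy (congrArg Prod.fst h)
  have heq := Finset.eq_of_subset_of_card_le hsub (by
    rw [Finset.card_pair hne]; rw [blocks] at hlt; omega)
  have hall : ∀ v, ψ v = ψ x ∨ ψ v = ψ y := fun v => by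
    have : ψ v ∈ Finset.univ.image ψ := by simp
    rw [← heq] at this
    simpa using this
  have hne2 : (ψ x).2 ≠ (ψ y).2 := by
    intro he
    refine hxy' ?_
    rcases hall x' with h | h <;> rcases hall y' with h' | h' <;> simp only [h, h', he]
  by_cases hx : (ψ x).2 = (ψ x).1
  · refine h1 (funext fun v => ?_)
    rcases hall v with h | h
    · simp only [h, hx]
    · simp only [h]
      have a := fin_two_ne_iff.1 hne2.symm
      have b := fin_two_ne_iff.1 (Ne.symm hxy)
      simp only at b
      rw [a, b, hx]
  · refine h2 (funext fun v => ?_)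
    rcases hall v with h | h
    · simp only [h]
      exact fin_two_ne_iff.1 hx
    · simp only [h]
      have a := fin_two_ne_iff.1 hne2.symm
      have b := fin_two_ne_iff.1 (Ne.symm hxy)
      have c := fin_two_ne_iff.1 hx
      simp only at b
      rw [a, b, c]

end fail

set_option linter.unusedSectionVars false

/-! ### Comparison of the failure probability with the sum over the small cuts -/

section approx

variable {V ι κ : Type} [Fintype V] [DecidableEq V] [DecidableEq κ] [DecidableEq ι] [Fintype ι]
  {ends : ι → V × V}

/-- The weights `w` are rounded logarithms of the probabilities `p`, on a scale on which `D` is the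
logarithm of `q`, and `q` is the bottleneck probability of the network. -/
structure IsScale (ends : ι → V × V) (p : ι → ℝ) (q : ℝ) (D cap : ℕ) (w : ι → ℕ) : Prop where
  p_nonneg : ∀ e, 0 ≤ p e
  p_le_one : ∀ e, p e ≤ 1
  q_pos : 0 < q
  q_lt_one : q < 1
  le_D : 6 * Fintype.card ι ≤ D
  D_pos : 0 < D
  lt_cap : D * Fintype.card ι < cap
  pow_le : ∀ e, p e ^ D ≤ q ^ w e
  le_pow : ∀ e, w e < cap → q ^ (w e + 1) ≤ p e ^ D
  D_le : ∀ e, p e ≤ q → D ≤ w e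
  w_le : ∀ e, q ≤ p e → w e ≤ D
  exists_cross : ∀ χ : V → Fin 2, Nonconst χ → ∃ e, Cross ends χ e ∧ p e ≤ q
  exists_cut : ∃ χ : V → Fin 2, Nonconst χ ∧ ∀ e, Cross ends χ e → q ≤ p e

theorem le_wt {w : ι → ℕ} {χ : V → κ} {e : ι} (he : Cross ends χ e) : w e ≤ wt ends w χ := by
  have := Finset.single_le_sum (f := fun e => if Cross ends χ e then w e else 0)
    (fun _ _ => Nat.zero_le _) (Finset.mem_univ e)
  simp only [he, if_true] at this
  exact this

/-- With `b = q ^ (1 / (2 D))`, a coloring of weight `w` has failure probability at most `b ^ (2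
w)`. For the cut of least weight `c` there is a converse: rounding loses at most one unit per edge,
so its probability is at least `b ^ (2 (c + m))`, and `6 m ≤ D ≤ c` turns this into the exponents
`7` and `3`. -/
theorem exists_isScale_min {p : ι → ℝ} {q : ℝ} {D cap : ℕ} {w : ι → ℕ}
    (h : IsScale ends p q D cap w) :
    ∃ (χ : V → Fin 2) (b : ℝ), Nonconst χ ∧ 0 < wt ends w χ ∧
      (∀ φ : V → Fin 2, Nonconst φ → wt ends w χ ≤ wt ends w φ) ∧ 0 < cp ends p χ ∧ 0 ≤ b ∧ b ≤ 1 ∧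
      (∀ ψ : V → Fin 2 × Fin 2, cp ends p ψ ≤ b ^ (2 * wt ends w ψ)) ∧
      (b ^ wt ends w χ) ^ 7 ≤ cp ends p χ ^ 3 := by
  obtain ⟨χ₁, hχ₁, hq₁⟩ := h.exists_cut
  obtain ⟨χ, hχ, hmin⟩ := Finset.exists_min_image
    (Finset.univ.filter fun χ : V → Fin 2 => Nonconst χ) (fun χ => wt ends w χ) ⟨χ₁, by simpa⟩
  simp only [Finset.mem_filter, Finset.mem_univ, true_and] at hχ hmin
  have hDle : D ≤ wt ends w χ := by
    obtain ⟨e, he, hpe⟩ := h.exists_cross χ hχ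
    refine (h.D_le e hpe).trans ?_
    exact le_wt he
  -- The bottleneck cut has edges of weight at most `D` only. In particular no edge of the minimum
  -- cut reaches `cap`, where the weights stop approximating logarithms.
  have hle : wt ends w χ ≤ D * Fintype.card ι := by
    refine (hmin χ₁ hχ₁).trans ?_
    refine (Finset.sum_le_card_nsmul _ _ D fun e _ => ?_).trans (by simp [mul_comm])
    split_ifs with he
    · exact h.w_le e (hq₁ e he)
    · exact Nat.zero_le _
  set c := wt ends w χ with hc
  set b : ℝ := q ^ ((2 * D : ℕ) : ℝ)⁻¹ with hb
  have hb0 : 0 ≤ b := Real.rpow_nonneg h.q_pos.le _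
  have hb1 : b ≤ 1 := Real.rpow_le_one h.q_pos.le h.q_lt_one.le (by positivity)
  have hbD : b ^ (2 * D) = q := Real.rpow_inv_natCast_pow h.q_pos.le (by have := h.D_pos; omega)
  have hcpD : ∀ {κ : Type} [DecidableEq κ] (ψ : V → κ), cp ends p ψ ^ D ≤ q ^ wt ends w ψ := by
    intro κ _ ψ
    rw [cp, ← Finset.prod_pow, wt, ← Finset.prod_pow_eq_pow_sum]
    refine Finset.prod_le_prod (fun e _ => ?_) fun e _ => ?_
    · have := h.p_nonneg e
      split <;> positivity
    · split
      · exact h.pow_le e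
      · simp
  have hlow : q ^ (c + Fintype.card ι) ≤ cp ends p χ ^ D := by
    have e1 : q ^ (c + Fintype.card ι) = ∏ e : ι, q ^ ((if Cross ends χ e then w e else 0) + 1) := by
      rw [Finset.prod_pow_eq_pow_sum, Finset.sum_add_distrib, hc, wt]
      simp
    rw [e1, cp, ← Finset.prod_pow]
    refine Finset.prod_le_prod (fun e _ => by have := h.q_pos; positivity) fun e _ => ?_
    split_ifs with he
    · refine h.le_pow e (lt_of_le_of_lt ?_ (hle.trans_lt h.lt_cap))
      exact le_wt he
    · rw [one_pow]
      exact pow_le_one₀ h.q_pos.le h.q_lt_one.le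
  have hnn : 0 ≤ cp ends p χ := Finset.prod_nonneg fun e _ => by
    split
    · exact h.p_nonneg e
    · exact zero_le_one
  have hlow' : b ^ (2 * (c + Fintype.card ι)) ≤ cp ends p χ := by
    rw [← pow_le_pow_iff_left₀ (pow_nonneg hb0 _) hnn h.D_pos.ne']
    refine le_trans (le_of_eq ?_) hlow
    rw [← hbD, ← pow_mul, ← pow_mul]
    congr 1
    ring
  have hbpos : 0 < b := Real.rpow_pos_of_pos h.q_pos _
  refine ⟨χ, b, hχ, h.D_pos.trans_le hDle, hmin, (pow_pos hbpos _).trans_le hlow', hb0, hb1,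
    fun ψ => ?_, ?_⟩
  · have hψ : 0 ≤ cp ends p ψ := Finset.prod_nonneg fun e _ => by
      split
      · exact h.p_nonneg e
      · exact zero_le_one
    rw [← pow_le_pow_iff_left₀ hψ (pow_nonneg hb0 _) h.D_pos.ne']
    refine (hcpD ψ).trans (le_of_eq ?_)
    rw [← hbD, ← pow_mul, ← pow_mul]
    congr 1
    ring
  · refine le_trans ?_ (pow_le_pow_left₀ (pow_nonneg hb0 _) hlow' 3)
    rw [← pow_mul, ← pow_mul]
    refine pow_le_pow_of_le_one hb0 hb1 ?_
    have := h.le_D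
    omega

/-- Without rounding, `P` would be `z ^ 2` and the tail, of order `n ^ 4 * z ^ 3`, would be smaller
than `P` by a factor of order `n ^ 4 * P ^ (1 / 2)`. Here `z ≤ P ^ (3 / 7)`, which still leaves the
gain `P ^ (2 / 7)`; this beats `M` once `P ≤ M ^ (-5)`. The constant in `M` is `2 * 4 * 4 ^ 3 * 8`.
-/
theorem heavy_bound {z P M n k : ℝ} (hz : 0 ≤ z) (hP : 0 < P) (hn : 1 ≤ n) (hk : 1 ≤ k)
    (hM : M = 4096 * n ^ 4 * k) (hzP : z ^ 7 ≤ P ^ 3) (hPM : P * M ^ 5 ≤ 1) :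
    2 * (4 * n * z) ≤ 1 ∧ 2 * (4 * n) * (4 * n * z) ^ 3 ≤ P / (8 * k) := by
  have hn4 : 1 ≤ n ^ 4 := one_le_pow₀ hn
  have hnn : n ≤ n ^ 4 := le_self_pow₀ hn (by norm_num)
  have hnk : n ^ 4 ≤ n ^ 4 * k := le_mul_of_one_le_right (by positivity) hk
  have hM1 : 1 ≤ M := by rw [hM]; nlinarith
  have hM0 : 0 < M := by linarith
  -- `(z M ^ 2) ^ 7 = z ^ 7 M ^ 14 ≤ P ^ 3 M ^ 15 = (P M ^ 5) ^ 3 ≤ 1`.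
  have hzM : z * M ^ 2 ≤ 1 := by
    by_contra hcon
    push Not at hcon
    have h1 : 1 < (z * M ^ 2) ^ 7 := one_lt_pow₀ hcon (by norm_num)
    have h2 : (z * M ^ 2) ^ 7 ≤ 1 := by
      calc (z * M ^ 2) ^ 7 = z ^ 7 * M ^ 14 := by ring
        _ ≤ P ^ 3 * M ^ 15 := by
            have : M ^ 14 ≤ M ^ 15 := pow_le_pow_right₀ hM1 (by norm_num)
            gcongr
        _ = (P * M ^ 5) ^ 3 := by ring
        _ ≤ 1 := pow_le_one₀ (by positivity) hPM
    linarith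
  have hzM1 : z * M ≤ 1 := by
    have : z * M ≤ z * M ^ 2 := by
      have : M ≤ M ^ 2 := le_self_pow₀ hM1 (by norm_num)
      gcongr
    linarith
  constructor
  · have : 2 * (4 * n * z) ≤ z * M := by
      rw [hM]
      have : 8 * n ≤ 4096 * n ^ 4 * k := by nlinarith
      nlinarith
    linarith
  · rw [le_div_iff₀ (by positivity)]
    have e1 : 2 * (4 * n) * (4 * n * z) ^ 3 * (8 * k) = M * z ^ 3 := by rw [hM]; ring
    rw [e1, ← pow_le_pow_iff_left₀ (by positivity) hP.le (n := 3) (by norm_num)]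
    calc (M * z ^ 3) ^ 3 = z ^ 7 * (z * M) * (z * M ^ 2) := by ring
      _ ≤ z ^ 7 * 1 * 1 := by gcongr
      _ ≤ P ^ 3 := by linarith

/-- The diagonal embeds 2-colorings into 4-colorings with the same crossing edges, so that one tail
bound serves both heavy cuts and pairs of cuts. -/
theorem cross_diag (χ : V → κ) (e : ι) : Cross ends (fun v => (χ v, χ v)) e ↔ Cross ends χ e := by
  simp [Cross]

theorem wt_diag (w : ι → ℕ) (χ : V → κ) : wt ends w (fun v => (χ v, χ v)) = wt ends w χ :=
  Finset.sum_congr rfl fun e _ => if_congr (cross_diag χ e) rfl rfl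

theorem cp_diag (p : ι → ℝ) (χ : V → κ) : cp ends p (fun v => (χ v, χ v)) = cp ends p χ :=
  Finset.prod_congr rfl fun e _ => if_congr (cross_diag χ e) rfl rfl

theorem cp_nonneg {p : ι → ℝ} (h0 : ∀ e, 0 ≤ p e) (ψ : V → κ) : 0 ≤ cp ends p ψ :=
  Finset.prod_nonneg fun e _ => by
    split
    · exact h0 e
    · exact zero_le_one

/-- If the failure probability of a minimum cut is small, then the failure probability of the
network is about the sum of the failure probabilities of the small cuts. -/
theorem failR_approx {p : ι → ℝ} {w : ι → ℕ} (h0 : ∀ e, 0 ≤ p e) (h1 : ∀ e, p e ≤ 1)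
    {χ : V → Fin 2} {b : ℝ} (hχ : Nonconst χ) (hc0 : 0 < wt ends w χ)
    (hc : ∀ φ : V → Fin 2, Nonconst φ → wt ends w χ ≤ wt ends w φ) (hP : 0 < cp ends p χ)
    (hb0 : 0 ≤ b) (hb1 : b ≤ 1) (hψ : ∀ ψ : V → Fin 2 × Fin 2, cp ends p ψ ≤ b ^ (2 * wt ends w ψ))
    (hb7 : (b ^ wt ends w χ) ^ 7 ≤ cp ends p χ ^ 3) {k : ℕ} (hk : 1 ≤ k)
    (hsmall : cp ends p χ * (4096 * (Fintype.card V : ℝ) ^ 4 * k) ^ 5 ≤ 1) :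
    ∑ φ : V → Fin 2 with Nonconst φ, cp ends p φ ≤ 2 * failR ends p * (1 + 1 / (8 * k)) ∧
    2 * failR ends p * (1 - 1 / (8 * k)) ≤
      ∑ φ : V → Fin 2 with Nonconst φ ∧ 2 * wt ends w φ < 3 * wt ends w χ, cp ends p φ := by
  have : Nonempty V := ⟨hχ.choose⟩
  have hn : (1 : ℝ) ≤ Fintype.card V := by exact_mod_cast Fintype.card_pos (α := V)
  have hk' : (1 : ℝ) ≤ k := by exact_mod_cast hk
  obtain ⟨g1, g2⟩ := heavy_bound (pow_nonneg hb0 _) hP hn hk' rfl hb7 hsmall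
  have hκ : Fintype.card (Fin 2 × Fin 2) = 4 := by simp
  have key := sum_heavy_le (κ := Fin 2 × Fin 2) hc0 hc hb0 hb1 hψ
    (by rw [hκ]; push_cast; exact g1)
  rw [hκ] at key
  push_cast at key
  have hheavy := key.trans g2
  -- `H` dominates both errors: the pairs of cuts neglected in the union bound, and the single cuts
  -- of weight at least `3 c / 2`.
  set H := ∑ ψ : V → Fin 2 × Fin 2 with 3 * wt ends w χ ≤ 2 * wt ends w ψ, cp ends p ψ
  have hPF := cp_le_failR (ends := ends) h0 h1 hχ
  have hHF : H ≤ failR ends p * (1 / (8 * k)) :=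
    hheavy.trans (by rw [div_eq_mul_one_div]; gcongr)
  -- At least three blocks have weight at least `3 c / 2`.
  have hpairs : ∑ ψ ∈ cutPairs (V := V), cp ends p ψ ≤ H := by
    refine Finset.sum_le_sum_of_subset_of_nonneg (fun ψ hψ => ?_) fun ψ _ _ => cp_nonneg h0 ψ
    have h3 := three_le_blocks hψ
    have h4 := blocks_mul_le hc (nonconst_of_two_le_blocks (by omega : 2 ≤ blocks ψ))
    simp only [Finset.mem_filter, Finset.mem_univ, true_and]
    exact (Nat.mul_le_mul_right _ h3).trans h4
  have hlarge : ∑ φ : V → Fin 2 with Nonconst φ ∧ ¬ 2 * wt ends w φ < 3 * wt ends w χ,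
      cp ends p φ ≤ H := by
    have hinj : Set.InjOn (fun (φ : V → Fin 2) v => (φ v, φ v))
        (Finset.univ.filter fun φ : V → Fin 2 =>
          Nonconst φ ∧ ¬ 2 * wt ends w φ < 3 * wt ends w χ) := fun φ _ φ' _ h => by
      funext v
      exact congrArg Prod.fst (congrFun h v)
    have e : ∑ φ : V → Fin 2 with Nonconst φ ∧ ¬ 2 * wt ends w φ < 3 * wt ends w χ,
        cp ends p φ = ∑ ψ ∈ (Finset.univ.filter fun φ : V → Fin 2 =>
          Nonconst φ ∧ ¬ 2 * wt ends w φ < 3 * wt ends w χ).image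
            (fun φ v => (φ v, φ v)), cp ends p ψ := by
      rw [Finset.sum_image hinj]
      simp only [cp_diag]
    rw [e]
    refine Finset.sum_le_sum_of_subset_of_nonneg (fun ψ hψ => ?_) fun ψ _ _ => cp_nonneg h0 ψ
    obtain ⟨φ, hφ, rfl⟩ := Finset.mem_image.1 hψ
    simp only [Finset.mem_filter, Finset.mem_univ, true_and, not_lt] at hφ ⊢
    rw [wt_diag]
    exact hφ.2
  have hsplit := Finset.sum_filter_add_sum_filter_not
    (Finset.univ.filter fun φ : V → Fin 2 => Nonconst φ)
    (fun φ => 2 * wt ends w φ < 3 * wt ends w χ) (cp ends p)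
  rw [Finset.filter_filter, Finset.filter_filter] at hsplit
  have hA := failR_le (ends := ends) h0 h1
  have hB := sum_cp_le (ends := ends) h0 h1
  have hF : 0 ≤ failR ends p := hP.le.trans hPF
  have hη : 0 ≤ failR ends p * (1 / (8 * k)) := by positivity
  constructor
  · linarith
  · linarith

end approx

/-! ### Averages over numbers read as strings of digits -/

/-- The average of `f` over the natural numbers below `M`. -/
noncomputable def avg (M : ℕ) (f : ℕ → ℝ) : ℝ := (∑ x ∈ Finset.range M, f x) / M

theorem avg_congr {M : ℕ} {f g : ℕ → ℝ} (h : ∀ x < M, f x = g x) : avg M f = avg M g := by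
  unfold avg
  rw [Finset.sum_congr rfl fun x hx => h x (Finset.mem_range.1 hx)]

theorem avg_mono {M : ℕ} {f g : ℕ → ℝ} (h : ∀ x < M, f x ≤ g x) : avg M f ≤ avg M g :=
  div_le_div_of_nonneg_right (Finset.sum_le_sum fun x hx => h x (Finset.mem_range.1 hx))
    (Nat.cast_nonneg _)

theorem avg_add (M : ℕ) (f g : ℕ → ℝ) : avg M (fun x => f x + g x) = avg M f + avg M g := by
  simp only [avg, Finset.sum_add_distrib, add_div]

theorem avg_mul_left (M : ℕ) (c : ℝ) (f : ℕ → ℝ) : avg M (fun x => c * f x) = c * avg M f := by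
  simp only [avg, ← Finset.mul_sum, mul_div_assoc]

theorem avg_const {M : ℕ} (hM : 0 < M) (c : ℝ) : avg M (fun _ => c) = c := by
  have : (M : ℝ) ≠ 0 := by positivity
  simp only [avg, Finset.sum_const, Finset.card_range, nsmul_eq_mul]
  field_simp

theorem avg_nonneg {M : ℕ} {f : ℕ → ℝ} (h : ∀ x < M, 0 ≤ f x) : 0 ≤ avg M f :=
  div_nonneg (Finset.sum_nonneg fun x hx => h x (Finset.mem_range.1 hx)) (Nat.cast_nonneg _)

theorem avg_sum {ι : Type} (A : Finset ι) (M : ℕ) (f : ι → ℕ → ℝ) :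
    avg M (fun x => ∑ i ∈ A, f i x) = ∑ i ∈ A, avg M (f i) := by
  simp only [avg, ← Finset.sum_div]
  rw [Finset.sum_comm]

/-- The lowest digit of a number and the remaining digits range independently over all pairs. -/
theorem sum_range_mul {β : Type} [AddCommMonoid β] (Q M : ℕ) (f : ℕ → ℕ → β) :
    ∑ x ∈ Finset.range (Q * M), f (x % Q) (x / Q) =
      ∑ a ∈ Finset.range Q, ∑ y ∈ Finset.range M, f a y := by
  rcases Nat.eq_zero_or_pos Q with rfl | hQ
  · simp
  rw [Finset.sum_comm]
  induction M with
  | zero => simp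
  | succ M ih =>
    rw [Nat.mul_succ, Finset.sum_range_add, ih, Finset.sum_range_succ]
    congr 1
    refine Finset.sum_congr rfl fun a ha => ?_
    have ha := Finset.mem_range.1 ha
    rw [Nat.mul_add_mod, Nat.mod_eq_of_lt ha, Nat.mul_add_div hQ, Nat.div_eq_of_lt ha, add_zero]

theorem avg_digit (Q M : ℕ) (f : ℕ → ℕ → ℝ) :
    avg (Q * M) (fun x => f (x % Q) (x / Q)) = avg Q fun a => avg M (f a) := by
  simp only [avg, ← Finset.sum_div]
  rw [sum_range_mul, Nat.cast_mul, div_div, mul_comm (M : ℝ)]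

/-- Reducing a random number modulo `W` yields an almost uniform residue. -/
theorem avg_mod_le {Q W : ℕ} (hQ : 0 < Q) (hW : 0 < W) {g : ℕ → ℝ} (hg : ∀ r, 0 ≤ g r) :
    avg Q (fun a => g (a % W)) ≤ (1 + W / Q) * avg W g := by
  have hQ' : (0 : ℝ) < Q := by positivity
  have hW' : (0 : ℝ) < W := by positivity
  -- Each residue occurs at most `Q / W + 1` times below `Q`.
  have h1 : ∑ a ∈ Finset.range Q, g (a % W) ≤ (Q / W + 1 : ℕ) * ∑ r ∈ Finset.range W, g r := by
    have := sum_range_mul W (Q / W + 1) (fun a _ => g a)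
    simp only [Finset.sum_const, Finset.card_range, nsmul_eq_mul, ← Finset.mul_sum] at this
    rw [← this]
    refine Finset.sum_le_sum_of_subset_of_nonneg (Finset.range_subset_range.2 ?_)
      fun _ _ _ => hg _
    rw [mul_add, mul_one]
    exact (Nat.lt_mul_div_succ Q hW).le
  have h2 : ((Q / W + 1 : ℕ) : ℝ) ≤ Q / W + 1 := by
    push_cast
    exact add_le_add_left Nat.cast_div_le _
  have h3 : 0 ≤ ∑ r ∈ Finset.range W, g r := Finset.sum_nonneg fun _ _ => hg _
  have h4 : (1 + (W : ℝ) / Q) * avg W g = (Q / W + 1) * (∑ r ∈ Finset.range W, g r) / Q := by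
    unfold avg
    field_simp
  rw [h4]
  exact div_le_div_of_nonneg_right (h1.trans (mul_le_mul_of_nonneg_right h2 h3)) hQ'.le

/-- Each residue occurs at least `⌊Q / W⌋` times below `Q`, and this exceeds `Q / W - 1`. -/
theorem le_avg_mod {Q W : ℕ} (hQ : 0 < Q) (hW : 0 < W) {g : ℕ → ℝ} (hg : ∀ r, 0 ≤ g r) :
    (1 - W / Q) * avg W g ≤ avg Q (fun a => g (a % W)) := by
  have hQ' : (0 : ℝ) < Q := by positivity
  have hW' : (0 : ℝ) < W := by positivity
  have h1 : (Q / W : ℕ) * ∑ r ∈ Finset.range W, g r ≤ ∑ a ∈ Finset.range Q, g (a % W) := by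
    have := sum_range_mul W (Q / W) (fun a _ => g a)
    simp only [Finset.sum_const, Finset.card_range, nsmul_eq_mul, ← Finset.mul_sum] at this
    rw [← this]
    exact Finset.sum_le_sum_of_subset_of_nonneg
      (Finset.range_subset_range.2 (Nat.mul_div_le Q W)) fun _ _ _ => hg _
  have h2 : (Q : ℝ) / W - 1 ≤ (Q / W : ℕ) := by
    have : (Q : ℝ) < W * ((Q / W : ℕ) + 1) := by exact_mod_cast Nat.lt_mul_div_succ Q hW
    rw [sub_le_iff_le_add, div_le_iff₀ hW']
    linarith
  have h3 : 0 ≤ ∑ r ∈ Finset.range W, g r := Finset.sum_nonneg fun _ _ => hg _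
  have h4 : (1 - (W : ℝ) / Q) * avg W g = (Q / W - 1) * (∑ r ∈ Finset.range W, g r) / Q := by
    unfold avg
    field_simp
  rw [h4]
  exact div_le_div_of_nonneg_right ((mul_le_mul_of_nonneg_right h2 h3).trans h1) hQ'.le

/-! ### Sample means -/

/-- The digits are independent, so for a centered `Y` the mixed terms vanish and variances add. The
induction splits off the lowest digit. -/
theorem avg_digits_sum {R : ℕ} (hR : 0 < R) {Y : ℕ → ℝ} (hY : avg R Y = 0) (N : ℕ) :
    avg (R ^ N) (fun x => ∑ j ∈ Finset.range N, Y (x / R ^ j % R)) = 0 ∧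
    avg (R ^ N) (fun x => (∑ j ∈ Finset.range N, Y (x / R ^ j % R)) ^ 2) =
      N * avg R fun x => Y x ^ 2 := by
  induction N with
  | zero => simp [avg]
  | succ N ih =>
    have hs : ∀ x, ∑ j ∈ Finset.range (N + 1), Y (x / R ^ j % R) =
        Y (x % R) + ∑ j ∈ Finset.range N, Y (x / R / R ^ j % R) := fun x => by
      rw [Finset.sum_range_succ', add_comm]
      simp [Nat.div_div_eq_div_mul, pow_succ']
    have hp : 0 < R ^ N := by positivity
    simp only [hs, pow_succ' R N]
    constructor
    · rw [avg_digit R (R ^ N) fun a y => Y a + ∑ j ∈ Finset.range N, Y (y / R ^ j % R)]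
      simp only [avg_add, ih.1, avg_const hp, hY, add_zero]
    · rw [avg_digit R (R ^ N) fun a y => (Y a + ∑ j ∈ Finset.range N, Y (y / R ^ j % R)) ^ 2]
      simp only [add_sq, avg_add, avg_mul_left, ih.1, ih.2, avg_const hp, avg_const hR, mul_zero]
      push_cast
      ring

/-- Chebyshev's inequality for the mean of `N` independent samples with values in `[0, B]`. -/
theorem card_mean_le {R : ℕ} (hR : 0 < R) {Y : ℕ → ℝ} {B μ η : ℝ} (hY0 : ∀ x < R, 0 ≤ Y x)
    (hYB : ∀ x < R, Y x ≤ B) (hμ : avg R Y = μ) (hμ0 : 0 < μ) (hη : 0 < η) {N : ℕ}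
    (hN : 8 * B ≤ N * η ^ 2 * μ) :
    (((Finset.range (R ^ N)).filter fun x =>
      ¬ |(∑ j ∈ Finset.range N, Y (x / R ^ j % R)) - N * μ| ≤ η * (N * μ)).card : ℝ) * 8 ≤
        R ^ N := by
  have h0 : avg R (fun x => Y x + -μ) = 0 := by rw [avg_add, hμ, avg_const hR]; ring
  have hB : 0 < B := by
    by_contra h
    have : avg R Y ≤ 0 := by
      rw [← avg_const hR 0]
      exact avg_mono fun x hx => (hYB x hx).trans (not_lt.1 h)
    linarith
  have hN0 : (0 : ℝ) < N := by
    have : 0 < N * η ^ 2 * μ := by linarith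
    by_contra h
    have : (N : ℝ) = 0 := le_antisymm (not_lt.1 h) (Nat.cast_nonneg _)
    simp [this] at *
  have h2 := (avg_digits_sum hR h0 N).2
  -- Since `0 ≤ Y ≤ B`, the second moment is at most `B μ`; the variance is thus linear in `μ`,
  -- which gives control of the relative error.
  have hvar : avg R (fun x => (Y x + -μ) ^ 2) ≤ B * μ := by
    have e : ∀ x, (Y x + -μ) ^ 2 = Y x * Y x + ((-2 * μ) * Y x + μ ^ 2) := fun x => by ring
    simp only [e, avg_add, avg_mul_left, hμ, avg_const hR]
    have : avg R (fun x => Y x * Y x) ≤ B * μ := by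
      rw [← hμ, ← avg_mul_left]
      exact avg_mono fun x hx => mul_le_mul_of_nonneg_right (hYB x hx) (hY0 x hx)
    nlinarith
  have hs : ∀ x, ∑ j ∈ Finset.range N, (Y (x / R ^ j % R) + -μ) =
      (∑ j ∈ Finset.range N, Y (x / R ^ j % R)) - N * μ := fun x => by
    rw [Finset.sum_add_distrib]
    simp
    ring
  simp only [hs] at h2
  set S : ℕ → ℝ := fun x => (∑ j ∈ Finset.range N, Y (x / R ^ j % R)) - N * μ with hS
  have hRN : (0 : ℝ) < R ^ N := by positivity
  have h3 : ∑ x ∈ Finset.range (R ^ N), S x ^ 2 ≤ R ^ N * (N * (B * μ)) := by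
    have : avg (R ^ N) (fun x => S x ^ 2) ≤ N * (B * μ) :=
      h2.le.trans (mul_le_mul_of_nonneg_left hvar hN0.le)
    unfold avg at this
    rw [div_le_iff₀ (by positivity)] at this
    push_cast at this
    linarith
  have h4 : ((Finset.range (R ^ N)).filter fun x => ¬ |S x| ≤ η * (N * μ)).card *
      (η * (N * μ)) ^ 2 ≤ ∑ x ∈ Finset.range (R ^ N), S x ^ 2 := by
    rw [← nsmul_eq_mul, ← Finset.sum_const]
    refine (Finset.sum_le_sum fun x hx => ?_).trans
      (Finset.sum_le_sum_of_subset_of_nonneg (Finset.filter_subset _ _) fun _ _ _ => sq_nonneg _)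
    rw [← sq_abs (S x)]
    have := not_le.1 (Finset.mem_filter.1 hx).2
    gcongr
  have h5 := h4.trans h3
  have hpos : 0 < N * (B * μ) := by positivity
  set c : ℝ := (((Finset.range (R ^ N)).filter fun x => ¬ |S x| ≤ η * (N * μ)).card : ℝ)
  have hc : 0 ≤ c := Nat.cast_nonneg _
  have h6 : 8 * (N * (B * μ)) ≤ (η * (N * μ)) ^ 2 := by
    have : (η * (N * μ)) ^ 2 = (N * η ^ 2 * μ) * (N * μ) := by ring
    rw [this]
    have := mul_le_mul_of_nonneg_right hN (by positivity : 0 ≤ N * μ)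
    linarith
  have h7 : (c * 8) * (N * (B * μ)) ≤ R ^ N * (N * (B * μ)) := by
    refine le_trans ?_ h5
    have := mul_le_mul_of_nonneg_left h6 hc
    linarith
  exact le_of_mul_le_mul_right h7 hpos


/-! ### Random contractions -/

section contraction

variable {n m : ℕ}

/-- The number `r` selects the index `e` when indices are laid out in order, `e` with length
`f e`. -/
def Hit (f : Fin m → ℕ) (r : ℕ) (e : Fin m) : Prop :=
  ∑ j, (if j < e then f j else 0) ≤ r ∧ r < ∑ j, (if j < e then f j else 0) + f e

instance (f : Fin m → ℕ) (r : ℕ) (e : Fin m) : Decidable (Hit f r e) :=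
  inferInstanceAs (Decidable (_ ∧ _))

theorem sum_lt_add (f : Fin m → ℕ) (e : Fin m) :
    ∑ j, (if j < e then f j else 0) + f e = ∑ j, (if j ≤ e then f j else 0) := by
  have : f e = ∑ j, if j = e then f j else 0 := by simp
  rw [this, ← Finset.sum_add_distrib]
  refine Finset.sum_congr rfl fun j _ => ?_
  rcases lt_trichotomy j e with h | h | h
  · simp [h, h.ne, h.le]
  · simp [h]
  · simp [h.not_gt, h.ne', h.not_ge]

theorem Hit.unique {f : Fin m → ℕ} {r : ℕ} {e e' : Fin m} (h : Hit f r e) (h' : Hit f r e') :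
    e = e' := by
  have key : ∀ {e e' : Fin m}, Hit f r e → Hit f r e' → ¬ e < e' := fun {e e'} h h' hlt => by
    have h1 := h.2
    rw [sum_lt_add] at h1
    have h2 : ∑ j, (if j ≤ e then f j else 0) ≤ ∑ j, (if j < e' then f j else 0) :=
      Finset.sum_le_sum fun j _ => by
        by_cases hj : j ≤ e
        · simp [hj, hj.trans_lt hlt]
        · simp [hj]
    have := h'.1
    omega
  rcases lt_trichotomy e e' with hlt | hlt | hlt
  exacts [(key h h' hlt).elim, hlt, (key h' h hlt).elim]

theorem card_hit (f : Fin m → ℕ) (e : Fin m) :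
    ((Finset.range (∑ j, f j)).filter fun r => Hit f r e).card = f e := by
  have h : (Finset.range (∑ j, f j)).filter (fun r => Hit f r e) =
      Finset.Ico (∑ j, (if j < e then f j else 0)) (∑ j, (if j < e then f j else 0) + f e) := by
    ext r
    rw [Finset.mem_filter, Finset.mem_range, Finset.mem_Ico, Hit]
    refine and_iff_right_of_imp fun h => h.2.trans_le ?_
    rw [sum_lt_add]
    refine Finset.sum_le_sum fun j _ => ?_
    split_ifs <;> omega
  rw [h, Nat.card_Ico]
  omega

/-- A count: the intervals have total length `∑ f` and no number lies in two of them, so no number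
below `∑ f` is missed. -/
theorem exists_hit {f : Fin m → ℕ} {r : ℕ} (hr : r < ∑ j, f j) : ∃ e, Hit f r e := by
  by_contra! hno
  have h1 : ∑ r ∈ Finset.range (∑ j, f j), (Finset.univ.filter fun e => Hit f r e).card =
      ∑ j, f j := by
    have := Finset.sum_card_bipartiteAbove_eq_sum_card_bipartiteBelow
      (s := Finset.range (∑ j, f j)) (t := (Finset.univ : Finset (Fin m))) (fun r e => Hit f r e)
    simp only [Finset.bipartiteAbove, Finset.bipartiteBelow, card_hit] at this
    exact this
  have h2 : ∑ r ∈ Finset.range (∑ j, f j), (Finset.univ.filter fun e => Hit f r e).card <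
      ∑ _r ∈ Finset.range (∑ j, f j), 1 := by
    refine Finset.sum_lt_sum (fun x _ => Finset.card_le_one.2 fun a ha b hb =>
      (Finset.mem_filter.1 ha).2.unique (Finset.mem_filter.1 hb).2) ⟨r, Finset.mem_range.2 hr, ?_⟩
    rw [Finset.filter_false_of_mem fun e _ => hno e]
    simp
  simp at h2
  omega

variable (ends : Fin m → Fin n × Fin n) (w : Fin m → ℕ)

/-- The weights of the edges that join different blocks. -/
def crossWt (l : Fin n → Fin n) (e : Fin m) : ℕ := if Cross ends l e then w e else 0

open scoped Classical in
/-- Contract the edge that is selected by the number `r`. -/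
noncomputable def contract (l : Fin n → Fin n) (r : ℕ) : Fin n → Fin n :=
  if h : ∃ e, Hit (crossWt ends w l) r e then merge ends l h.choose else l

theorem wt_eq_sum (l : Fin n → Fin n) : wt ends w l = ∑ e, crossWt ends w l e := rfl

variable {ends w}

theorem contract_eq {l : Fin n → Fin n} {r : ℕ} {e : Fin m} (h : Hit (crossWt ends w l) r e) :
    contract ends w l r = merge ends l e := by
  have hex : ∃ e, Hit (crossWt ends w l) r e := ⟨e, h⟩
  rw [contract, dif_pos hex, hex.choose_spec.unique h]

/-- A uniform `r` below the total crossing weight selects a crossing edge with probability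
proportional to its weight. -/
theorem avg_contract (l : Fin n → Fin n) (F : (Fin n → Fin n) → ℝ) :
    avg (wt ends w l) (fun r => F (contract ends w l r)) =
      (∑ e, (if Cross ends l e then (w e : ℝ) * F (merge ends l e) else 0)) / wt ends w l := by
  unfold avg
  congr 1
  have h1 : ∀ r ∈ Finset.range (wt ends w l), F (contract ends w l r) =
      ∑ e, if Hit (crossWt ends w l) r e then F (merge ends l e) else 0 := fun r hr => by
    obtain ⟨e, he⟩ := exists_hit (f := crossWt ends w l) (Finset.mem_range.1 hr)
    rw [Finset.sum_eq_single e, if_pos he, contract_eq he]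
    · intro e' _ hne
      exact if_neg fun h => hne (h.unique he)
    · simp
  rw [Finset.sum_congr rfl h1, Finset.sum_comm]
  refine Finset.sum_congr rfl fun e _ => ?_
  rw [← Finset.sum_filter, Finset.sum_const, wt_eq_sum, card_hit, nsmul_eq_mul, crossWt]
  split_ifs <;> simp

end contraction

/-! ### Random colorings -/

/-- Prescribing the binary digits in `I` leaves a fraction `2 ^ (-|I|)` of the numbers. The
induction splits off the lowest bit and shifts the remaining positions down. -/
theorem card_testBit (b : ℕ) (I : Finset ℕ) (hI : ∀ i ∈ I, i < b) (g : ℕ → Bool) :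
    ((Finset.range (2 ^ b)).filter fun y => ∀ i ∈ I, y.testBit i = g i).card * 2 ^ I.card =
      2 ^ b := by
  induction b generalizing I g with
  | zero =>
    have : I = ∅ := Finset.eq_empty_of_forall_notMem fun i hi => by simpa using hI i hi
    simp [this]
  | succ b ih =>
    have key := sum_range_mul 2 (2 ^ b) fun a y =>
      if (0 ∈ I → (decide (a = 1)) = g 0) ∧ ∀ i ∈ (I.erase 0).image Nat.pred,
        y.testBit i = g (i + 1) then 1 else 0
    have h0 : ∀ y, (∀ i ∈ I, y.testBit i = g i) ↔ (0 ∈ I → (decide (y % 2 = 1)) = g 0) ∧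
        ∀ i ∈ (I.erase 0).image Nat.pred, (y / 2).testBit i = g (i + 1) := fun y => by
      simp only [Finset.mem_image, Finset.mem_erase, forall_exists_index, and_imp]
      constructor
      · intro h
        refine ⟨fun h0 => ?_, ?_⟩
        · rw [← h 0 h0, Nat.testBit_zero]
        · rintro _ i hi0 hi rfl
          rw [← Nat.testBit_succ, Nat.succ_eq_add_one, Nat.pred_eq_sub_one,
            Nat.sub_add_cancel (Nat.pos_of_ne_zero hi0), h i hi]
      · rintro ⟨h1, h2⟩ i hi
        cases i with
        | zero => rw [← h1 hi, Nat.testBit_zero]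
        | succ i => rw [Nat.testBit_succ]; exact h2 _ (i + 1) (by simp) hi rfl
    rw [pow_succ', Finset.card_filter]
    simp only [h0]
    rw [key]
    have hinj : ((I.erase 0).image Nat.pred).card = (I.erase 0).card :=
      Finset.card_image_of_injOn fun x hx y hy h => by
        have hx := (Finset.mem_erase.1 hx).1
        have hy := (Finset.mem_erase.1 hy).1
        simp only [Nat.pred_eq_sub_one] at h
        omega
    have hr := ih ((I.erase 0).image Nat.pred) (fun i hi => by
      obtain ⟨j, hj, rfl⟩ := Finset.mem_image.1 hi
      have := hI j (Finset.mem_of_mem_erase hj)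
      have := (Finset.mem_erase.1 hj).1
      simp only [Nat.pred_eq_sub_one]
      omega) fun i => g (i + 1)
    rw [hinj] at hr
    have hf : ∀ a : ℕ, (∑ y ∈ Finset.range (2 ^ b), if (0 ∈ I → (decide (a = 1)) = g 0) ∧
        ∀ i ∈ (I.erase 0).image Nat.pred, y.testBit i = g (i + 1) then 1 else 0) =
        if 0 ∈ I → (decide (a = 1)) = g 0 then ((Finset.range (2 ^ b)).filter fun y =>
          ∀ i ∈ (I.erase 0).image Nat.pred, y.testBit i = g (i + 1)).card else 0 := fun a => by
      split_ifs with h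
      · rw [Finset.card_filter]
        exact Finset.sum_congr rfl fun y _ => if_congr (and_iff_right h) rfl rfl
      · exact Finset.sum_eq_zero fun y _ => if_neg fun h' => h h'.1
    rw [Finset.sum_range_succ, Finset.sum_range_one, hf, hf]
    by_cases hz : 0 ∈ I
    · rw [← Finset.card_erase_add_one hz, pow_succ]
      cases hg : g 0 <;> simp only [hz, forall_const] <;> norm_num <;> linarith
    · rw [Finset.erase_eq_of_notMem hz] at hr ⊢
      simp only [hz, false_imp_iff, if_true]
      linarith

/-- The coloring of the blocks of `l` by the binary digits of `y`. -/
def colorOf {n : ℕ} (l : Fin n → Fin n) (y : ℕ) (v : Fin n) : Fin 2 :=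
  ⟨y / 2 ^ (l v : ℕ) % 2, Nat.mod_lt _ two_pos⟩

/-- Different blocks read different binary digits of `y`, at positions given by their labels, so the
block colors are independent fair bits. -/
theorem avg_colorOf {n b : ℕ} (hb : n ≤ b) (l : Fin n → Fin n) (χ : Fin n → Fin 2) :
    avg (2 ^ b) (fun y => if colorOf l y = χ then 1 else 0) =
      if Compat l χ then ((2 : ℝ) ^ blocks l)⁻¹ else 0 := by
  unfold avg
  rw [← Finset.sum_filter, Finset.sum_const, nsmul_eq_mul, mul_one]
  split_ifs with h
  · have h1 : ∀ i : ℕ, ∃ c : Bool, ∀ v, (l v : ℕ) = i → c = decide (χ v = 1) := fun i => by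
      by_cases hv : ∃ v, (l v : ℕ) = i
      · obtain ⟨v, rfl⟩ := hv
        exact ⟨decide (χ v = 1), fun u hu => by rw [h u v (Fin.ext hu)]⟩
      · exact ⟨false, fun v hv' => (hv ⟨v, hv'⟩).elim⟩
    choose g hg using h1
    have h2 := card_testBit b (Finset.univ.image fun v => (l v : ℕ)) (fun i hi => by
      obtain ⟨v, -, rfl⟩ := Finset.mem_image.1 hi
      exact (l v).2.trans_le hb) g
    have h3 : (Finset.univ.image fun v => (l v : ℕ)).card = blocks l := by
      rw [blocks, ← Finset.card_image_of_injective _ Fin.val_injective, Finset.image_image]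
      rfl
    have h4 : ∀ y, (∀ i ∈ Finset.univ.image fun v => (l v : ℕ), y.testBit i = g i) ↔
        colorOf l y = χ := fun y => by
      simp only [Finset.mem_image, Finset.mem_univ, true_and, forall_exists_index,
        forall_apply_eq_imp_iff, funext_iff]
      refine forall_congr' fun v => ?_
      rw [hg _ v rfl, Nat.testBit_eq_decide_div_mod_eq, decide_eq_decide]
      rcases Nat.mod_two_eq_zero_or_one (y / 2 ^ (l v : ℕ)) with h | h <;>
        rcases Fin.exists_fin_two.1 ⟨χ v, rfl⟩ with h' | h' <;>
        simp [h', h, colorOf]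
    simp only [h4, h3] at h2
    have h5 : ((((Finset.range (2 ^ b)).filter fun y => colorOf l y = χ).card : ℕ) : ℝ) *
        2 ^ blocks l = 2 ^ b := by exact_mod_cast h2
    rw [Nat.cast_pow, Nat.cast_ofNat, ← h5]
    have : ((((Finset.range (2 ^ b)).filter fun y => colorOf l y = χ).card : ℕ) : ℝ) ≠ 0 :=
      left_ne_zero_of_mul (h5.trans_ne (by positivity))
    field_simp
  · rw [Finset.filter_false_of_mem]
    · simp
    · rintro y - rfl
      exact h fun u v huv => by simp [colorOf, huv]


/-! ### The contraction estimator -/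

section sampler

variable {n m : ℕ} (ends : Fin m → Fin n × Fin n) (w : Fin m → ℕ)

/-- Contract the edge that is selected by the last digit of a number in base `Q`, and drop that
digit. -/
noncomputable def contractStep (Q : ℕ) (s : (Fin n → Fin n) × ℕ) : (Fin n → Fin n) × ℕ :=
  (contract ends w s.1 (s.2 % Q % wt ends w s.1), s.2 / Q)

/-- Numerator and denominator of the inverse of the probability that a random edge between the `k`
blocks of `l` does not cross a given cut of weight `c`. Unlikely cuts are discarded. -/
def rhoNum (c k : ℕ) (l : Fin n → Fin n) : ℕ := if k * c ≤ 3 * wt ends w l then wt ends w l else 0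

/-- The denominator that belongs to `rhoNum`. -/
def rhoDen (c k : ℕ) (l : Fin n → Fin n) : ℕ :=
  if k * c ≤ 3 * wt ends w l then wt ends w l - c else 1

/-- The inverse of the probability that a random edge does not cross the cut. -/
noncomputable def rho (c k : ℕ) (l : Fin n → Fin n) : ℝ := rhoNum ends w c k l / rhoDen ends w c k l

/-- The product of the inverse probabilities along a run of `d` contractions that ends with `k`
blocks. -/
noncomputable def rhoProd (Q c k d : ℕ) (s : (Fin n → Fin n) × ℕ) : ℝ :=
  ∏ i ∈ Finset.range d, rho ends w c (k + d - i) ((contractStep ends w Q)^[i] s).1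

variable {ends w} {Q c k d : ℕ} {l : Fin n → Fin n} {χ : Fin n → Fin 2}

theorem rho_nonneg : 0 ≤ rho ends w c k l := by unfold rho; positivity

theorem rhoProd_nonneg (s : (Fin n → Fin n) × ℕ) : 0 ≤ rhoProd ends w Q c k d s :=
  Finset.prod_nonneg fun _ _ => rho_nonneg

theorem rhoProd_succ (s : (Fin n → Fin n) × ℕ) :
    rhoProd ends w Q c k (d + 1) s =
      rho ends w c (k + d + 1) s.1 * rhoProd ends w Q c k d (contractStep ends w Q s) := by
  unfold rhoProd
  rw [Finset.prod_range_succ', mul_comm]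
  congr 1
  refine Finset.prod_congr rfl fun i hi => ?_
  rw [Function.iterate_succ_apply]
  congr 1
  omega

theorem rhoDen_pos (hc : 0 < c) (hk : 4 ≤ k) : 0 < rhoDen ends w c k l := by
  unfold rhoDen
  split_ifs with h
  · have : 4 * c ≤ k * c := Nat.mul_le_mul_right _ hk
    omega
  · exact one_pos

/-- If the guard holds, then `c ≤ 3 W / (d + 4)`, so `W / (W - c) ≤ (d + 4) / (d + 1)`; otherwise
the value is `0`. The guard thus bounds the estimator on every run. -/
theorem rho_le (hc : 0 < c) : rho ends w c (d + 4) l ≤ (d + 4) / (d + 1) := by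
  have hpos := rhoDen_pos (ends := ends) (w := w) (l := l) hc (Nat.le_add_left 4 d)
  rw [rho]
  have hpos' : (0 : ℝ) < rhoDen ends w c (d + 4) l := by exact_mod_cast hpos
  rw [div_le_div_iff₀ hpos' (by positivity)]
  unfold rhoNum rhoDen at *
  split_ifs at * with h
  · have h1 : c ≤ wt ends w l := by omega
    rw [Nat.cast_sub h1]
    have : ((d : ℝ) + 4) * c ≤ 3 * wt ends w l := by exact_mod_cast h
    linarith
  · simp
    positivity

/-- The bounds `r / (r - 3)` of the single steps telescope to a binomial coefficient. -/
theorem rhoProd_le (hc : 0 < c) (d : ℕ) (s : (Fin n → Fin n) × ℕ) :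
    rhoProd ends w Q c 3 d s ≤ (d + 3).choose 3 := by
  induction d generalizing s with
  | zero => simp [rhoProd]
  | succ d ih =>
    rw [rhoProd_succ]
    have h1 := ih (contractStep ends w Q s)
    have h2 : rho ends w c (3 + d + 1) s.1 ≤ (d + 4) / (d + 1) := by
      rw [show 3 + d + 1 = d + 4 by omega]
      exact rho_le hc
    have h3 : ((d + 1 + 3).choose 3 : ℝ) = (d + 4) / (d + 1) * (d + 3).choose 3 := by
      have : (d + 1 + 3).choose 3 * (d + 1) = (d + 4) * (d + 3).choose 3 := by
        have := Nat.add_one_mul_choose_eq (d + 3) d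
        rw [show (d + 1 + 3).choose 3 = (d + 4).choose (d + 1) from
          (Nat.choose_symm_of_eq_add (by omega)), show (d + 3).choose 3 = (d + 3).choose d from
          (Nat.choose_symm_of_eq_add (by omega))]
        exact this.symm
      have : ((d + 1 + 3).choose 3 : ℝ) * (d + 1) = (d + 4) * (d + 3).choose 3 := by
        exact_mod_cast this
      field_simp
      linarith
    rw [h3]
    exact mul_le_mul h2 h1 (rhoProd_nonneg _) (by positivity)

variable (ends w Q c k d χ) in
/-- The contribution of the coloring `χ` to the estimator. -/
noncomputable def colorTerm (s : (Fin n → Fin n) × ℕ) : ℝ :=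
  (if colorOf ((contractStep ends w Q)^[d] s).1 ((contractStep ends w Q)^[d] s).2 = χ
    then 1 else 0) * rhoProd ends w Q c k d s

theorem colorTerm_nonneg (s : (Fin n → Fin n) × ℕ) : 0 ≤ colorTerm ends w Q c k d χ s :=
  mul_nonneg (by split_ifs <;> simp) (rhoProd_nonneg s)

theorem avg_colorTerm_zero {b : ℕ} (hb : n ≤ b) :
    avg (Q ^ 0 * 2 ^ b) (fun x => colorTerm ends w Q c k 0 χ (l, x)) =
      if Compat l χ then ((2 : ℝ) ^ blocks l)⁻¹ else 0 := by
  rw [pow_zero, one_mul, ← avg_colorOf hb]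
  refine avg_congr fun x _ => ?_
  rw [colorTerm, rhoProd, Finset.prod_range_zero, mul_one]
  congr

/-- The lowest digit decides the first contraction; the other digits are independent of it and drive
the rest of the run. -/
theorem avg_colorTerm_succ {M : ℕ} :
    avg (Q ^ (d + 1) * M) (fun x => colorTerm ends w Q c k (d + 1) χ (l, x)) =
      rho ends w c (k + d + 1) l * avg Q fun a => avg (Q ^ d * M) fun x =>
        colorTerm ends w Q c k d χ (contract ends w l (a % wt ends w l), x) := by
  rw [← avg_mul_left, pow_succ', mul_assoc]
  simp only [← avg_mul_left]
  rw [← avg_digit Q (Q ^ d * M) fun a x => rho ends w c (k + d + 1) l *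
    colorTerm ends w Q c k d χ (contract ends w l (a % wt ends w l), x)]
  refine avg_congr fun x _ => ?_
  rw [colorTerm, rhoProd_succ, colorTerm, Function.iterate_succ_apply]
  exact mul_left_comm _ _ _

theorem rho_mul_eq_zero (hW : wt ends w l = 0) : rho ends w c k l = 0 := by
  simp [rho, rhoNum, hW]

/-- A contraction spares `χ` with probability `(W - c) / W`, up to the factor `1 + δ` from reducing
a digit modulo `W`. The factor `rho` cancels this, and the guard can only lower the result. At the
end each coloring of the `k` blocks has probability `2 ^ (-k)`. -/
theorem avg_colorTerm_le {b : ℕ} (hb : n ≤ b) (hQ : 0 < Q) {δ : ℝ}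
    (hδ : ∀ l : Fin n → Fin n, (wt ends w l : ℝ) ≤ δ * Q) (d : ℕ) :
    ∀ l : Fin n → Fin n, blocks l = k + d →
      avg (Q ^ d * 2 ^ b) (fun x => colorTerm ends w Q (wt ends w χ) k d χ (l, x)) ≤
        if Compat l χ then (1 + δ) ^ d * ((2 : ℝ) ^ k)⁻¹ else 0 := by
  have hQ' : (0 : ℝ) < Q := by positivity
  have hδ0 : 0 ≤ δ := by
    by_contra h
    have := hδ id
    have h2 : (0 : ℝ) ≤ wt ends w (id : Fin n → Fin n) := Nat.cast_nonneg _
    nlinarith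
  induction d with
  | zero =>
    intro l hl
    rw [avg_colorTerm_zero hb, hl]
    simp
  | succ d ih =>
    intro l hl
    rw [avg_colorTerm_succ]
    rcases Nat.eq_zero_or_pos (wt ends w l) with hW | hW
    · rw [rho_mul_eq_zero hW, zero_mul]
      split_ifs <;> positivity
    have hW' : (0 : ℝ) < wt ends w l := by exact_mod_cast hW
    set V : (Fin n → Fin n) → ℝ := fun l =>
      avg (Q ^ d * 2 ^ b) fun x => colorTerm ends w Q (wt ends w χ) k d χ (l, x) with hV
    have hV0 : ∀ l, 0 ≤ V l := fun l => avg_nonneg fun x _ => colorTerm_nonneg _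
    have h1 := avg_mod_le (Q := Q) hQ hW (g := fun r => V (contract ends w l r)) fun r => hV0 _
    rw [avg_contract] at h1
    set c := wt ends w χ with hc
    set S : ℝ := ∑ e, (if Cross ends l e then (w e : ℝ) * V (merge ends l e) else 0) with hS
    have hdiv : (wt ends w l : ℝ) / Q ≤ δ := (div_le_iff₀ hQ').2 (hδ l)
    by_cases hl' : Compat l χ
    · rw [if_pos hl']
      have hSle : S ≤ (wt ends w l - c : ℕ) * ((1 + δ) ^ d * ((2 : ℝ) ^ k)⁻¹) := by
        have h2 := wt_compat (ends := ends) (w := w) hl'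
        rw [← h2, Nat.add_sub_cancel_left, Nat.cast_sum, Finset.sum_mul]
        refine Finset.sum_le_sum fun e _ => ?_
        by_cases he : Cross ends l e
        · rw [if_pos he]
          have h3 := ih (merge ends l e) (by have := blocks_merge he; omega)
          by_cases he' : Cross ends χ e
          · rw [if_neg (fun h => (compat_merge.1 h).2 he')] at h3
            simp only [he, he', not_true, and_false, if_false, Nat.cast_zero, zero_mul]
            exact mul_nonpos_of_nonneg_of_nonpos (Nat.cast_nonneg _) h3
          · rw [if_pos (compat_merge.2 ⟨hl', he'⟩)] at h3
            simp only [he, he', not_false_eq_true, and_self, if_true]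
            exact mul_le_mul_of_nonneg_left h3 (Nat.cast_nonneg _)
        · simp [he]
      -- The product is `1` if the guard holds and `c < W`, and `0` otherwise, by truncated
      -- subtraction or by the guard.
      have hrho : rho ends w c (k + d + 1) l * ((wt ends w l - c : ℕ) / wt ends w l) ≤ 1 := by
        unfold rho rhoNum rhoDen
        split_ifs
        · by_cases h0 : wt ends w l - c = 0
          · simp [h0]
          · have : ((wt ends w l - c : ℕ) : ℝ) ≠ 0 := by exact_mod_cast h0
            exact le_of_eq (by field_simp)
        · simp
      calc _ ≤ rho ends w c (k + d + 1) l * ((1 + δ) * (((wt ends w l - c : ℕ) *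
            ((1 + δ) ^ d * ((2 : ℝ) ^ k)⁻¹)) / wt ends w l)) := by
            refine mul_le_mul_of_nonneg_left (h1.trans (mul_le_mul (by linarith) ?_ ?_ ?_))
              rho_nonneg
            · exact div_le_div_of_nonneg_right hSle hW'.le
            · refine div_nonneg (Finset.sum_nonneg fun e _ => ?_) hW'.le
              split_ifs
              exacts [mul_nonneg (Nat.cast_nonneg _) (hV0 _), le_rfl]
            · linarith
        _ = (rho ends w c (k + d + 1) l * ((wt ends w l - c : ℕ) / wt ends w l)) *
            ((1 + δ) ^ (d + 1) * ((2 : ℝ) ^ k)⁻¹) := by ring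
        _ ≤ 1 * ((1 + δ) ^ (d + 1) * ((2 : ℝ) ^ k)⁻¹) :=
            mul_le_mul_of_nonneg_right hrho (by positivity)
        _ = _ := one_mul _
    · rw [if_neg hl']
      have hSle : S ≤ 0 := Finset.sum_nonpos fun e _ => by
        split_ifs with he
        · have h3 := ih (merge ends l e) (by have := blocks_merge he; omega)
          rw [if_neg (fun h => hl' (compat_merge.1 h).1)] at h3
          exact mul_nonpos_of_nonneg_of_nonpos (Nat.cast_nonneg _) h3
        · exact le_rfl
      refine mul_nonpos_of_nonneg_of_nonpos rho_nonneg (h1.trans ?_)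
      exact mul_nonpos_of_nonneg_of_nonpos (by positivity)
        (div_nonpos_of_nonpos_of_nonneg hSle hW'.le)

/-- For a cut of weight at most `3 / 2` times the minimum the guard never discards a compatible run,
so the cancellation is exact. The alternative `d = 0` covers networks with fewer than three
vertices, where nothing is contracted. -/
theorem le_avg_colorTerm {b : ℕ} (hb : n ≤ b) (hQ : 0 < Q) {δ : ℝ} (hδ1 : δ ≤ 1)
    (hδ : ∀ l : Fin n → Fin n, (wt ends w l : ℝ) ≤ δ * Q) {c₀ : ℕ} (hc0 : 0 < wt ends w χ)
    (hc : ∀ φ : Fin n → Fin 2, Nonconst φ → c₀ ≤ wt ends w φ) (hχ : 2 * wt ends w χ ≤ 3 * c₀)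
    (d : ℕ) (hk : d = 0 ∨ 3 ≤ k) :
    ∀ l : Fin n → Fin n, blocks l = k + d → Compat l χ →
      (1 - δ) ^ d * ((2 : ℝ) ^ k)⁻¹ ≤
        avg (Q ^ d * 2 ^ b) (fun x => colorTerm ends w Q (wt ends w χ) k d χ (l, x)) := by
  have hQ' : (0 : ℝ) < Q := by positivity
  induction d with
  | zero =>
    intro l hl hl'
    rw [avg_colorTerm_zero hb, hl, if_pos hl']
    simp
  | succ d ih =>
    intro l hl hl'
    have hk : 3 ≤ k := hk.resolve_left (by omega)
    rw [avg_colorTerm_succ]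
    have hbl := blocks_mul_le hc (nonconst_of_two_le_blocks (l := l) (by omega))
    set c := wt ends w χ with hcdef
    -- With `r` blocks, `r c₀ ≤ 2 W`; together with `2 c ≤ 3 c₀` this gives `r c ≤ 3 W`.
    have hguard : (k + d + 1) * c ≤ 3 * wt ends w l := by
      rw [hl] at hbl
      have : (k + (d + 1)) * (2 * c) ≤ (k + (d + 1)) * (3 * c₀) := Nat.mul_le_mul_left _ hχ
      nlinarith
    have h4 : 4 * c ≤ (k + d + 1) * c := Nat.mul_le_mul_right _ (by omega)
    have hcW : c < wt ends w l := by omega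
    have hW : 0 < wt ends w l := by omega
    have hW' : (0 : ℝ) < wt ends w l := by exact_mod_cast hW
    set V : (Fin n → Fin n) → ℝ := fun l =>
      avg (Q ^ d * 2 ^ b) fun x => colorTerm ends w Q c k d χ (l, x) with hV
    have hV0 : ∀ l, 0 ≤ V l := fun l => avg_nonneg fun x _ => colorTerm_nonneg _
    have h1 := le_avg_mod (Q := Q) hQ hW (g := fun r => V (contract ends w l r)) fun r => hV0 _
    rw [avg_contract] at h1
    set S : ℝ := ∑ e, (if Cross ends l e then (w e : ℝ) * V (merge ends l e) else 0) with hS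
    have hdiv : (wt ends w l : ℝ) / Q ≤ δ := (div_le_iff₀ hQ').2 (hδ l)
    have hSle : (wt ends w l - c : ℕ) * ((1 - δ) ^ d * ((2 : ℝ) ^ k)⁻¹) ≤ S := by
      have h2 := wt_compat (ends := ends) (w := w) hl'
      rw [← h2, Nat.add_sub_cancel_left, Nat.cast_sum, Finset.sum_mul]
      refine Finset.sum_le_sum fun e _ => ?_
      by_cases he : Cross ends l e
      · rw [if_pos he]
        by_cases he' : Cross ends χ e
        · simp only [he, he', not_true, and_false, if_false, Nat.cast_zero, zero_mul]
          exact mul_nonneg (Nat.cast_nonneg _) (hV0 _)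
        · have h3 := ih (Or.inr hk) (merge ends l e) (by have := blocks_merge he; omega)
            (compat_merge.2 ⟨hl', he'⟩)
          simp only [he, he', not_false_eq_true, and_self, if_true]
          exact mul_le_mul_of_nonneg_left h3 (Nat.cast_nonneg _)
      · simp [he]
    have hrho : rho ends w c (k + d + 1) l * ((wt ends w l - c : ℕ) / wt ends w l) = 1 := by
      unfold rho rhoNum rhoDen
      rw [if_pos hguard, if_pos hguard]
      have : ((wt ends w l - c : ℕ) : ℝ) ≠ 0 := by
        have : wt ends w l - c ≠ 0 := by omega
        exact_mod_cast this
      field_simp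
    have hd0 : 0 ≤ 1 - δ := by linarith
    calc (1 - δ) ^ (d + 1) * ((2 : ℝ) ^ k)⁻¹
        = (rho ends w c (k + d + 1) l * ((wt ends w l - c : ℕ) / wt ends w l)) *
          ((1 - δ) ^ (d + 1) * ((2 : ℝ) ^ k)⁻¹) := by rw [hrho, one_mul]
      _ = rho ends w c (k + d + 1) l * ((1 - δ) * (((wt ends w l - c : ℕ) *
            ((1 - δ) ^ d * ((2 : ℝ) ^ k)⁻¹)) / wt ends w l)) := by ring
      _ ≤ _ := by
        refine mul_le_mul_of_nonneg_left (le_trans ?_ h1) rho_nonneg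
        refine mul_le_mul (by linarith) (div_le_div_of_nonneg_right hSle hW'.le) (by positivity)
          (by linarith)

end sampler


/-! ### The contraction estimator as a fraction, its range and its expectation -/

section sampler

variable {n m : ℕ} (ends : Fin m → Fin n × Fin n) (w a den : Fin m → ℕ)

/-- The failure probabilities with numerators `a` and denominators `den`. -/
noncomputable def prb (e : Fin m) : ℝ := a e / den e

/-- The random coloring that remains after all but three blocks have been contracted. -/
noncomputable def runColor (Q x : ℕ) : Fin n → Fin 2 :=
  colorOf ((contractStep ends w Q)^[n - 3] (id, x)).1 ((contractStep ends w Q)^[n - 3] (id, x)).2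

/-- The numerator of the contraction estimator. -/
noncomputable def zNum (Q x : ℕ) : ℕ :=
  if wt ends w (runColor ends w Q x) = 0 then 0 else
    2 ^ (n - (n - 3) - 1) * (∏ e, if Cross ends (runColor ends w Q x) e then a e else 1) *
      ∏ i ∈ Finset.range (n - 3), rhoNum ends w (wt ends w (runColor ends w Q x)) (n - i)
        ((contractStep ends w Q)^[i] (id, x)).1

/-- The denominator of the contraction estimator. -/
noncomputable def zDen (Q x : ℕ) : ℕ :=
  if wt ends w (runColor ends w Q x) = 0 then 1 else
    (∏ e, if Cross ends (runColor ends w Q x) e then den e else 1) *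
      ∏ i ∈ Finset.range (n - 3), rhoDen ends w (wt ends w (runColor ends w Q x)) (n - i)
        ((contractStep ends w Q)^[i] (id, x)).1

/-- The contraction estimator. -/
noncomputable def zVal (Q x : ℕ) : ℝ := zNum ends w a Q x / zDen ends w den Q x

variable {ends w a den} {Q : ℕ}

theorem zDen_pos (hden : ∀ e, 0 < den e) (x : ℕ) : 0 < zDen ends w den Q x := by
  unfold zDen
  split_ifs with h
  · exact one_pos
  · refine Nat.mul_pos (Finset.prod_pos fun e _ => ?_) (Finset.prod_pos fun i hi => ?_)
    · split_ifs
      exacts [hden e, one_pos]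
    · have := Finset.mem_range.1 hi
      exact rhoDen_pos (Nat.pos_of_ne_zero h) (by omega)

theorem zVal_nonneg (x : ℕ) : 0 ≤ zVal ends w a den Q x := by unfold zVal; positivity

theorem cp_prb (χ : Fin n → Fin 2) : cp ends (prb a den) χ =
    ((∏ e, if Cross ends χ e then a e else 1 : ℕ) : ℝ) /
      (∏ e, if Cross ends χ e then den e else 1 : ℕ) := by
  rw [cp, Nat.cast_prod, Nat.cast_prod, ← Finset.prod_div_distrib]
  refine Finset.prod_congr rfl fun e _ => ?_
  by_cases h : Cross ends χ e <;> simp [h, prb]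

theorem zVal_eq (hn : 0 < n) (x : ℕ) : zVal ends w a den Q x =
    if wt ends w (runColor ends w Q x) = 0 then 0 else
      2 ^ (n - (n - 3) - 1) * cp ends (prb a den) (runColor ends w Q x) *
        rhoProd ends w Q (wt ends w (runColor ends w Q x)) (n - (n - 3)) (n - 3) (id, x) := by
  unfold zVal zNum zDen
  split_ifs with h
  · simp
  · have : rhoProd ends w Q (wt ends w (runColor ends w Q x)) (n - (n - 3)) (n - 3) (id, x) =
        ((∏ i ∈ Finset.range (n - 3), rhoNum ends w (wt ends w (runColor ends w Q x)) (n - i)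
          ((contractStep ends w Q)^[i] (id, x)).1 : ℕ) : ℝ) /
        (∏ i ∈ Finset.range (n - 3), rhoDen ends w (wt ends w (runColor ends w Q x)) (n - i)
          ((contractStep ends w Q)^[i] (id, x)).1 : ℕ) := by
      rw [Nat.cast_prod, Nat.cast_prod, ← Finset.prod_div_distrib, rhoProd]
      refine Finset.prod_congr rfl fun i _ => ?_
      rw [show n - (n - 3) + (n - 3) - i = n - i by omega, rho]
    rw [cp_prb, this]
    push_cast
    rw [mul_div_mul_comm, mul_div_assoc]

/-- The sampled cut has `cp ≤ F`, the product of the `rho` is at most `n.choose 3`, and the power of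
two is at most `4`. Being bounded by a polynomial multiple of `F`, the estimator has small relative
variance when its mean is comparable to `F`. -/
theorem zVal_le (hn : 0 < n) (hden : ∀ e, 0 < den e) (ha : ∀ e, a e ≤ den e) (x : ℕ) :
    zVal ends w a den Q x ≤ 4 * n ^ 3 * failR ends (prb a den) := by
  have h0 : ∀ e, 0 ≤ prb a den e := fun e => by unfold prb; positivity
  have h1 : ∀ e, prb a den e ≤ 1 := fun e => by
    have := hden e
    exact div_le_one_of_le₀ (by exact_mod_cast ha e) (Nat.cast_nonneg _)
  have hF : 0 ≤ failR ends (prb a den) := by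
    have := failRec_nonneg (ends := ends) h0 h1 (List.finRange m) (id : Fin n → Fin n)
    rwa [failRec_eq _ _ (List.nodup_finRange m), List.toFinset_finRange] at this
  rw [zVal_eq hn]
  split_ifs with h
  · positivity
  set χ := runColor ends w Q x
  have hχ : Nonconst χ := by
    by_contra hno
    refine h (Finset.sum_eq_zero fun e _ => if_neg fun he => hno ⟨_, _, he⟩)
  have hcp := cp_le_failR h0 h1 hχ (ends := ends)
  have hcp0 := cp_nonneg (ends := ends) h0 χ
  have key : 2 ^ (n - (n - 3) - 1) *
      rhoProd ends w Q (wt ends w χ) (n - (n - 3)) (n - 3) (id, x) ≤ 4 * n ^ 3 := by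
    rcases lt_or_ge n 3 with h3 | h3
    · rw [show n - 3 = 0 by omega]
      simp only [rhoProd, Finset.prod_range_zero, mul_one]
      interval_cases n <;> norm_num
    · rw [show n - (n - 3) = 3 by omega]
      have h4 := rhoProd_le (ends := ends) (w := w) (Q := Q) (Nat.pos_of_ne_zero h) (n - 3)
        (id, x)
      rw [Nat.sub_add_cancel h3] at h4
      have h5 : (n.choose 3 : ℝ) ≤ n ^ 3 := by exact_mod_cast Nat.choose_le_pow n 3
      norm_num
      linarith
  calc _ = (2 ^ (n - (n - 3) - 1) *
      rhoProd ends w Q (wt ends w χ) (n - (n - 3)) (n - 3) (id, x)) * cp ends (prb a den) χ := by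
        ring
    _ ≤ (4 * n ^ 3) * failR ends (prb a den) := mul_le_mul key hcp hcp0 (by positivity)

theorem avg_zVal (hn : 0 < n) (M : ℕ) : avg M (zVal ends w a den Q) =
    ∑ χ : Fin n → Fin 2 with wt ends w χ ≠ 0, 2 ^ (n - (n - 3) - 1) * cp ends (prb a den) χ *
      avg M (fun x => colorTerm ends w Q (wt ends w χ) (n - (n - 3)) (n - 3) χ (id, x)) := by
  simp only [← avg_mul_left]
  rw [← avg_sum]
  refine avg_congr fun x _ => ?_
  rw [zVal_eq hn]
  have hterm : ∀ χ : Fin n → Fin 2, colorTerm ends w Q (wt ends w χ) (n - (n - 3)) (n - 3) χ (id, x)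
      = (if runColor ends w Q x = χ then 1 else 0) *
        rhoProd ends w Q (wt ends w χ) (n - (n - 3)) (n - 3) (id, x) := fun χ => rfl
  simp only [hterm]
  rw [Finset.sum_filter, Finset.sum_eq_single (runColor ends w Q x)]
  · by_cases h : wt ends w (runColor ends w Q x) = 0 <;> simp [h]
  · intro χ _ hne
    rw [if_neg (Ne.symm hne)]
    simp
  · simp

theorem wt_eq_zero_of_not_nonconst {χ : Fin n → Fin 2} (h : ¬ Nonconst χ) : wt ends w χ = 0 :=
  Finset.sum_eq_zero fun _ _ => if_neg fun he => h ⟨_, _, he⟩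

theorem compat_id {V κ : Type} (χ : V → κ) : Compat id χ := fun _ _ h => congrArg χ h

/-- `n - (n - 3)` is the number `min n 3` of final blocks. The estimator multiplies by half the
number of their colorings, because both colorings of a cut are sampled. -/
theorem half_pow (hn : 0 < n) :
    (2 : ℝ) ^ (n - (n - 3) - 1) * ((2 : ℝ) ^ (n - (n - 3)))⁻¹ = 1 / 2 := by
  obtain ⟨k, hk⟩ : ∃ k, n - (n - 3) = k + 1 := ⟨n - (n - 3) - 1, by omega⟩
  rw [hk, Nat.add_sub_cancel, pow_succ]
  field_simp

variable {b : ℕ} {δ : ℝ}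

theorem avg_zVal_le (hn : 0 < n) (hb : n ≤ b) (hQ : 0 < Q)
    (hδ : ∀ l : Fin n → Fin n, (wt ends w l : ℝ) ≤ δ * Q) :
    avg (Q ^ (n - 3) * 2 ^ b) (zVal ends w a den Q) ≤
      (1 + δ) ^ (n - 3) * (1 / 2 * ∑ χ : Fin n → Fin 2 with Nonconst χ, cp ends (prb a den) χ) := by
  have h0 : ∀ e, 0 ≤ prb a den e := fun e => by unfold prb; positivity
  have hbl : blocks (id : Fin n → Fin n) = n - (n - 3) + (n - 3) := by
    simp [blocks]
  rw [avg_zVal hn, Finset.mul_sum, Finset.mul_sum]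
  refine (Finset.sum_le_sum_of_subset_of_nonneg (t := Finset.univ.filter Nonconst)
    (fun χ h => ?_) fun χ _ _ => ?_).trans (Finset.sum_le_sum fun χ _ => ?_)
  · have := (Finset.mem_filter.1 h).2
    exact Finset.mem_filter.2 ⟨Finset.mem_univ _, by_contra fun h' =>
      this (wt_eq_zero_of_not_nonconst h')⟩
  · exact mul_nonneg (mul_nonneg (by positivity) (cp_nonneg h0 χ))
      (avg_nonneg fun x _ => colorTerm_nonneg _)
  · have h2 := avg_colorTerm_le (χ := χ) hb hQ hδ (n - 3) id hbl
    rw [if_pos (compat_id χ)] at h2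
    calc _ ≤ 2 ^ (n - (n - 3) - 1) * cp ends (prb a den) χ *
          ((1 + δ) ^ (n - 3) * ((2 : ℝ) ^ (n - (n - 3)))⁻¹) :=
          mul_le_mul_of_nonneg_left h2 (mul_nonneg (by positivity) (cp_nonneg h0 χ))
      _ = (1 + δ) ^ (n - 3) * ((2 : ℝ) ^ (n - (n - 3) - 1) * ((2 : ℝ) ^ (n - (n - 3)))⁻¹ *
          cp ends (prb a den) χ) := by ring
      _ = _ := by rw [half_pow hn]

theorem le_avg_zVal (hn : 0 < n) (hb : n ≤ b) (hQ : 0 < Q)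
    (hδ : ∀ l : Fin n → Fin n, (wt ends w l : ℝ) ≤ δ * Q) (hδ1 : δ ≤ 1) {c : ℕ} (hc0 : 0 < c)
    (hc : ∀ φ : Fin n → Fin 2, Nonconst φ → c ≤ wt ends w φ) :
    (1 - δ) ^ (n - 3) * (1 / 2 * ∑ χ : Fin n → Fin 2 with Nonconst χ ∧ 2 * wt ends w χ < 3 * c,
      cp ends (prb a den) χ) ≤ avg (Q ^ (n - 3) * 2 ^ b) (zVal ends w a den Q) := by
  have h0 : ∀ e, 0 ≤ prb a den e := fun e => by unfold prb; positivity
  have hbl : blocks (id : Fin n → Fin n) = n - (n - 3) + (n - 3) := by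
    simp [blocks]
  rw [avg_zVal hn, Finset.mul_sum, Finset.mul_sum]
  refine (Finset.sum_le_sum fun χ hχ => ?_).trans (Finset.sum_le_sum_of_subset_of_nonneg
    (s := Finset.univ.filter fun χ : Fin n → Fin 2 => Nonconst χ ∧ 2 * wt ends w χ < 3 * c)
    (fun χ h => ?_) fun χ _ _ => ?_)
  · have hχ := (Finset.mem_filter.1 hχ).2
    have h2 := le_avg_colorTerm (χ := χ) (k := n - (n - 3)) hb hQ hδ1 hδ
      (hc0.trans_le (hc χ hχ.1)) hc hχ.2.le (n - 3) (by omega) id hbl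
      (compat_id χ)
    calc (1 - δ) ^ (n - 3) * (1 / 2 * cp ends (prb a den) χ)
        = (1 - δ) ^ (n - 3) * ((2 : ℝ) ^ (n - (n - 3) - 1) * ((2 : ℝ) ^ (n - (n - 3)))⁻¹ *
          cp ends (prb a den) χ) := by rw [half_pow hn]
      _ = 2 ^ (n - (n - 3) - 1) * cp ends (prb a den) χ *
          ((1 - δ) ^ (n - 3) * ((2 : ℝ) ^ (n - (n - 3)))⁻¹) := by ring
      _ ≤ _ := mul_le_mul_of_nonneg_left h2 (mul_nonneg (by positivity) (cp_nonneg h0 χ))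
  · have h' := (Finset.mem_filter.1 h).2
    exact Finset.mem_filter.2 ⟨Finset.mem_univ _, (hc0.trans_le (hc χ h'.1)).ne'⟩
  · exact mul_nonneg (mul_nonneg (by positivity) (cp_nonneg h0 χ))
      (avg_nonneg fun x _ => colorTerm_nonneg _)

end sampler

/-! ### Direct simulation -/

section simulation

variable {n m : ℕ}

/-- Merge the end blocks of all the edges that satisfy `c`. -/
def mergeAll (ends : Fin m → Fin n × Fin n) (c : Fin m → Prop) [DecidablePred c]
    (l : Fin n → Fin n) : Fin n → Fin n :=
  (List.finRange m).foldl (fun l e => if c e then merge ends l e else l) l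

theorem mergeAll_succ (ends : Fin (m + 1) → Fin n × Fin n) (c : Fin (m + 1) → Prop)
    [DecidablePred c] (l : Fin n → Fin n) :
    mergeAll ends c l = mergeAll (fun e => ends e.succ) (fun e => c e.succ)
      (if c 0 then merge ends l 0 else l) := by
  rw [mergeAll, List.finRange_succ, List.foldl_cons, List.foldl_map]
  rfl

theorem mergeAll_congr {ends : Fin m → Fin n × Fin n} {c c' : Fin m → Prop} [DecidablePred c]
    [DecidablePred c'] (h : ∀ e, c e ↔ c' e) (l : Fin n → Fin n) :
    mergeAll ends c l = mergeAll ends c' l := by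
  unfold mergeAll
  congr 1
  funext l e
  exact if_congr (h e) rfl rfl

theorem compat_mergeAll {κ : Type} {ends : Fin m → Fin n × Fin n} {c : Fin m → Prop}
    [DecidablePred c] {l : Fin n → Fin n} {ψ : Fin n → κ} :
    Compat (mergeAll ends c l) ψ ↔ Compat l ψ ∧ ∀ e, c e → ¬ Cross ends ψ e := by
  induction m generalizing l with
  | zero => simp [mergeAll]
  | succ m ih =>
    rw [mergeAll_succ, ih, Fin.forall_fin_succ]
    have : ∀ e : Fin m, Cross (fun e => ends e.succ) ψ e ↔ Cross ends ψ e.succ := fun _ => Iff.rfl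
    simp only [this]
    by_cases h : c 0
    · simp [h, compat_merge, and_assoc]
    · simp [h]

theorem nonconst_mergeAll {ends : Fin m → Fin n × Fin n} {c : Fin m → Prop} [DecidablePred c] :
    Nonconst (mergeAll ends c id) ↔
      ∃ χ : Fin n → Fin 2, Nonconst χ ∧ ∀ e, c e → ¬ Cross ends χ e := by
  rw [← exists_compat_iff]
  refine exists_congr fun χ => and_congr_right fun _ => ?_
  rw [compat_mergeAll, and_iff_right (compat_id χ)]

/-- The edge `e` survives if the `e`-th digit of the random number `x` is large enough. -/
def Surv (a den : Fin m → ℕ) (Q x : ℕ) (e : Fin m) : Prop :=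
  ¬ x / Q ^ (e : ℕ) % Q * den e < a e * Q

instance (a den : Fin m → ℕ) (Q x : ℕ) : DecidablePred (Surv a den Q x) :=
  fun _ => inferInstanceAs (Decidable (¬ _))

/-- Whether the network gets disconnected in a simulation with the random number `x`. -/
def mcVal (ends : Fin m → Fin n × Fin n) (a den : Fin m → ℕ) (Q x : ℕ) : ℕ :=
  if Nonconst (mergeAll ends (Surv a den Q x) id) then 1 else 0

/-- The failure probabilities, rounded up to multiples of `1 / Q`. -/
noncomputable def prbUp (a den : Fin m → ℕ) (Q : ℕ) (e : Fin m) : ℝ :=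
  (⌈(a e * Q : ℝ) / den e⌉₊ : ℝ) / Q

theorem failRec_map_succ {V μ : Type} [Fintype V] [DecidableEq μ]
    (ends : Fin (m + 1) → V × V) (p : Fin (m + 1) → ℝ) (L : List (Fin m)) (l : V → μ) :
    failRec ends p (L.map Fin.succ) l =
      failRec (fun e => ends e.succ) (fun e => p e.succ) L l := by
  induction L generalizing l with
  | nil => rfl
  | cons e L ih =>
    rw [List.map_cons, failRec, failRec, ih, ih]
    rfl

/-- The integer comparison succeeds for exactly `⌈a Q / d⌉` digits, so a simulated edge fails with
probability exactly `prbUp`. -/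
theorem card_digit_lt {a d Q : ℕ} (hd : 0 < d) (ha : a ≤ d) :
    (Finset.range Q).filter (fun y => y * d < a * Q) = Finset.range ⌈(a * Q : ℝ) / d⌉₊ := by
  have hd' : (0 : ℝ) < d := by positivity
  ext y
  rw [Finset.mem_filter, Finset.mem_range, Finset.mem_range, Nat.lt_ceil, lt_div_iff₀ hd']
  constructor
  · rintro ⟨-, h⟩
    exact_mod_cast h
  · intro h
    have h : y * d < a * Q := by exact_mod_cast h
    refine ⟨?_, h⟩
    by_contra hQ
    have h1 := Nat.mul_le_mul (not_lt.1 hQ) ha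
    rw [mul_comm Q a] at h1
    omega

theorem avg_digit_lt {a d Q : ℕ} (hd : 0 < d) (ha : a ≤ d) (hQ : 0 < Q) (u v : ℝ) :
    avg Q (fun y => if y * d < a * Q then u else v) =
      (⌈(a * Q : ℝ) / d⌉₊ : ℝ) / Q * u + (1 - (⌈(a * Q : ℝ) / d⌉₊ : ℝ) / Q) * v := by
  have h1 : ∀ y, (if y * d < a * Q then u else v) =
      v + (u - v) * (if y * d < a * Q then 1 else 0) := fun y => by split_ifs <;> ring
  simp only [h1, avg_add, avg_mul_left, avg_const hQ]
  rw [avg, ← Finset.sum_filter, card_digit_lt hd ha]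
  simp
  ring

/-- Edge `e` reads the digit `e`, so splitting off the lowest digit reproduces the recursion of
`failRec`. The simulation is exact for the rounded probabilities; the factor `M` stands for unused
digits. -/
theorem avg_mergeAll {ends : Fin m → Fin n × Fin n} {a den : Fin m → ℕ} {Q M : ℕ}
    (hden : ∀ e, 0 < den e) (ha : ∀ e, a e ≤ den e) (hQ : 0 < Q) (hM : 0 < M)
    (l : Fin n → Fin n) :
    avg (Q ^ m * M) (fun x => if Nonconst (mergeAll ends (Surv a den Q x) l) then 1 else 0) =
      failRec ends (prbUp a den Q) (List.finRange m) l := by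
  induction m generalizing l with
  | zero =>
    rw [pow_zero, one_mul, List.finRange_zero, failRec]
    have : ∀ x, mergeAll ends (Surv a den Q x) l = l := fun x => by simp [mergeAll]
    simp only [this]
    exact avg_const hM _
  | succ m ih =>
    rw [List.finRange_succ, failRec, failRec_map_succ, failRec_map_succ, pow_succ', mul_assoc]
    have hs : ∀ x (e : Fin m), Surv a den Q x e.succ ↔
        Surv (fun e => a e.succ) (fun e => den e.succ) Q (x / Q) e := fun x e => by
      rw [Surv, Surv, Nat.div_div_eq_div_mul, ← pow_succ', Fin.val_succ]
    have h1 : ∀ x, (if Nonconst (mergeAll ends (Surv a den Q x) l) then (1 : ℝ) else 0) =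
        if x % Q * den 0 < a 0 * Q then
          if Nonconst (mergeAll (fun e => ends e.succ)
            (Surv (fun e => a e.succ) (fun e => den e.succ) Q (x / Q)) l) then (1 : ℝ) else 0
        else if Nonconst (mergeAll (fun e => ends e.succ)
            (Surv (fun e => a e.succ) (fun e => den e.succ) Q (x / Q)) (merge ends l 0))
            then (1 : ℝ) else 0 := fun x => by
      rw [mergeAll_succ, mergeAll_congr (hs x)]
      have h0 : Surv a den Q x 0 ↔ ¬ x % Q * den 0 < a 0 * Q := by simp [Surv]
      by_cases h : x % Q * den 0 < a 0 * Q
      · simp only [h0, h, not_true, if_false, if_true]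
      · simp only [h0, h, not_false_iff, if_false, if_true]
    simp only [h1]
    rw [avg_digit Q (Q ^ m * M) fun y x => if y * den 0 < a 0 * Q then
          if Nonconst (mergeAll (fun e => ends e.succ)
            (Surv (fun e => a e.succ) (fun e => den e.succ) Q x) l) then (1 : ℝ) else 0
        else if Nonconst (mergeAll (fun e => ends e.succ)
            (Surv (fun e => a e.succ) (fun e => den e.succ) Q x) (merge ends l 0))
            then (1 : ℝ) else 0]
    have h2 : ∀ y, (avg (Q ^ m * M) fun x => if y * den 0 < a 0 * Q then
          if Nonconst (mergeAll (fun e => ends e.succ)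
            (Surv (fun e => a e.succ) (fun e => den e.succ) Q x) l) then (1 : ℝ) else 0
        else if Nonconst (mergeAll (fun e => ends e.succ)
            (Surv (fun e => a e.succ) (fun e => den e.succ) Q x) (merge ends l 0))
            then (1 : ℝ) else 0) = if y * den 0 < a 0 * Q then
          failRec (fun e => ends e.succ) (fun e => prbUp a den Q e.succ) (List.finRange m) l
        else failRec (fun e => ends e.succ) (fun e => prbUp a den Q e.succ) (List.finRange m)
          (merge ends l 0) := fun y => by
      split_ifs
      · exact ih (fun e => hden _) (fun e => ha _) l
      · exact ih (fun e => hden _) (fun e => ha _) (merge ends l 0)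
    simp only [h2]
    exact avg_digit_lt (hden 0) (ha 0) hQ _ _

variable {a den : Fin m → ℕ} {Q : ℕ}

theorem prbUp_bounds (hden : ∀ e, 0 < den e) (ha : ∀ e, a e ≤ den e) (hQ : 0 < Q) (e : Fin m) :
    prb a den e ≤ prbUp a den Q e ∧ prbUp a den Q e ≤ prb a den e + 1 / Q ∧
      prbUp a den Q e ≤ 1 := by
  have hQ' : (0 : ℝ) < Q := by positivity
  have hd' : (0 : ℝ) < den e := by exact_mod_cast hden e
  have h1 := Nat.le_ceil ((a e * Q : ℝ) / den e)
  have h2 := Nat.ceil_lt_add_one (a := (a e * Q : ℝ) / den e) (by positivity)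
  have h3 : (a e * Q : ℝ) / den e = prb a den e * Q := by rw [prb]; ring
  rw [prbUp]
  refine ⟨?_, ?_, ?_⟩
  · rw [le_div_iff₀ hQ', ← h3]
    exact h1
  · rw [div_le_iff₀ hQ', add_mul, one_div_mul_cancel hQ'.ne', ← h3]
    exact h2.le
  · rw [div_le_one hQ']
    have : ⌈(a e * Q : ℝ) / den e⌉₊ ≤ Q := Nat.ceil_le.2 (by
      rw [div_le_iff₀ hd', mul_comm]
      exact mul_le_mul_of_nonneg_left (by exact_mod_cast ha e) hQ'.le)
    exact_mod_cast this

end simulation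


/-! ### The bottleneck probability and the weights -/

section weights

variable {n m : ℕ} (ends : Fin m → Fin n × Fin n) (a den : Fin m → ℕ)

/-- The edge `e` is at most as likely to fail as the edge `e'`. -/
def LeP (e e' : Fin m) : Prop := a e * den e' ≤ a e' * den e

instance (e e' : Fin m) : Decidable (LeP a den e e') := inferInstanceAs (Decidable (_ ≤ _))

/-- The edges that are at most as likely to fail as `e` connect the network. -/
def Conn (e : Fin m) : Prop := ¬ Nonconst (mergeAll ends (fun e' => LeP a den e' e) id)

instance (e : Fin m) : Decidable (Conn ends a den e) := inferInstanceAs (Decidable (¬ _))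

/-- The edge `e` has the smallest failure probability among those with `Conn`. -/
def Bottleneck (e : Fin m) : Prop :=
  Conn ends a den e ∧ ∀ e', Conn ends a den e' → LeP a den e e'

instance (e : Fin m) : Decidable (Bottleneck ends a den e) := inferInstanceAs (Decidable (_ ∧ _))

/-- The numerator of the bottleneck probability. -/
def qNum : ℕ := ∑ e, if Bottleneck ends a den e then a e else 0

/-- The denominator of the bottleneck probability. -/
def qDen : ℕ := ∑ e, if Bottleneck ends a den e then den e else 0

variable {ends a den}

theorem leP_iff (hden : ∀ e, 0 < den e) {e e' : Fin m} :
    LeP a den e e' ↔ prb a den e ≤ prb a den e' := by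
  have h1 : (0 : ℝ) < den e := by exact_mod_cast hden e
  have h2 : (0 : ℝ) < den e' := by exact_mod_cast hden e'
  rw [LeP, prb, prb, div_le_div_iff₀ h1 h2]
  exact_mod_cast Iff.rfl

theorem conn_iff (hden : ∀ e, 0 < den e) {e : Fin m} : Conn ends a den e ↔
    ∀ χ : Fin n → Fin 2, Nonconst χ → ∃ e', Cross ends χ e' ∧ prb a den e' ≤ prb a den e := by
  rw [Conn, nonconst_mergeAll]
  push Not
  simp only [leP_iff hden, and_comm]

theorem exists_bottleneck (hden : ∀ e, 0 < den e) {e : Fin m} (he : Conn ends a den e) :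
    ∃ e, Bottleneck ends a den e := by
  obtain ⟨e₀, h0, h1⟩ := Finset.exists_min_image
    (Finset.univ.filter fun e => Conn ends a den e) (prb a den) ⟨e, by simpa⟩
  simp only [Finset.mem_filter, Finset.mem_univ, true_and] at h0 h1
  exact ⟨e₀, h0, fun e' he' => (leP_iff hden).2 (h1 e' he')⟩

/-- Several edges may tie for the bottleneck. Adding numerators and denominators of equal fractions
does not change their value, so no choice among them is needed. -/
theorem q_eq (hden : ∀ e, 0 < den e) {e : Fin m} (he : Bottleneck ends a den e) :
    0 < qDen ends a den ∧ (qNum ends a den : ℝ) / qDen ends a den = prb a den e := by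
  have h0 : 0 < qDen ends a den := by
    have := Finset.single_le_sum (f := fun e => if Bottleneck ends a den e then den e else 0)
      (fun _ _ => Nat.zero_le _) (Finset.mem_univ e)
    simp only [he, if_true] at this
    exact (hden e).trans_le this
  refine ⟨h0, ?_⟩
  have h1 : (0 : ℝ) < den e := by exact_mod_cast hden e
  have h2 : (0 : ℝ) < qDen ends a den := by exact_mod_cast h0
  rw [prb, div_eq_div_iff h2.ne' h1.ne']
  have : qNum ends a den * den e = a e * qDen ends a den := by
    rw [qNum, qDen, Finset.sum_mul, Finset.mul_sum]
    refine Finset.sum_congr rfl fun e' _ => ?_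
    split_ifs with h
    · exact le_antisymm (h.2 e he.1) (he.2 e' h.1)
    · simp
  exact_mod_cast this

theorem qNum_eq_zero (h : ¬ ∃ e, Bottleneck ends a den e) : qNum ends a den = 0 :=
  Finset.sum_eq_zero fun e _ => if_neg fun h' => h ⟨e, h'⟩

/-- If the edges that are less likely to fail than `q` do not connect the network, then there is
a cut all of whose edges fail with probability at least `q`. -/
theorem exists_cut_of_forall_conn (hden : ∀ e, 0 < den e) {q : ℝ}
    (hn : ∃ χ : Fin n → Fin 2, Nonconst χ) (h : ∀ e, Conn ends a den e → q ≤ prb a den e) :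
    ∃ χ : Fin n → Fin 2, Nonconst χ ∧ ∀ e, Cross ends χ e → q ≤ prb a den e := by
  by_contra! hno
  obtain ⟨χ, hχ⟩ := hn
  obtain ⟨e₁, -, he₁⟩ := hno χ hχ
  -- If every cut had an edge less likely to fail than `q`, then the most likely to fail among all
  -- such edges would satisfy `Conn`, against `h`.
  obtain ⟨e₀, h0, h1⟩ := Finset.exists_max_image
    (Finset.univ.filter fun e => prb a den e < q) (prb a den) ⟨e₁, by simpa⟩
  simp only [Finset.mem_filter, Finset.mem_univ, true_and] at h0 h1
  refine (h e₀ ((conn_iff hden).2 fun ψ hψ => ?_)).not_gt h0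
  obtain ⟨e, he, hq⟩ := hno ψ hψ
  exact ⟨e, he, h1 e hq⟩

/-- For a downward closed `P` the count is the end of an initial segment. In this way a rounded
logarithm is computed by counting inequalities between integers. -/
theorem lt_sum_iff {P : ℕ → Prop} [DecidablePred P] (hP : ∀ i j, i ≤ j → P j → P i) (c i : ℕ) :
    i < ∑ j ∈ Finset.range c, (if P j then 1 else 0) ↔ i < c ∧ P i := by
  induction c with
  | zero => simp
  | succ c ih =>
    rw [Finset.sum_range_succ]
    by_cases h : P c
    · have h1 : ∑ j ∈ Finset.range c, (if P j then 1 else 0) = c := by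
        rw [Finset.sum_congr rfl fun j hj => if_pos (hP j c (Finset.mem_range.1 hj).le h)]
        simp
      rw [h1, if_pos h]
      exact ⟨fun hi => ⟨hi, hP i c (by omega) h⟩, fun hi => hi.1⟩
    · rw [if_neg h, add_zero, ih]
      refine ⟨fun hi => ⟨by omega, hi.2⟩, fun hi => ⟨?_, hi.2⟩⟩
      rcases Nat.lt_succ_iff_lt_or_eq.1 hi.1 with h' | h'
      · exact h'
      · exact (h (h' ▸ hi.2)).elim

variable (ends a den)

/-- The scale of the weights. -/
def scl (m : ℕ) : ℕ := 6 * (m + 1)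

/-- The largest possible weight. -/
def wtCap (m : ℕ) : ℕ := scl m * (m + 1)

/-- The weight of an edge: the rounded logarithm of its failure probability with respect to the
bottleneck probability. -/
def lwt (e : Fin m) : ℕ :=
  ∑ j ∈ Finset.range (wtCap m), if a e ^ scl m * qDen ends a den ^ (j + 1) ≤
    qNum ends a den ^ (j + 1) * den e ^ scl m then 1 else 0

variable {ends a den}

theorem lt_lwt_iff (hden : ∀ e, 0 < den e) (h0 : 0 < qNum ends a den)
    (h1 : qNum ends a den < qDen ends a den) (e : Fin m) (i : ℕ) :
    i < lwt ends a den e ↔ i < wtCap m ∧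
      prb a den e ^ scl m ≤ ((qNum ends a den : ℝ) / qDen ends a den) ^ (i + 1) := by
  have hd : (0 : ℝ) < den e := by exact_mod_cast hden e
  have hn : (0 : ℝ) < qNum ends a den := by exact_mod_cast h0
  have hq : (0 : ℝ) < qDen ends a den := by exact_mod_cast h0.trans h1
  have hq1 : (qNum ends a den : ℝ) / qDen ends a den ≤ 1 :=
    (div_le_one hq).2 (by exact_mod_cast h1.le)
  have key : ∀ j, a e ^ scl m * qDen ends a den ^ (j + 1) ≤
      qNum ends a den ^ (j + 1) * den e ^ scl m ↔
      prb a den e ^ scl m ≤ ((qNum ends a den : ℝ) / qDen ends a den) ^ (j + 1) := fun j => by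
    rw [prb, div_pow, div_pow, div_le_div_iff₀ (by positivity) (by positivity)]
    exact_mod_cast Iff.rfl
  rw [lwt, lt_sum_iff (fun i j hij hj => ?_), key]
  rw [key] at hj ⊢
  exact hj.trans (pow_le_pow_of_le_one (by positivity) hq1 (by omega))

/-- By `lt_lwt_iff` the weight is `⌊D log_q p_e⌋` cut off at the cap, which yields the inequalities
for single edges. The two statements on cuts express that `q` is the bottleneck: `Conn` gives an
edge at most `q` in every cut, minimality a cut with all edges at least `q`. -/
theorem isScale (hden : ∀ e, 0 < den e) (ha : ∀ e, a e ≤ den e)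
    (hn : ∃ χ : Fin n → Fin 2, Nonconst χ) (h0 : 0 < qNum ends a den)
    (h1 : qNum ends a den < qDen ends a den) :
    IsScale ends (prb a den) ((qNum ends a den : ℝ) / qDen ends a den) (scl m) (wtCap m)
      (lwt ends a den) := by
  have hnum : (0 : ℝ) < qNum ends a den := by exact_mod_cast h0
  have hq : (0 : ℝ) < qDen ends a den := by exact_mod_cast h0.trans h1
  have hlt : (qNum ends a den : ℝ) / qDen ends a den < 1 := (div_lt_one hq).2 (by exact_mod_cast h1)
  have hiff := lt_lwt_iff hden h0 h1
  obtain ⟨e₀, he₀⟩ : ∃ e, Bottleneck ends a den e := by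
    by_contra h
    rw [qNum_eq_zero h] at h0
    exact h0.false
  have hqe := (q_eq hden he₀).2
  set q : ℝ := (qNum ends a den : ℝ) / qDen ends a den
  have hq0 : 0 < q := div_pos hnum hq
  have hp1 : ∀ e, prb a den e ≤ 1 := fun e =>
    div_le_one_of_le₀ (by exact_mod_cast ha e) (Nat.cast_nonneg _)
  have hp0 : ∀ e, 0 ≤ prb a den e := fun e => by unfold prb; positivity
  have hD : 0 < scl m := by unfold scl; omega
  have hDcap : scl m ≤ wtCap m := Nat.le_mul_of_pos_right _ (by omega)
  have hpow : ∀ e, prb a den e ^ scl m ≤ q ^ lwt ends a den e := fun e => by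
    rcases Nat.eq_zero_or_pos (lwt ends a den e) with h | h
    · rw [h, pow_zero]
      exact pow_le_one₀ (hp0 e) (hp1 e)
    · have := ((hiff e (lwt ends a den e - 1)).1 (by omega)).2
      rwa [Nat.sub_add_cancel h] at this
  refine ⟨hp0, hp1, hq0, hlt, ?_, hD, ?_, hpow, fun e he => ?_, fun e he => ?_, fun e he => ?_, ?_,
    ?_⟩
  · simp [scl]
  · rw [Fintype.card_fin]
    exact Nat.mul_lt_mul_of_pos_left (Nat.lt_succ_self m) hD
  · have := mt (hiff e (lwt ends a den e)).2 (lt_irrefl _)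
    push Not at this
    exact (this he).le
  · have := (hiff e (scl m - 1)).2 ⟨by omega, by
      rw [Nat.sub_add_cancel hD]
      exact pow_le_pow_left₀ (hp0 e) he _⟩
    omega
  · by_contra h
    have h2 : q ^ lwt ends a den e ≤ q ^ (scl m + 1) :=
      pow_le_pow_of_le_one hq0.le hlt.le (by omega)
    have h3 : q ^ (scl m + 1) < q ^ scl m := pow_lt_pow_right_of_lt_one₀ hq0 hlt (Nat.lt_succ_self _)
    have h4 : q ^ scl m ≤ prb a den e ^ scl m := pow_le_pow_left₀ hq0.le he _
    have := hpow e
    linarith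
  · rw [hqe]
    exact (conn_iff hden).1 he₀.1
  · refine exists_cut_of_forall_conn hden hn fun e he => ?_
    rw [hqe]
    exact (leP_iff hden).1 (he₀.2 e he)

theorem failR_nonneg (ha : ∀ e, a e ≤ den e) :
    0 ≤ failR ends (prb a den) := by
  have := failRec_nonneg (ends := ends) (p := prb a den) (fun e => by unfold prb; positivity)
    (fun e => div_le_one_of_le₀ (by exact_mod_cast ha e) (Nat.cast_nonneg _))
    (List.finRange m) (id : Fin n → Fin n)
  rwa [failRec_eq _ _ (List.nodup_finRange m), List.toFinset_finRange] at this

theorem lwt_le (e : Fin m) : lwt ends a den e ≤ wtCap m := by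
  unfold lwt
  refine (Finset.sum_le_card_nsmul _ _ 1 fun j _ => ?_).trans (by simp)
  split_ifs <;> simp

/-- If the bottleneck probability is degenerate, then so is the failure probability. -/
theorem one_le_failR (hden : ∀ e, 0 < den e) (ha : ∀ e, a e ≤ den e)
    (hF : failR ends (prb a den) ≠ 0)
    (hq : ¬ (0 < qNum ends a den ∧ qNum ends a den < qDen ends a den)) :
    1 ≤ failR ends (prb a den) := by
  have hp0 : ∀ e, 0 ≤ prb a den e := fun e => by unfold prb; positivity
  have hp1 : ∀ e, prb a den e ≤ 1 := fun e =>
    div_le_one_of_le₀ (by exact_mod_cast ha e) (Nat.cast_nonneg _)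
  have hF0 : 0 < failR ends (prb a den) := lt_of_le_of_ne (failR_nonneg ha) (Ne.symm hF)
  have h1 := failR_le (ends := ends) hp0 hp1
  obtain ⟨χ, hχ, hcp⟩ : ∃ χ : Fin n → Fin 2, Nonconst χ ∧ 0 < cp ends (prb a den) χ := by
    by_contra! hno
    have := Finset.sum_nonpos (s := Finset.univ.filter fun χ : Fin n → Fin 2 => Nonconst χ)
      fun χ hχ => hno χ (Finset.mem_filter.1 hχ).2
    linarith
  -- A cut with positive `cp` excludes bottleneck probability `0`, so a degenerate bottleneck is at
  -- least `1`. If no edge satisfies `Conn`, the claim is vacuous, and the cut found below has no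
  -- edges.
  have hone : ∀ e, Conn ends a den e → 1 ≤ prb a den e := fun e he => by
    obtain ⟨e₀, he₀⟩ := exists_bottleneck hden he
    obtain ⟨h2, h3⟩ := q_eq hden he₀
    have h2' : (0 : ℝ) < qDen ends a den := by exact_mod_cast h2
    have h0 : 0 < qNum ends a den := by
      by_contra h0
      rw [Nat.eq_zero_of_not_pos h0, Nat.cast_zero, zero_div] at h3
      obtain ⟨e', he', hle⟩ := (conn_iff hden).1 he₀.1 χ hχ
      refine hcp.ne' (Finset.prod_eq_zero (Finset.mem_univ e') ?_)
      rw [if_pos he']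
      exact le_antisymm (hle.trans h3.ge) (hp0 e')
    have h4 : (qDen ends a den : ℝ) ≤ qNum ends a den := by
      exact_mod_cast not_lt.1 fun h => hq ⟨h0, h⟩
    refine le_trans ?_ ((leP_iff hden).1 (he₀.2 e he))
    rw [← h3, one_le_div h2']
    exact h4
  obtain ⟨ψ, hψ, hψ1⟩ := exists_cut_of_forall_conn hden ⟨χ, hχ⟩ hone
  refine le_trans ?_ (cp_le_failR hp0 hp1 hψ)
  refine le_of_eq (Finset.prod_eq_one fun e _ => ?_).symm
  split_ifs with he
  exacts [le_antisymm (hp1 e) (hψ1 e he), rfl]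

end weights


/-! ### The approximation algorithm as a function of its random bits -/

section scheme

/-- Numerator of the sum of the fractions `u y / v y` over the first `N` digits `y` of `x` in
base `R`. -/
def sumNum (u v : ℕ → ℕ) (R N x : ℕ) : ℕ :=
  ∑ j : Fin N, u (x / R ^ (j : ℕ) % R) *
    ((∏ j : Fin N, v (x / R ^ (j : ℕ) % R)) / v (x / R ^ (j : ℕ) % R))

/-- Denominator of the sum of the fractions `u y / v y` over the first `N` digits `y` of `x` in
base `R`. -/
def sumDen (v : ℕ → ℕ) (R N x : ℕ) : ℕ := ∏ j : Fin N, v (x / R ^ (j : ℕ) % R)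

theorem sumNum_div_sumDen {u v : ℕ → ℕ} (hv : ∀ y, 0 < v y) (R N x : ℕ) :
    (sumNum u v R N x : ℝ) / sumDen v R N x =
      ∑ j ∈ Finset.range N, (u (x / R ^ j % R) : ℝ) / v (x / R ^ j % R) := by
  rw [Finset.sum_range, sumNum, sumDen, Nat.cast_sum, Finset.sum_div]
  refine Finset.sum_congr rfl fun j _ => ?_
  have h0 : (v (x / R ^ (j : ℕ) % R) : ℝ) ≠ 0 := by exact_mod_cast (hv _).ne'
  have h1 : ((∏ j : Fin N, v (x / R ^ (j : ℕ) % R) : ℕ) : ℝ) ≠ 0 := by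
    exact_mod_cast (Finset.prod_pos fun j _ => hv _).ne'
  rw [Nat.cast_mul, Nat.cast_div (Finset.dvd_prod_of_mem _ (Finset.mem_univ j)) h0]
  field_simp

/-- The smallness threshold for the use of the contraction estimator. -/
def thr (n k : ℕ) : ℕ := (4096 * n ^ 4 * k) ^ 5

/-- The number of bits of each random digit. -/
def digitBits (n m k : ℕ) : ℕ := 128 * k * n ^ 4 * thr n k * (m + 1) * (wtCap m + 1) + n

/-- The number of samples. -/
def samples (n k : ℕ) : ℕ := 2 ^ 14 * k ^ 2 * n ^ 3 * thr n k

/-- The base of the random digits. -/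
def base (n m k : ℕ) : ℕ := 2 ^ digitBits n m k

/-- The size of the space of random numbers for one sample. -/
def radix (n m k : ℕ) : ℕ := base n m k ^ (n + m)

variable {n m : ℕ} (ends : Fin m → Fin n × Fin n) (a den : Fin m → ℕ) (k : ℕ)

/-- Numerator of the sum of the samples of the contraction estimator. -/
noncomputable def zSumNum (x : ℕ) : ℕ :=
  sumNum (zNum ends (lwt ends a den) a (base n m k)) (zDen ends (lwt ends a den) den (base n m k))
    (radix n m k) (samples n k) x

/-- Denominator of the sum of the samples of the contraction estimator. -/
noncomputable def zSumDen (x : ℕ) : ℕ :=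
  sumDen (zDen ends (lwt ends a den) den (base n m k)) (radix n m k) (samples n k) x

/-- The number of simulations in which the network gets disconnected. -/
def mcSum (x : ℕ) : ℕ :=
  ∑ j : Fin (samples n k), mcVal ends a den (base n m k) (x / radix n m k ^ (j : ℕ) % radix n m k)

/-- The contraction estimator is to be used. -/
def UseZ (x : ℕ) : Prop :=
  0 < qNum ends a den ∧ qNum ends a den < qDen ends a den ∧
    4 * thr n k * zSumNum ends a den k x < samples n k * zSumDen ends a den k x

noncomputable instance (x : ℕ) : Decidable (UseZ ends a den k x) :=
  inferInstanceAs (Decidable (_ ∧ _))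

/-- Numerator of the result. -/
noncomputable def estNum (x : ℕ) : ℕ :=
  if UseZ ends a den k x then zSumNum ends a den k x else mcSum ends a den k x

/-- Denominator of the result. -/
noncomputable def estDen (x : ℕ) : ℕ :=
  if UseZ ends a den k x then samples n k * zSumDen ends a den k x else samples n k

/-- The result. -/
noncomputable def est (x : ℕ) : ℝ := estNum ends a den k x / estDen ends a den k x

variable {ends a den k}

theorem base_pos : 0 < base n m k := by unfold base; positivity

theorem radix_pos : 0 < radix n m k := Nat.pow_pos base_pos

theorem thr_pos (hn : 0 < n) (hk : 0 < k) : 0 < thr n k := by unfold thr; positivity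

theorem samples_pos (hn : 0 < n) (hk : 0 < k) : 0 < samples n k := by
  have := thr_pos hn hk
  unfold samples
  positivity

theorem estDen_pos (hn : 0 < n) (hk : 0 < k) (hden : ∀ e, 0 < den e) (x : ℕ) :
    0 < estDen ends a den k x := by
  unfold estDen
  split_ifs
  · refine Nat.mul_pos (samples_pos hn hk) ?_
    unfold zSumDen sumDen
    exact Finset.prod_pos fun _ _ => zDen_pos hden _
  · exact samples_pos hn hk

theorem est_eq (hden : ∀ e, 0 < den e) (x : ℕ) : est ends a den k x =
    if UseZ ends a den k x then (∑ j ∈ Finset.range (samples n k),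
      zVal ends (lwt ends a den) a den (base n m k) (x / radix n m k ^ j % radix n m k)) /
        samples n k
    else (∑ j ∈ Finset.range (samples n k),
      (mcVal ends a den (base n m k) (x / radix n m k ^ j % radix n m k) : ℝ)) / samples n k := by
  unfold est estNum estDen
  split_ifs with h
  · have := sumNum_div_sumDen (u := zNum ends (lwt ends a den) a (base n m k))
      (v := zDen ends (lwt ends a den) den (base n m k)) (fun y => zDen_pos hden y) (radix n m k)
      (samples n k) x
    simp only [zVal, ← this, zSumNum, zSumDen]
    push_cast
    rw [div_div, mul_comm]
  · rw [Finset.sum_range, mcSum, Nat.cast_sum]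

theorem avg_mcVal (hden : ∀ e, 0 < den e) (ha : ∀ e, a e ≤ den e) :
    avg (radix n m k) (fun x => (mcVal ends a den (base n m k) x : ℝ)) =
      failRec ends (prbUp a den (base n m k)) (List.finRange m) id := by
  rw [radix, add_comm, pow_add, ← avg_mergeAll hden ha base_pos (Nat.pow_pos base_pos)]
  refine avg_congr fun x _ => ?_
  unfold mcVal
  split_ifs <;> simp

theorem failR_eq_failRec (p : Fin m → ℝ) :
    failR ends p = failRec ends p (List.finRange m) (id : Fin n → Fin n) := by
  rw [failRec_eq _ _ (List.nodup_finRange m), List.toFinset_finRange]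
  rfl

/-- The number of bits per digit is chosen so large that `x < 2 ^ x` alone bounds the base from
below; the inverse of the base then bounds all discretization errors. -/
theorem le_base : 128 * k * n ^ 4 * thr n k * (m + 1) * (wtCap m + 1) ≤ base n m k :=
  (Nat.le_add_right _ n).trans Nat.lt_two_pow_self.le

theorem abs_failRec_sub_le (hn : 0 < n) (hk : 0 < k) (hden : ∀ e, 0 < den e)
    (ha : ∀ e, a e ≤ den e) :
    |failRec ends (prbUp a den (base n m k)) (List.finRange m) (id : Fin n → Fin n) -
      failR ends (prb a den)| * (128 * k * n ^ 3 * thr n k) ≤ 1 := by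
  have hb := prbUp_bounds hden ha (base_pos (n := n) (m := m) (k := k))
  have hp0 : ∀ e, 0 ≤ prb a den e := fun e => by unfold prb; positivity
  have hp1 : ∀ e, prb a den e ≤ 1 := fun e => (hb e).1.trans (hb e).2.2
  have hQ : (0 : ℝ) < base n m k := by exact_mod_cast base_pos
  have h1 := failRec_sub_le (ends := ends) hp0 hp1 (fun e => (hp0 e).trans (hb e).1)
    (fun e => (hb e).2.2) (δ := 1 / base n m k) (fun e => by
      rw [abs_of_nonneg (sub_nonneg.2 (hb e).1)]
      linarith [(hb e).2.1]) (List.finRange m) (id : Fin n → Fin n)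
  rw [← failR_eq_failRec (prb a den), List.length_finRange] at h1
  have h2 : m * (128 * k * n ^ 3 * thr n k) ≤ base n m k := by
    refine le_trans ?_ le_base
    have h3 : n ^ 3 ≤ n ^ 4 := Nat.pow_le_pow_right hn (by norm_num)
    calc m * (128 * k * n ^ 3 * thr n k) = 128 * k * n ^ 3 * thr n k * m * 1 := by ring
      _ ≤ 128 * k * n ^ 4 * thr n k * (m + 1) * (wtCap m + 1) := by gcongr <;> omega
  have h2' : (m : ℝ) * (128 * k * n ^ 3 * thr n k) ≤ base n m k := by exact_mod_cast h2
  refine (mul_le_mul_of_nonneg_right h1 (by positivity)).trans ?_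
  rw [mul_one_div, div_mul_eq_mul_div, div_le_one hQ]
  exact h2'

/-- The event that the simulation gives an inaccurate result is rare unless the failure probability
is very small. -/
theorem card_mc_le (hn : 0 < n) (hk : 0 < k) (hden : ∀ e, 0 < den e) (ha : ∀ e, a e ≤ den e)
    (hF : 1 ≤ failR ends (prb a den) * (16 * n ^ 3 * thr n k)) :
    (((Finset.range (radix n m k ^ samples n k)).filter fun x =>
      ¬ |(∑ j ∈ Finset.range (samples n k),
        (mcVal ends a den (base n m k) (x / radix n m k ^ j % radix n m k) : ℝ)) / samples n k -
          failR ends (prb a den)| ≤ 1 / k * failR ends (prb a den)).card : ℝ) * 8 ≤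
      (radix n m k : ℝ) ^ samples n k := by
  have hT : (0 : ℝ) < thr n k := by exact_mod_cast thr_pos hn hk
  have hN : (0 : ℝ) < samples n k := by exact_mod_cast samples_pos hn hk
  have hn' : (0 : ℝ) < n := by exact_mod_cast hn
  have hk' : (1 : ℝ) ≤ k := by exact_mod_cast hk
  set F := failR ends (prb a den) with hFdef
  set F' := failRec ends (prbUp a den (base n m k)) (List.finRange m) (id : Fin n → Fin n) with hF'
  have hX : (0 : ℝ) < n ^ 3 * thr n k := by positivity
  set X : ℝ := n ^ 3 * thr n k with hXdef
  have hFX : 1 ≤ 16 * (F * X) := by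
    have : F * (16 * n ^ 3 * thr n k) = 16 * (F * X) := by rw [hXdef]; ring
    linarith
  have hF0 : 0 < F := by
    by_contra h
    have := mul_nonpos_of_nonpos_of_nonneg (not_lt.1 h) hX.le
    linarith
  -- The rounding error is at most `1 / (128 k X)`, and `F` is at least `1 / (16 X)`.
  have hd : |F' - F| * (8 * k) ≤ F := by
    have h1 := abs_failRec_sub_le (ends := ends) hn hk hden ha
    have h2 : |F' - F| * (128 * k * n ^ 3 * thr n k) = 16 * X * (|F' - F| * (8 * k)) := by
      rw [hXdef]; ring
    rw [h2] at h1
    by_contra hlt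
    have := mul_lt_mul_of_pos_left (not_le.1 hlt) (by positivity : 0 < 16 * X)
    nlinarith
  have hd' : |F' - F| ≤ F / 8 := by
    have : |F' - F| * 8 ≤ |F' - F| * (8 * k) :=
      mul_le_mul_of_nonneg_left (by linarith) (abs_nonneg _)
    linarith
  have hF'1 : F / 2 ≤ F' := by
    have := neg_abs_le (F' - F)
    linarith
  have hF'2 : F' ≤ 2 * F := by
    have := le_abs_self (F' - F)
    linarith
  -- `2 ^ 14 k ^ 2 / (8 k) ^ 2 = 2 ^ 8`. Chebyshev's inequality needs `8 ≤ 2 ^ 8 X F'`, which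
  -- follows from `F' ≥ F / 2` and `16 F X ≥ 1`.
  have hsX : (samples n k : ℝ) * (1 / (8 * k)) ^ 2 = 2 ^ 8 * X := by
    rw [hXdef, samples]
    push_cast
    field_simp
    norm_num
  refine le_trans ?_ (card_mean_le (R := radix n m k) (N := samples n k) radix_pos
    (Y := fun x => (mcVal ends a den (base n m k) x : ℝ)) (B := 1) (μ := F') (η := 1 / (8 * k))
    (fun _ _ => Nat.cast_nonneg _) (fun x _ => ?_) (avg_mcVal hden ha) (by linarith)
    (by positivity) ?_)
  · refine mul_le_mul_of_nonneg_right ?_ (by norm_num)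
    refine Nat.cast_le.2 (Finset.card_le_card ?_)
    intro x hx
    rw [Finset.mem_filter] at hx ⊢
    refine ⟨hx.1, fun h => hx.2 ?_⟩
    set S := ∑ j ∈ Finset.range (samples n k),
        (mcVal ends a den (base n m k) (x / radix n m k ^ j % radix n m k) : ℝ)
    have h1 : |S / samples n k - F'| ≤ 1 / (8 * k) * F' := by
      have : S / samples n k - F' = (S - samples n k * F') / samples n k := by field_simp
      rw [this, abs_div, abs_of_pos hN, div_le_iff₀ hN]
      linarith
    have h2 : |S / samples n k - F| ≤ |S / samples n k - F'| + |F' - F| := abs_sub_le _ _ _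
    have h3 : |F' - F| ≤ F * (1 / (8 * k)) := by
      rw [mul_one_div, le_div_iff₀ (by positivity)]
      exact hd
    have h4 : 1 / (8 * (k : ℝ)) * F' ≤ 1 / (8 * k) * (2 * F) :=
      mul_le_mul_of_nonneg_left hF'2 (by positivity)
    have h5 : 1 / (k : ℝ) * F = 8 * (1 / (8 * k) * F) := by field_simp
    have h6 : 0 ≤ 1 / (8 * (k : ℝ)) * F := by positivity
    rw [h5]
    linarith
  · unfold mcVal
    split_ifs <;> simp
  · rw [hsX]
    nlinarith

end scheme


/-! ### Accuracy of the result -/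

section correct

variable {n m : ℕ} {ends : Fin m → Fin n × Fin n} {a den : Fin m → ℕ} {k : ℕ}

/-- `(1 + δ) ^ d (1 - δ) ^ d ≤ 1`, combined with Bernoulli's inequality for `(1 - δ) ^ d`. -/
theorem one_add_pow_le {δ : ℝ} (h0 : 0 ≤ δ) (d : ℕ) (h : d * δ ≤ 1 / 2) :
    (1 + δ) ^ d ≤ 1 + 2 * (d * δ) := by
  rcases Nat.eq_zero_or_pos d with rfl | hd
  · simp
  have hd' : (1 : ℝ) ≤ d := by exact_mod_cast hd
  have hδ : δ ≤ 1 / 2 := by nlinarith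
  have h1 : 1 - d * δ ≤ (1 - δ) ^ d := by
    have := one_add_mul_le_pow (a := -δ) (by linarith) d
    calc _ = 1 + d * -δ := by ring
      _ ≤ _ := this
  have h2 : (1 + δ) ^ d * (1 - δ) ^ d ≤ 1 := by
    rw [← mul_pow]
    exact pow_le_one₀ (mul_nonneg (by linarith) (by linarith)) (by nlinarith)
  have h3 : (1 + δ) ^ d * (1 - d * δ) ≤ 1 :=
    (mul_le_mul_of_nonneg_left h1 (by positivity)).trans h2
  have h4 : 1 ≤ (1 + 2 * (d * δ)) * (1 - d * δ) := by
    have : 0 ≤ d * δ := by positivity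
    nlinarith
  exact le_of_mul_le_mul_right (h3.trans h4) (by linarith)

theorem wt_lwt_le (l : Fin n → Fin n) : wt ends (lwt ends a den) l ≤ m * wtCap m := by
  refine (Finset.sum_le_card_nsmul _ _ (wtCap m) fun e _ => ?_).trans (by simp)
  split_ifs
  exacts [lwt_le e, Nat.zero_le _]

/-- The expected value of the contraction estimator. -/
theorem avg_zVal_bounds (hn : 0 < n) (hk : 0 < k) (hden : ∀ e, 0 < den e) (ha : ∀ e, a e ≤ den e)
    (hex : ∃ χ : Fin n → Fin 2, Nonconst χ) (h0 : 0 < qNum ends a den)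
    (h1 : qNum ends a den < qDen ends a den) :
    ∃ (P μ : ℝ), avg (radix n m k) (zVal ends (lwt ends a den) a den (base n m k)) = μ ∧ 0 < P ∧
      7 / 16 * P ≤ μ ∧ (P * thr n k ≤ 1 →
        failR ends (prb a den) * (1 - 1 / (8 * k)) ^ 2 ≤ μ ∧
        μ ≤ failR ends (prb a den) * (1 + 1 / (8 * k)) ^ 2) := by
  have hsc := isScale hden ha hex h0 h1
  obtain ⟨χ, b, hχ, hc0, hmin, hP, hb0, hb1, hψ, hb7⟩ := exists_isScale_min hsc
  have happ := failR_approx hsc.p_nonneg hsc.p_le_one hχ hc0 hmin hP hb0 hb1 hψ hb7 hk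
  refine ⟨cp ends (prb a den) χ, _, rfl, hP, ?_⟩
  have hQ : (0 : ℝ) < base n m k := by exact_mod_cast base_pos
  have hk' : (1 : ℝ) ≤ k := by exact_mod_cast hk
  set δ : ℝ := (m * wtCap m : ℕ) / base n m k with hδdef
  have hδ0 : 0 ≤ δ := by positivity
  have hδ : ∀ l : Fin n → Fin n, (wt ends (lwt ends a den) l : ℝ) ≤ δ * base n m k := fun l => by
    rw [hδdef, div_mul_cancel₀ _ hQ.ne']
    exact_mod_cast wt_lwt_le l
  have hsmall : ((n - 3 : ℕ) : ℝ) * δ ≤ 1 / (16 * k) := by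
    have hT := thr_pos hn hk
    have h2 : (n - 3) * (m * wtCap m) * (16 * k) ≤ base n m k := by
      refine le_trans ?_ le_base
      have h3 : n - 3 ≤ n ^ 4 := (Nat.sub_le n 3).trans (Nat.le_self_pow (by norm_num) n)
      calc (n - 3) * (m * wtCap m) * (16 * k) = 16 * k * (n - 3) * 1 * m * wtCap m := by ring
        _ ≤ 128 * k * n ^ 4 * thr n k * (m + 1) * (wtCap m + 1) := by gcongr <;> omega
    rw [hδdef, ← mul_div_assoc, div_le_div_iff₀ hQ (by positivity), one_mul]
    exact_mod_cast h2
  have ht : 1 / (16 * (k : ℝ)) = 1 / (8 * k) / 2 := by field_simp; norm_num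
  rw [ht] at hsmall
  set t : ℝ := 1 / (8 * (k : ℝ)) with htdef
  have ht0 : 0 < t := by positivity
  have ht1 : t ≤ 1 / 8 := by
    rw [htdef, div_le_div_iff₀ (by positivity) (by norm_num)]
    linarith
  have hδ1 : δ ≤ 1 := by
    rw [hδdef, div_le_one hQ]
    have h2 : m * wtCap m ≤ base n m k := by
      refine le_trans ?_ le_base
      have : 1 ≤ 128 * k * n ^ 4 * thr n k := by
        have := thr_pos hn hk
        exact Nat.succ_le_of_lt (by positivity)
      calc m * wtCap m = 1 * m * wtCap m := by ring
        _ ≤ 128 * k * n ^ 4 * thr n k * (m + 1) * (wtCap m + 1) := by gcongr <;> omega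
    exact_mod_cast h2
  have hup : (1 + δ) ^ (n - 3) ≤ 1 + t := by
    have := one_add_pow_le hδ0 (n - 3) (by linarith)
    linarith
  have hlo : 1 - t ≤ (1 - δ) ^ (n - 3) := by
    have := one_add_mul_le_pow (a := -δ) (by linarith) (n - 3)
    have h3 : 1 + ((n - 3 : ℕ) : ℝ) * -δ = 1 - (n - 3 : ℕ) * δ := by ring
    have h4 : (1 + -δ) = 1 - δ := by ring
    rw [h3, h4] at this
    linarith
  -- Of the random number of one sample, `n - 3` digits select contractions and the remaining bits,
  -- at least `n` of them, color the blocks.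
  have hrad : radix n m k = base n m k ^ (n - 3) * 2 ^ (digitBits n m k * (n + m - (n - 3))) := by
    rw [radix, pow_mul, ← base, ← pow_add]
    congr 1
    omega
  have hbits : n ≤ digitBits n m k * (n + m - (n - 3)) := by
    have h2 : n ≤ digitBits n m k := Nat.le_add_left _ _
    exact h2.trans (Nat.le_mul_of_pos_right _ (by omega))
  have hU := avg_zVal_le (a := a) (den := den) hn hbits base_pos hδ
  have hL := le_avg_zVal (a := a) (den := den) hn hbits base_pos hδ hδ1 hc0 hmin
  rw [← hrad] at hU hL
  have hcp0 := fun φ : Fin n → Fin 2 => cp_nonneg (ends := ends) hsc.p_nonneg φ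
  set Zg := ∑ φ : Fin n → Fin 2 with Nonconst φ ∧
    2 * wt ends (lwt ends a den) φ < 3 * wt ends (lwt ends a den) χ, cp ends (prb a den) φ
  set Z := ∑ φ : Fin n → Fin 2 with Nonconst φ, cp ends (prb a den) φ
  -- The minimum cut itself belongs to the sum. This gives `μ ≥ (7 / 16) P` without any smallness
  -- assumption on `P`.
  have hZg : cp ends (prb a den) χ ≤ Zg :=
    Finset.single_le_sum (f := fun φ => cp ends (prb a den) φ) (fun φ _ => hcp0 φ)
      (Finset.mem_filter.2 ⟨Finset.mem_univ _, hχ, by omega⟩)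
  have hL' : (1 - t) * (1 / 2 * Zg) ≤
      avg (radix n m k) (zVal ends (lwt ends a den) a den (base n m k)) :=
    (mul_le_mul_of_nonneg_right hlo (by linarith)).trans hL
  refine ⟨le_trans ?_ hL', fun hsm => ?_⟩
  · have : 7 / 8 * (1 / 2 * Zg) ≤ (1 - t) * (1 / 2 * Zg) :=
      mul_le_mul_of_nonneg_right (by linarith) (by linarith)
    linarith
  · obtain ⟨hA, hB⟩ := happ (by
      rw [Fintype.card_fin]
      have : (thr n k : ℝ) = (4096 * n ^ 4 * k) ^ 5 := by unfold thr; push_cast; ring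
      rwa [← this])
    have hZ0 : 0 ≤ Z := Finset.sum_nonneg fun φ _ => hcp0 φ
    constructor
    · refine le_trans ?_ hL'
      have := mul_le_mul_of_nonneg_left hB (by linarith : 0 ≤ (1 - t) * (1 / 2))
      calc _ = (1 - t) * (1 / 2) * (2 * failR ends (prb a den) * (1 - t)) := by ring
        _ ≤ _ := this
        _ = _ := by ring
    · refine hU.trans ?_
      refine (mul_le_mul_of_nonneg_right hup (by linarith)).trans ?_
      have := mul_le_mul_of_nonneg_left hA (by linarith : 0 ≤ (1 + t) * (1 / 2))
      calc _ = (1 + t) * (1 / 2) * Z := by ring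
        _ ≤ _ := this
        _ = _ := by ring

/-- Two factors `1 ± t` separate `F` from `μ` and a third separates `μ` from `Z`; for `t ≤ 1 / 8`
their product stays within `1 ± 8 t`. -/
theorem abs_sub_le_of_approx {F μ Z t : ℝ} (ht0 : 0 ≤ t) (ht1 : t ≤ 1 / 8) (hF0 : 0 ≤ F)
    (hlo : F * (1 - t) ^ 2 ≤ μ) (hup : μ ≤ F * (1 + t) ^ 2) (h : |Z - μ| ≤ t * μ) :
    |Z - F| ≤ 8 * t * F := by
  obtain ⟨h1, h2⟩ := abs_le.1 h
  have ht2 : t ^ 2 ≤ 1 / 8 * t := by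
    rw [sq]
    exact mul_le_mul_of_nonneg_right ht1 ht0
  have ht3 : t ^ 3 ≤ 1 / 8 * t ^ 2 := by
    rw [pow_succ' t 2]
    exact mul_le_mul_of_nonneg_right ht1 (sq_nonneg t)
  have ht20 := sq_nonneg t
  have e1 : (1 + t) ^ 3 ≤ 1 + 8 * t := by
    have : (1 + t) ^ 3 = 1 + 3 * t + 3 * t ^ 2 + t ^ 3 := by ring
    linarith
  have e2 : 1 - 8 * t ≤ (1 - t) ^ 3 := by
    have : (1 - t) ^ 3 = 1 - 3 * t + 3 * t ^ 2 - t ^ 3 := by ring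
    linarith
  have h5 : Z ≤ F * (1 + t) ^ 3 := by
    have := mul_le_mul_of_nonneg_left hup (by linarith : 0 ≤ 1 + t)
    calc Z ≤ (1 + t) * μ := by linarith
      _ ≤ _ := this
      _ = _ := by ring
  have h6 : F * (1 - t) ^ 3 ≤ Z := by
    have := mul_le_mul_of_nonneg_left hlo (by linarith : 0 ≤ 1 - t)
    calc _ = (1 - t) * (F * (1 - t) ^ 2) := by ring
      _ ≤ (1 - t) * μ := this
      _ ≤ _ := by linarith
  have h7 := mul_le_mul_of_nonneg_left e1 hF0
  have h8 := mul_le_mul_of_nonneg_left e2 hF0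
  rw [abs_le]
  constructor <;> linarith

set_option maxHeartbeats 800000 in
/-- The result is accurate for most random numbers. -/
theorem card_est_le (hn : 0 < n) (hk : 0 < k) (hden : ∀ e, 0 < den e) (ha : ∀ e, a e ≤ den e) :
    (((Finset.range (radix n m k ^ samples n k)).filter fun x =>
      ¬ |est ends a den k x - failR ends (prb a den)| ≤ 1 / k * failR ends (prb a den)).card : ℝ) *
        4 ≤ (radix n m k : ℝ) ^ samples n k := by
  have hF0 := failR_nonneg (ends := ends) ha
  have hT : (0 : ℝ) < thr n k := by exact_mod_cast thr_pos hn hk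
  have hN : (0 : ℝ) < samples n k := by exact_mod_cast samples_pos hn hk
  have hn' : (0 : ℝ) < n := by exact_mod_cast hn
  have hn1 : (1 : ℝ) ≤ n := by exact_mod_cast hn
  have hk' : (1 : ℝ) ≤ k := by exact_mod_cast hk
  have hT1 : (1 : ℝ) ≤ thr n k := by exact_mod_cast thr_pos hn hk
  have hest := est_eq (ends := ends) (a := a) (k := k) hden
  set F := failR ends (prb a den) with hFdef
  set Q := base n m k
  set R := radix n m k with hR
  set N := samples n k
  set X : ℕ → ℝ := fun x => (∑ j ∈ Finset.range N, (mcVal ends a den Q (x / R ^ j % R) : ℝ)) / N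
    with hX
  set Zh : ℕ → ℝ := fun x =>
    (∑ j ∈ Finset.range N, zVal ends (lwt ends a den) a den Q (x / R ^ j % R)) / N with hZh
  have hZle : ∀ x, Zh x ≤ 4 * n ^ 3 * F := fun x => by
    rw [hZh, div_le_iff₀ hN]
    refine (Finset.sum_le_card_nsmul _ _ _ fun j _ => zVal_le hn hden ha _).trans ?_
    simp [mul_comm, hFdef]
  have hZ0 : ∀ x, 0 ≤ Zh x := fun x =>
    div_nonneg (Finset.sum_nonneg fun _ _ => zVal_nonneg _) hN.le
  rcases eq_or_ne F 0 with hF | hF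
  · -- nothing can go wrong if the network cannot fail
    rw [Finset.filter_false_of_mem]
    · simp only [Finset.card_empty, Nat.cast_zero, zero_mul]
      positivity
    intro x _
    rw [not_not, hF, hest]
    simp only [mul_zero, sub_zero, abs_nonpos_iff]
    split_ifs
    · have := hZle x
      rw [hF, mul_zero] at this
      exact le_antisymm this (hZ0 x)
    · refine div_eq_zero_iff.2 (Or.inl (Finset.sum_eq_zero fun j _ => ?_))
      have hb := prbUp_bounds hden ha (base_pos (n := n) (m := m) (k := k))
      have hp0 : ∀ e, 0 ≤ prb a den e := fun e => by unfold prb; positivity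
      -- Rounding up keeps the probabilities `0` and `1`, so the simulated network fails with
      -- probability exactly `0`, and every single simulation returns `0`.
      have h1 := failRec_eq_zero (ends := ends) hp0 (fun e => (hb e).1.trans (hb e).2.2)
        (fun e he => ?_) (fun e he => le_antisymm (hb e).2.2 (he ▸ (hb e).1)) (List.finRange m)
        (id : Fin n → Fin n) (by rw [← failR_eq_failRec]; exact hF)
      · rw [← avg_mcVal hden ha, avg, div_eq_zero_iff, Finset.sum_eq_zero_iff_of_nonneg
          fun _ _ => Nat.cast_nonneg _] at h1
        have hR0 : ((radix n m k : ℕ) : ℝ) ≠ 0 := by exact_mod_cast radix_pos.ne'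
        exact (h1.resolve_right hR0) _ (Finset.mem_range.2 (Nat.mod_lt _ radix_pos))
      · have hd : (den e : ℝ) ≠ 0 := by exact_mod_cast (hden e).ne'
        have ha0 : (a e : ℝ) = 0 := by
          rw [prb, div_eq_zero_iff] at he
          exact he.resolve_right hd
        simp [prbUp, ha0]
  have hFpos : 0 < F := lt_of_le_of_ne hF0 (Ne.symm hF)
  -- accuracy of the simulation
  have hB := fun h => card_mc_le (ends := ends) (a := a) (den := den) hn hk hden ha h
  rw [← hFdef] at hB
  by_cases hq : 0 < qNum ends a den ∧ qNum ends a den < qDen ends a den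
  · have hex : ∃ χ : Fin n → Fin 2, Nonconst χ := by
      by_contra hno
      push Not at hno
      have := failR_le (ends := ends) (p := prb a den) (fun e => by unfold prb; positivity)
        (fun e => div_le_one_of_le₀ (by exact_mod_cast ha e) (Nat.cast_nonneg _))
      rw [Finset.filter_false_of_mem (fun χ _ => hno χ), Finset.sum_empty] at this
      linarith
    obtain ⟨P, μ, hμ, hP, hPμ, happ⟩ := avg_zVal_bounds hn hk hden ha hex hq.1 hq.2
    rw [← hFdef] at happ
    have hμ0 : 0 < μ := by linarith
    set t : ℝ := 1 / (8 * (k : ℝ)) with htdef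
    have ht0 : 0 < t := by positivity
    have ht1 : t ≤ 1 / 8 := by
      rw [htdef, div_le_div_iff₀ (by positivity) (by norm_num)]
      linarith
    have h8t : 1 / (k : ℝ) = 8 * t := by rw [htdef]; field_simp
    have hF1 : F ≤ 1 := by
      rw [hFdef, failR_eq_failRec]
      exact failRec_le_one (p := prb a den) (fun e => by unfold prb; positivity)
        (fun e => div_le_one_of_le₀ (by exact_mod_cast ha e) (Nat.cast_nonneg _)) _ _
    -- If `P` is small, `μ` approximates `F`; otherwise `4 thr μ ≥ (7 / 4) P thr > 1 ≥ F`. The mean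
    -- is thus never so small that the samples do not suffice.
    have hFμ : F ≤ 4 * thr n k * μ := by
      by_cases hs : P * thr n k ≤ 1
      · have h1 := (happ hs).1
        have h2 : F * (1 / 4) ≤ F * (1 - t) ^ 2 := mul_le_mul_of_nonneg_left (by nlinarith) hF0
        nlinarith
      · nlinarith
    -- The condition is `32 n ^ 3 F ≤ N t ^ 2 μ`; it holds because `N t ^ 2 = 2 ^ 8 n ^ 3 thr` and
    -- `F ≤ 4 thr μ`.
    have hA := card_mean_le (R := radix n m k) (N := samples n k) radix_pos
      (Y := zVal ends (lwt ends a den) a den Q) (B := 4 * n ^ 3 * F) (μ := μ) (η := t)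
      (fun _ _ => zVal_nonneg _) (fun x _ => zVal_le hn hden ha x) hμ hμ0 ht0 (by
        have : (samples n k : ℝ) * t ^ 2 = 2 ^ 8 * (n ^ 3 * thr n k) := by
          rw [htdef, samples]
          push_cast
          field_simp
          norm_num
        rw [this]
        have h2 := mul_le_mul_of_nonneg_left hFμ (by positivity : (0 : ℝ) ≤ n ^ 3)
        have h3 : (0 : ℝ) ≤ n ^ 3 * thr n k * μ := by positivity
        linarith)
    have key : ∀ x, |(∑ j ∈ Finset.range N, zVal ends (lwt ends a den) a den Q (x / R ^ j % R)) -
        N * μ| ≤ t * (N * μ) →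
        (1 ≤ F * (16 * n ^ 3 * thr n k) → |X x - F| ≤ 1 / k * F) →
        |est ends a den k x - F| ≤ 1 / k * F := by
      intro x hx hx'
      have hx1 : |Zh x - μ| ≤ t * μ := by
        have : Zh x - μ = ((∑ j ∈ Finset.range N,
            zVal ends (lwt ends a den) a den Q (x / R ^ j % R)) - N * μ) / N := by
          rw [hZh]
          field_simp
        rw [this, abs_div, abs_of_pos hN, div_le_iff₀ hN]
        linarith
      obtain ⟨hx2, hx3⟩ := abs_le.1 hx1
      have huse : UseZ ends a den k x ↔ 4 * thr n k * Zh x < 1 := by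
        have hZD : (0 : ℝ) < zSumDen ends a den k x := by
          unfold zSumDen sumDen
          exact_mod_cast Finset.prod_pos fun _ _ => zDen_pos hden _
        have h1 : Zh x * N = zSumNum ends a den k x / zSumDen ends a den k x := by
          rw [zSumNum, zSumDen, sumNum_div_sumDen (fun y => zDen_pos hden y), hZh,
            div_mul_cancel₀ _ hN.ne']
          rfl
        have h2 : Zh x = zSumNum ends a den k x / (N * zSumDen ends a den k x) := by
          rw [mul_comm, ← div_div, ← h1, mul_div_cancel_right₀ _ hN.ne']
        rw [UseZ, ← and_assoc, and_iff_right hq, h2, ← mul_div_assoc,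
          div_lt_one (by positivity)]
        exact_mod_cast Iff.rfl
      rw [hest]
      by_cases hu : UseZ ends a den k x
      · rw [if_pos hu]
        change |Zh x - F| ≤ _
        rw [huse] at hu
        -- A small sample mean certifies a small `P`: `Zh ≥ (7 / 8) μ ≥ (49 / 128) P ≥ P / 4`, while
        -- `4 thr Zh < 1`.
        have hsm : P * thr n k ≤ 1 := by
          have h1 : 7 / 8 * μ ≤ Zh x := by
            have := mul_le_mul_of_nonneg_right ht1 hμ0.le
            linarith
          have h2 : P / 4 ≤ Zh x := by linarith
          have h3 := mul_le_mul_of_nonneg_right h2 hT.le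
          linarith
        obtain ⟨h3, h4⟩ := happ hsm
        rw [h8t]
        exact abs_sub_le_of_approx ht0.le ht1 hF0 h3 h4 hx1
      -- A large sample mean certifies a large `F`, since `Zh ≤ 4 n ^ 3 F` holds on every run; the
      -- simulation is then accurate.
      · rw [if_neg hu]
        refine hx' ?_
        rw [huse, not_lt] at hu
        have := mul_le_mul_of_nonneg_left (hZle x) (by positivity : (0 : ℝ) ≤ 4 * thr n k)
        calc 1 ≤ 4 * thr n k * Zh x := hu
          _ ≤ 4 * thr n k * (4 * n ^ 3 * F) := this
          _ = _ := by ring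
    classical
    -- Both estimates read the same random digits, so no independence is available; the union bound
    -- with twice the probability `1 / 8` suffices. If `F` is too small for simulation, only the
    -- first bad event matters.
    by_cases hbig : 1 ≤ F * (16 * n ^ 3 * thr n k)
    · have h1 := Finset.card_le_card (s := (Finset.range (R ^ N)).filter fun x =>
          ¬ |est ends a den k x - F| ≤ 1 / k * F)
        (t := ((Finset.range (R ^ N)).filter fun x => ¬ |(∑ j ∈ Finset.range N,
          zVal ends (lwt ends a den) a den Q (x / R ^ j % R)) - N * μ| ≤ t * (N * μ)) ∪
          (Finset.range (R ^ N)).filter fun x => ¬ |X x - F| ≤ 1 / k * F) fun x hx => by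
        rw [Finset.mem_union, Finset.mem_filter, Finset.mem_filter]
        rw [Finset.mem_filter] at hx
        by_contra hno
        rw [not_or, not_and, not_not, not_and, not_not] at hno
        exact hx.2 (key x (hno.1 hx.1) fun _ => hno.2 hx.1)
      have h2 := h1.trans (Finset.card_union_le _ _)
      have h3 := hB hbig
      have h4 : (((Finset.range (R ^ N)).filter fun x =>
          ¬ |est ends a den k x - F| ≤ 1 / k * F).card : ℝ) ≤ _ := Nat.cast_le.2 h2
      push_cast at h4
      linarith
    · have h1 := Finset.card_le_card (s := (Finset.range (R ^ N)).filter fun x =>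
          ¬ |est ends a den k x - F| ≤ 1 / k * F)
        (t := ((Finset.range (R ^ N)).filter fun x => ¬ |(∑ j ∈ Finset.range N,
          zVal ends (lwt ends a den) a den Q (x / R ^ j % R)) - N * μ| ≤ t * (N * μ))) fun x hx => by
        rw [Finset.mem_filter] at hx ⊢
        exact ⟨hx.1, fun h => hx.2 (key x h fun h' => (hbig h').elim)⟩
      have h4 : (((Finset.range (R ^ N)).filter fun x =>
          ¬ |est ends a den k x - F| ≤ 1 / k * F).card : ℝ) ≤ _ := Nat.cast_le.2 h1
      have h5 : (0 : ℝ) ≤ (((Finset.range (R ^ N)).filter fun x =>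
          ¬ |est ends a den k x - F| ≤ 1 / k * F).card : ℝ) := Nat.cast_nonneg _
      linarith
  -- With a degenerate bottleneck the algorithm always simulates, and `F ≥ 1` makes this accurate.
  · have h1 := one_le_failR hden ha hF hq
    rw [← hFdef] at h1
    have h2 : 1 ≤ F * (16 * n ^ 3 * thr n k) := by
      have h3 : (1 : ℝ) ≤ n ^ 3 * thr n k := one_le_mul_of_one_le_of_one_le (one_le_pow₀ hn1) hT1
      nlinarith
    have h3 := hB h2
    have h4 : ∀ x, est ends a den k x = X x := fun x => by
      rw [hest, if_neg fun h => hq ⟨h.1, h.2.1⟩]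
    simp only [h4]
    have h5 : (0 : ℝ) ≤ (((Finset.range (R ^ N)).filter fun x =>
          ¬ |X x - F| ≤ 1 / k * F).card : ℝ) := Nat.cast_nonneg _
    linarith

end correct


/-! ### Programs for finite families of numbers -/

/-- The list `0, …, n - 1`. -/
def rangeV (n : ℕ) : Val := Val.ofList (List.ofFn fun k : Fin n => .num k)

/-- A finite family of numbers, as the list of its entries, each preceded by its position. -/
def idx {n : ℕ} (f : Fin n → ℕ) : Val :=
  Val.ofList (List.ofFn fun k : Fin n => .pair (.num k) (.num (f k)))

theorem size_idx_le {n B : ℕ} {f : Fin n → ℕ} (h : ∀ k, f k ≤ B) :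
    (idx f).size ≤ n * (n + B + 4) + 1 :=
  Val.size_ofList_ofFn_le (B := n + B + 3) fun k => by
    have h1 := Nat.size_le_self' (k : ℕ)
    have h2 := Nat.size_le_self' (f k)
    have h3 := h k
    have h4 := k.2
    simp only [Val.size]
    omega

namespace Comp

variable {α : Type} {s : α → ℕ} {i : α → Val} {n : α → ℕ}

/-- Lists grow at the front, so the range is built downwards with a counter in the loop state. -/
theorem range (hn : CompN s i n) (hpn : PB s n) : Comp s i (fun a => rangeV (n a)) := by
  have hB : PB s (fun a => n a + (n a * (n a + 2) + 1) + 1) :=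
    (hpn.add ((hpn.mul (hpn.add (PB.const 2))).add (PB.const 1))).add (PB.const 1)
  have hsz : ∀ a k, k ≤ n a →
      (Val.ofList (List.ofFn fun j : Fin k => .num (n a - k + j))).size ≤ n a * (n a + 2) + 1 := by
    intro a k hk
    refine (Val.size_ofList_ofFn_le (B := n a + 1) fun j => ?_).trans
      (Nat.succ_le_succ (Nat.mul_le_mul_right _ hk))
    have h1 := Nat.size_le_self' (n a - k + j)
    have h2 := j.2
    simp only [Val.size]
    omega
  have h := Comp.iter (n := n)
    (st := fun a k => .pair (.num (n a - k))
      (Val.ofList (List.ofFn fun j : Fin k => .num (n a - k + j))))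
    (fun a => n a + (n a * (n a + 2) + 1) + 2) hn hpn
    ((hn.pair (const hn.pb_in 0)).congr fun a => by simp [Val.ofList]) (hB.add (PB.const 1))
    (fun a k hk => by
      have h1 := Nat.size_le_self' (n a - k)
      have h2 := hsz a k hk
      simp only [Val.size] at h2 ⊢
      omega)
    (fun hE => by
      have h1 := hE.snd.fst.sub (const hE.pb_in 1)
      refine (h1.pair (h1.pair hE.snd.snd)).congr fun b => ?_
      have hb := b.2.2
      congr 1
      rw [List.ofFn_succ]
      simp only [Val.ofList]
      congr 3
      funext j
      rw [Fin.val_succ]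
      congr 1
      omega)
  refine h.snd.congr fun a => ?_
  rw [rangeV]
  congr 2
  funext j
  simp

theorem enum {g : ∀ a, Fin (n a) → Val} (hl : Comp s i (fun a => Val.ofList (List.ofFn (g a)))) :
    Comp s i (fun a => Val.ofList (List.ofFn fun k => .pair (.num k) (g a k))) := by
  have hsz : ∀ a k, k ≤ n a → (Val.ofList (List.ofFn fun j : Fin k =>
      if h : (k - 1 - j) < n a then .pair (.num (k - 1 - j)) (g a ⟨k - 1 - j, h⟩)
      else .num 0)).size ≤
      n a * (n a + 3 + (Val.ofList (List.ofFn (g a))).size) + 1 := by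
    intro a k hk
    refine (Val.size_ofList_ofFn_le (B := n a + 2 + (Val.ofList (List.ofFn (g a))).size)
      fun j => ?_).trans (Nat.succ_le_succ ?_)
    · have hj : k - 1 - j < n a := by omega
      rw [dif_pos hj]
      have h1 := Nat.size_le_self' (k - 1 - j)
      have h2 := Val.le_size_ofList_ofFn (g a) ⟨k - 1 - j, hj⟩
      simp only [Val.size]
      omega
    · refine Nat.mul_le_mul hk (by omega)
  have hpn := hl.pb_length
  have h := Comp.fold (g := g)
    (st := fun a k => .pair (.num k) (Val.ofList (List.ofFn fun j : Fin k =>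
      if h : (k - 1 - j) < n a then .pair (.num (k - 1 - j)) (g a ⟨k - 1 - j, h⟩)
      else .num 0)))
    (fun a => n a + (n a * (n a + 3 + (Val.ofList (List.ofFn (g a))).size) + 1) + 2) hl
    (((const hl.pb_in 0).pair (const hl.pb_in 0)).congr fun a => by simp [Val.ofList])
    ((hpn.add ((hpn.mul ((hpn.add (PB.const 3)).add hl.pb_out)).add (PB.const 1))).add
      (PB.const 2))
    (fun a k hk => by
      have h1 := Nat.size_le_self' k
      have h2 := hsz a k hk
      simp only [Val.size] at h2 ⊢
      omega)
    (fun hE => by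
      refine ((hE.snd.snd.fst.add (const hE.pb_in 1)).pair
        ((hE.snd.snd.fst.pair hE.snd.fst).pair hE.snd.snd.snd)).congr fun b => ?_
      congr 1
      rw [List.ofFn_succ]
      simp only [Val.ofList]
      congr 1
      · simp
      · congr 2
        funext j
        have e : ((b.2 : ℕ) + 1 - 1 - (j.succ : Fin (b.2 + 1)) : ℕ) = b.2 - 1 - j := by
          rw [Fin.val_succ]
          omega
        simp only [e])
  have h' : Comp s i (fun a => Val.ofList (List.ofFn fun k : Fin (n a) =>
      .pair (.num k.rev) (g a k.rev))) := h.snd.congr fun a => by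
    congr 2
    funext j
    have e : n a - 1 - (j : ℕ) = (j.rev : ℕ) := by
      rw [Fin.val_rev]
      omega
    simp only [e, Fin.is_lt, dif_pos, Fin.eta]
  exact (map_rev (f := fun a k => .pair (.num k.rev) (g a k.rev)) h' fun hE => hE.snd).congr
    fun a => by simp only [Fin.rev_rev]

section index

variable {f : ∀ a, Fin (n a) → ℕ}

theorem mkIdx (hV : Comp s i (fun a => rangeV (n a)))
    (hf : Comp (fun b : Σ a, Fin (n a) => s b.1) (fun b => .pair (i b.1) (.num b.2))
        (fun b => .pair (i b.1) (.num b.2)) →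
      CompN (fun b : Σ a, Fin (n a) => s b.1) (fun b => .pair (i b.1) (.num b.2))
        (fun b => f b.1 b.2)) :
    Comp s i (fun a => idx (f a)) :=
  map hV fun hE => hE.snd.pair (hf hE)

theorem get (hf : Comp s i (fun a => idx (f a))) {u : ∀ a, Fin (n a)}
    (hu : CompN s i (fun a => (u a : ℕ))) : CompN s i (fun a => f a (u a)) :=
  lookup u hf hu

variable {P : ∀ a, Fin (n a) → Prop} [∀ a k, Decidable (P a k)]

theorem ex (hV : Comp s i (fun a => rangeV (n a)))
    (hP : Comp (fun b : Σ a, Fin (n a) => s b.1) (fun b => .pair (i b.1) (.num b.2))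
        (fun b => .pair (i b.1) (.num b.2)) →
      CompN (fun b : Σ a, Fin (n a) => s b.1) (fun b => .pair (i b.1) (.num b.2))
        (fun b => ind (P b.1 b.2))) :
    CompN s i (fun a => ind (∃ k, P a k)) :=
  ((const hV.pb_in 1).le (sum (f := fun a k => ind (P a k)) hV hP)).congr fun a => by
    congr 1
    refine if_congr ?_ rfl rfl
    rw [Nat.one_le_iff_ne_zero, Ne, Finset.sum_eq_zero_iff]
    simp [ind]

theorem all (hV : Comp s i (fun a => rangeV (n a)))
    (hP : Comp (fun b : Σ a, Fin (n a) => s b.1) (fun b => .pair (i b.1) (.num b.2))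
        (fun b => .pair (i b.1) (.num b.2)) →
      CompN (fun b : Σ a, Fin (n a) => s b.1) (fun b => .pair (i b.1) (.num b.2))
        (fun b => ind (P b.1 b.2))) :
    CompN s i (fun a => ind (∀ k, P a k)) :=
  (not (ex (P := fun a k => ¬ P a k) hV fun hE => not (hP hE))).congr fun a => by
    congr 1
    exact if_congr (by push Not; rfl) rfl rfl

theorem pb_range (hV : Comp s i (fun a => rangeV (n a))) : PB s n := hV.pb_length

end index

end Comp

/-! ### Programs for networks -/

/-- The network with the given data is available to a program. -/
structure HasNet {α : Type} (s : α → ℕ) (i : α → Val) {n m : α → ℕ}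
    (ends : ∀ a, Fin (m a) → Fin (n a) × Fin (n a)) (A den : ∀ a, Fin (m a) → ℕ) : Prop where
  V : Comp s i (fun a => rangeV (n a))
  E : Comp s i (fun a => rangeV (m a))
  left : Comp s i (fun a => idx fun e => ((ends a e).1 : ℕ))
  right : Comp s i (fun a => idx fun e => ((ends a e).2 : ℕ))
  num : Comp s i (fun a => idx (A a))
  den : Comp s i (fun a => idx (den a))

namespace HasNet

open NetRel.Comp

variable {α : Type} {s : α → ℕ} {i : α → Val} {n m : α → ℕ}
  {ends : ∀ a, Fin (m a) → Fin (n a) × Fin (n a)} {A den : ∀ a, Fin (m a) → ℕ}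

theorem up {κ : α → Type} {j : (Σ a, κ a) → Val} (h : HasNet s i ends A den)
    (hE : Comp (fun b : Σ a, κ a => s b.1) j (fun b => i b.1)) :
    HasNet (fun b : Σ a, κ a => s b.1) j (fun b => ends b.1) (fun b => A b.1) (fun b => den b.1) :=
  ⟨h.V.up hE, h.E.up hE, h.left.up hE, h.right.up hE, h.num.up hE, h.den.up hE⟩

section labels

variable {c : α → ℕ} {l : ∀ a, Fin (n a) → Fin (c a)} {e : ∀ a, Fin (m a)} {w : ∀ a, Fin (m a) → ℕ}

theorem cross (h : HasNet s i ends A den) (hl : Comp s i (fun a => idx fun v => (l a v : ℕ)))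
    (he : CompN s i (fun a => (e a : ℕ))) :
    CompN s i (fun a => ind (Cross (ends a) (l a) (e a))) :=
  (not ((get hl (u := fun a => (ends a (e a)).1) (get h.left he)).eq
    (get hl (u := fun a => (ends a (e a)).2) (get h.right he)))).congr fun a => by
    congr 1
    exact if_congr (not_congr Fin.ext_iff) rfl rfl

theorem wt (h : HasNet s i ends A den) (hl : Comp s i (fun a => idx fun v => (l a v : ℕ)))
    (hw : Comp s i (fun a => idx (w a))) :
    CompN s i (fun a => NetRel.wt (ends a) (w a) (l a)) :=
  sum (f := fun a e => if Cross (ends a) (l a) e then w a e else 0) h.E fun hE =>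
    iteN ((h.up hE.fst).cross (hl.up hE.fst) hE.snd) (get (hw.up hE.fst) hE.snd)
      (const hE.pb_in 0)

theorem prodCross (h : HasNet s i ends A den) (hl : Comp s i (fun a => idx fun v => (l a v : ℕ)))
    (hw : Comp s i (fun a => idx (w a))) :
    CompN s i (fun a => ∏ e, if Cross (ends a) (l a) e then w a e else 1) :=
  prod (f := fun a e => if Cross (ends a) (l a) e then w a e else 1) h.E fun hE =>
    iteN ((h.up hE.fst).cross (hl.up hE.fst) hE.snd) (get (hw.up hE.fst) hE.snd)
      (const hE.pb_in 1)

theorem nonconst (h : HasNet s i ends A den)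
    (hl : Comp s i (fun a => idx fun v => (l a v : ℕ))) :
    CompN s i (fun a => ind (Nonconst (l a))) :=
  (ex (P := fun a x => ∃ y, l a x ≠ l a y) h.V fun hE =>
    ex (P := fun b y => l b.1 b.2 ≠ l b.1 y) (h.V.up hE.fst) fun hE' =>
      (not ((get ((hl.up hE.fst).up hE'.fst) (u := fun b => b.1.2) (hE.snd.up hE'.fst)).eq
        (get ((hl.up hE.fst).up hE'.fst) hE'.snd))).congr fun b => by
        congr 1
        exact if_congr (not_congr Fin.ext_iff) rfl rfl).congr fun a => by
    congr 1
    exact if_congr Iff.rfl rfl rfl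

end labels

variable {l : ∀ a, Fin (n a) → Fin (n a)} {e : ∀ a, Fin (m a)} {w : ∀ a, Fin (m a) → ℕ}

theorem merge (h : HasNet s i ends A den) (hl : Comp s i (fun a => idx fun v => (l a v : ℕ)))
    (he : CompN s i (fun a => (e a : ℕ))) :
    Comp s i (fun a => idx fun v => ((NetRel.merge (ends a) (l a) (e a) v : Fin (n a)) : ℕ)) :=
  mkIdx h.V fun hE => (iteN (P := fun b => (l b.1 b.2 : ℕ) = l b.1 (ends b.1 (e b.1)).1)
    ((get (hl.up hE.fst) hE.snd).eq
      ((get hl (u := fun a => (ends a (e a)).1) (get h.left he)).up hE.fst))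
    ((get hl (u := fun a => (ends a (e a)).2) (get h.right he)).up hE.fst)
    (get (hl.up hE.fst) hE.snd)).congr fun b => by
      simp only [NetRel.merge, ← Fin.ext_iff]
      split_ifs <;> rfl

theorem mergeAll (h : HasNet s i ends A den) (hl : Comp s i (fun a => idx fun v => (l a v : ℕ)))
    {c : ∀ a, Fin (m a) → Prop} [∀ a, DecidablePred (c a)]
    (hc : Comp (fun b : Σ a, Fin (m a) => s b.1) (fun b => .pair (i b.1) (.num b.2))
        (fun b => .pair (i b.1) (.num b.2)) →
      CompN (fun b : Σ a, Fin (m a) => s b.1) (fun b => .pair (i b.1) (.num b.2))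
        (fun b => ind (c b.1 b.2))) :
    Comp s i (fun a => idx fun v => ((NetRel.mergeAll (ends a) (c a) (l a) v : Fin (n a)) : ℕ)) := by
  have hpn := h.V.pb_range
  have hc' := hc (refl h.E.pb_entry)
  refine (fold (st := fun a k => idx fun v => (((((List.finRange (m a)).take k).foldl
    (fun l e => if c a e then NetRel.merge (ends a) l e else l) (l a)) v : Fin (n a)) : ℕ))
    (fun a => n a * (n a + n a + 4) + 1) h.E (hl.congr fun a => by simp)
    ((hpn.mul ((hpn.add hpn).add (PB.const 4))).add (PB.const 1))
    (fun a k _ => size_idx_le fun v => (Fin.is_lt _).le) fun hE => ?_).congr fun a => ?_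
  · refine (ite (P := fun b => c b.1 b.2) ((hE.fst.pair hE.snd.fst).trans hc')
      ((h.up hE.fst).merge hE.snd.snd (e := fun b => b.2) hE.snd.fst) hE.snd.snd).congr fun b => ?_
    have hb : (b.2 : ℕ) < (List.finRange (m b.1)).length := by simp
    rw [List.take_add_one, List.getElem?_eq_getElem hb, Option.toList_some, List.foldl_append]
    simp only [List.foldl_cons, List.foldl_nil, List.getElem_finRange, Fin.cast_mk, Fin.eta]
    split_ifs <;> rfl
  · rw [NetRel.mergeAll, List.take_of_length_le (by simp)]

end HasNet

section contract

variable {n m : ℕ} (ends : Fin m → Fin n × Fin n) (w : Fin m → ℕ)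

theorem sum_hit (f : Fin m → ℕ) (g : Fin m → ℕ) {r : ℕ} {e : Fin m} (he : Hit f r e) :
    ∑ e, (if Hit f r e then g e else 0) = g e := by
  rw [Finset.sum_eq_single e, if_pos he]
  · intro e' _ hne
    exact if_neg fun h => hne (h.unique he)
  · simp

/-- The edge selected by choice in `contract` is unique, so its end labels can be computed as masked
sums. If no edge is selected, both sums are `0`, and relabelling the block `0` by `0` changes
nothing. -/
theorem contract_val (l : Fin n → Fin n) (r : ℕ) (v : Fin n) :
    (contract ends w l r v : ℕ) =
      if (l v : ℕ) = ∑ e, (if Hit (crossWt ends w l) r e then (l (ends e).1 : ℕ) else 0) then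
        ∑ e, (if Hit (crossWt ends w l) r e then (l (ends e).2 : ℕ) else 0) else l v := by
  by_cases h : ∃ e, Hit (crossWt ends w l) r e
  · obtain ⟨e, he⟩ := h
    rw [contract_eq he, sum_hit _ (fun e => (l (ends e).1 : ℕ)) he,
      sum_hit _ (fun e => (l (ends e).2 : ℕ)) he, merge]
    simp only [Fin.ext_iff]
    split_ifs <;> rfl
  · rw [contract, dif_neg h]
    push Not at h
    simp only [h, if_false, Finset.sum_const_zero]
    split_ifs with h0
    exacts [h0, rfl]

end contract

namespace HasNet

open NetRel.Comp

variable {α : Type} {s : α → ℕ} {i : α → Val} {n m : α → ℕ}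
  {ends : ∀ a, Fin (m a) → Fin (n a) × Fin (n a)} {A den : ∀ a, Fin (m a) → ℕ}
  {l : ∀ a, Fin (n a) → Fin (n a)} {e : ∀ a, Fin (m a)} {w : ∀ a, Fin (m a) → ℕ}

theorem contract (h : HasNet s i ends A den) (hl : Comp s i (fun a => idx fun v => (l a v : ℕ)))
    (hw : Comp s i (fun a => idx (w a))) {r : α → ℕ} (hr : CompN s i r) :
    Comp s i (fun a => idx fun v =>
      ((NetRel.contract (ends a) (w a) (l a) (r a) v : Fin (n a)) : ℕ)) := by
  have hcw : Comp s i (fun a => idx (crossWt (ends a) (w a) (l a))) := mkIdx h.E fun hE =>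
    iteN ((h.up hE.fst).cross (hl.up hE.fst) hE.snd) (get (hw.up hE.fst) hE.snd)
      (const hE.pb_in 0)
  have hP : Comp s i (fun a => idx fun e : Fin (m a) =>
      ∑ j, (if j < e then crossWt (ends a) (w a) (l a) j else 0)) := mkIdx h.E fun hE =>
    sum (f := fun b j => if j < b.2 then crossWt (ends b.1) (w b.1) (l b.1) j else 0)
      (h.E.up hE.fst) fun hE' =>
        iteN (P := fun c => c.2 < c.1.2) (hE'.snd.lt (hE.snd.up hE'.fst))
          (get ((hcw.up hE.fst).up hE'.fst) hE'.snd) (const hE'.pb_in 0)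
  have hsum : ∀ {f : ∀ a, Fin (m a) → ℕ}, Comp s i (fun a => idx (f a)) → CompN s i (fun a =>
      ∑ e, if Hit (crossWt (ends a) (w a) (l a)) (r a) e then f a e else 0) := fun {f} hf =>
    sum (f := fun a e => if Hit (crossWt (ends a) (w a) (l a)) (r a) e then f a e else 0) h.E
      fun hE => iteN (P := fun b => Hit (crossWt (ends b.1) (w b.1) (l b.1)) (r b.1) b.2)
        (((get (hP.up hE.fst) hE.snd).le (hr.up hE.fst)).and ((hr.up hE.fst).lt
          ((get (hP.up hE.fst) hE.snd).add (get (hcw.up hE.fst) hE.snd))))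
        (get (hf.up hE.fst) hE.snd) (const hE.pb_in 0)
  have hu := hsum (f := fun a e => (l a (ends a e).1 : ℕ)) (mkIdx h.E fun hE =>
    get (hl.up hE.fst) (u := fun b => (ends b.1 b.2).1) (get (h.left.up hE.fst) hE.snd))
  have hv := hsum (f := fun a e => (l a (ends a e).2 : ℕ)) (mkIdx h.E fun hE =>
    get (hl.up hE.fst) (u := fun b => (ends b.1 b.2).2) (get (h.right.up hE.fst) hE.snd))
  exact mkIdx h.V fun hE => (iteN ((get (hl.up hE.fst) hE.snd).eq (hu.up hE.fst)) (hv.up hE.fst)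
    (get (hl.up hE.fst) hE.snd)).congr fun b =>
      congrArg Val.num (contract_val _ _ _ _ _)

theorem contractStep_iterate_snd_le {n m : ℕ} (ends : Fin m → Fin n × Fin n) (w : Fin m → ℕ)
    (Q k : ℕ) (s : (Fin n → Fin n) × ℕ) : ((contractStep ends w Q)^[k] s).2 ≤ s.2 := by
  induction k generalizing s with
  | zero => exact le_rfl
  | succ k ih => exact (ih _).trans (Nat.div_le_self _ _)

theorem iterate (h : HasNet s i ends A den) (hw : Comp s i (fun a => idx (w a)))
    {d Q x : α → ℕ} (hd : CompN s i d) (hpd : PB s d) (hQ : CompN s i Q) (hx : CompN s i x) :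
    Comp s i (fun a => .pair (idx fun v =>
      ((((contractStep (ends a) (w a) (Q a))^[d a] (id, x a)).1 v : Fin (n a)) : ℕ))
      (.num ((contractStep (ends a) (w a) (Q a))^[d a] (id, x a)).2)) := by
  have hpn := h.V.pb_range
  refine Comp.iter (st := fun a k => .pair (idx fun v =>
      ((((contractStep (ends a) (w a) (Q a))^[k] (id, x a)).1 v : Fin (n a)) : ℕ))
      (.num ((contractStep (ends a) (w a) (Q a))^[k] (id, x a)).2))
    (fun a => (n a * (n a + n a + 4) + 1) + (Val.num (x a)).size + 1) hd hpd
    ((mkIdx (f := fun _ v => (v : ℕ)) h.V fun hE => hE.snd).pair hx)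
    ((((hpn.mul ((hpn.add hpn).add (PB.const 4))).add (PB.const 1)).add hx.pb_out).add
      (PB.const 1)) (fun a k _ => ?_) fun hE => ?_
  · have h1 := size_idx_le (n := n a) (B := n a) (f := fun v =>
      ((((contractStep (ends a) (w a) (Q a))^[k] (id, x a)).1 v : Fin (n a)) : ℕ))
      fun v => (Fin.is_lt _).le
    have h2 := Nat.size_le_size (contractStep_iterate_snd_le (ends a) (w a) (Q a) k (id, x a))
    simp only [Val.size] at h1 h2 ⊢
    omega
  · have hN := h.up hE.fst
    have hw' := hw.up hE.fst
    have hQ' := hQ.up hE.fst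
    refine ((hN.contract hE.snd.fst hw' ((hE.snd.snd.mod hQ').mod
      (hN.wt hE.snd.fst hw'))).pair (hE.snd.snd.div hQ')).congr fun b => ?_
    rw [Function.iterate_succ_apply']
    rfl

theorem runColor (h : HasNet s i ends A den) (hw : Comp s i (fun a => idx (w a)))
    {Q x : α → ℕ} (hQ : CompN s i Q) (hx : CompN s i x) :
    Comp s i (fun a => idx fun v => (NetRel.runColor (ends a) (w a) (Q a) (x a) v : ℕ)) := by
  have hn := Comp.length h.V
  have hpn := h.V.pb_range
  have hit := h.iterate hw (hn.sub (const hn.pb_in 3)) (hpn.mono fun a => Nat.sub_le _ _) hQ hx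
  refine mkIdx h.V fun hE => ?_
  have hl := get (hit.fst.up hE.fst) hE.snd
  have hp := Comp.pow (const hE.pb_in 2) hl (hpn.up.mono fun b => (Fin.is_lt _).le)
  exact ((hit.snd.up hE.fst).div hp).mod (const hE.pb_in 2)

theorem zNum (h : HasNet s i ends A den) (hw : Comp s i (fun a => idx (w a)))
    {Q x : α → ℕ} (hQ : CompN s i Q) (hx : CompN s i x) :
    CompN s i (fun a => NetRel.zNum (ends a) (w a) (A a) (Q a) (x a)) := by
  have hn := Comp.length h.V
  have hpn := h.V.pb_range
  have hχ := h.runColor hw hQ hx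
  have hc := h.wt hχ hw
  have hd := hn.sub (const hn.pb_in 3)
  have hpd : PB s (fun a => n a - 3) := hpn.mono fun a => Nat.sub_le _ _
  have hr := Comp.range hd hpd
  have h1 := Comp.pow (const hn.pb_in 2) ((hn.sub hd).sub (const hn.pb_in 1))
    (hpn.mono fun a => by omega)
  have h2 := h.prodCross hχ h.num
  have h3 := prod (f := fun a j => rhoNum (ends a) (w a)
      (NetRel.wt (ends a) (w a) (NetRel.runColor (ends a) (w a) (Q a) (x a))) (n a - j)
      ((contractStep (ends a) (w a) (Q a))^[j] (id, x a)).1) hr fun hE => by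
    have hN := h.up hE.fst
    have hit := hN.iterate (hw.up hE.fst) hE.snd (hpn.up.mono fun b => by omega) (hQ.up hE.fst)
      (hx.up hE.fst)
    have hW := hN.wt hit.fst (hw.up hE.fst)
    exact iteN ((((hn.up hE.fst).sub hE.snd).mul (hc.up hE.fst)).le
      ((const hE.pb_in 3).mul hW)) hW (const hE.pb_in 0)
  refine (iteN (hc.eq (const hn.pb_in 0)) (const hn.pb_in 0) ((h1.mul h2).mul h3)).congr
    fun a => ?_
  beta_reduce
  rw [NetRel.zNum, Finset.prod_range]

theorem zDen (h : HasNet s i ends A den) (hw : Comp s i (fun a => idx (w a)))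
    {Q x : α → ℕ} (hQ : CompN s i Q) (hx : CompN s i x) :
    CompN s i (fun a => NetRel.zDen (ends a) (w a) (den a) (Q a) (x a)) := by
  have hn := Comp.length h.V
  have hpn := h.V.pb_range
  have hχ := h.runColor hw hQ hx
  have hc := h.wt hχ hw
  have hd := hn.sub (const hn.pb_in 3)
  have hpd : PB s (fun a => n a - 3) := hpn.mono fun a => Nat.sub_le _ _
  have hr := Comp.range hd hpd
  have h2 := h.prodCross hχ h.den
  have h3 := prod (f := fun a j => rhoDen (ends a) (w a)
      (NetRel.wt (ends a) (w a) (NetRel.runColor (ends a) (w a) (Q a) (x a))) (n a - j)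
      ((contractStep (ends a) (w a) (Q a))^[j] (id, x a)).1) hr fun hE => by
    have hN := h.up hE.fst
    have hit := hN.iterate (hw.up hE.fst) hE.snd (hpn.up.mono fun b => by omega) (hQ.up hE.fst)
      (hx.up hE.fst)
    have hW := hN.wt hit.fst (hw.up hE.fst)
    exact iteN ((((hn.up hE.fst).sub hE.snd).mul (hc.up hE.fst)).le
      ((const hE.pb_in 3).mul hW)) (hW.sub (hc.up hE.fst)) (const hE.pb_in 1)
  refine (iteN (hc.eq (const hn.pb_in 0)) (const hn.pb_in 1) (h2.mul h3)).congr fun a => ?_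
  beta_reduce
  rw [NetRel.zDen, Finset.prod_range]

theorem mcVal (h : HasNet s i ends A den) {Q x : α → ℕ} (hQ : CompN s i Q) (hx : CompN s i x) :
    CompN s i (fun a => NetRel.mcVal (ends a) (A a) (den a) (Q a) (x a)) := by
  have hpm := h.E.pb_range
  refine h.nonconst (h.mergeAll (c := fun a => Surv (A a) (den a) (Q a) (x a))
    (mkIdx (f := fun _ v => (v : ℕ)) h.V fun hE => hE.snd) fun hE => ?_)
  have hp := Comp.pow (hQ.up hE.fst) hE.snd (hpm.up.mono fun b => (Fin.is_lt _).le)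
  exact not (((((hx.up hE.fst).div hp).mod (hQ.up hE.fst)).mul (get (h.den.up hE.fst) hE.snd)).lt
    ((get (h.num.up hE.fst) hE.snd).mul (hQ.up hE.fst)))

theorem leP (h : HasNet s i ends A den) {e e' : ∀ a, Fin (m a)}
    (he : CompN s i (fun a => (e a : ℕ))) (he' : CompN s i (fun a => (e' a : ℕ))) :
    CompN s i (fun a => ind (LeP (A a) (den a) (e a) (e' a))) :=
  ((get h.num he).mul (get h.den he')).le ((get h.num he').mul (get h.den he))

theorem conn (h : HasNet s i ends A den) {e : ∀ a, Fin (m a)}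
    (he : CompN s i (fun a => (e a : ℕ))) :
    CompN s i (fun a => ind (Conn (ends a) (A a) (den a) (e a))) :=
  not (h.nonconst (h.mergeAll (c := fun a e' => LeP (A a) (den a) e' (e a))
    (mkIdx (f := fun _ v => (v : ℕ)) h.V fun hE => hE.snd) fun hE =>
      (h.up hE.fst).leP (e := fun b => b.2) (e' := fun b => e b.1) hE.snd (he.up hE.fst)))

theorem bottleneck (h : HasNet s i ends A den) {e : ∀ a, Fin (m a)}
    (he : CompN s i (fun a => (e a : ℕ))) :
    CompN s i (fun a => ind (Bottleneck (ends a) (A a) (den a) (e a))) :=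
  ((h.conn he).and (all (P := fun a e' => ¬ (Conn (ends a) (A a) (den a) e' ∧
    ¬ LeP (A a) (den a) (e a) e')) h.E fun hE =>
      not (((h.up hE.fst).conn (e := fun b => b.2) hE.snd).and (not ((h.up hE.fst).leP
        (e := fun b => e b.1) (e' := fun b => b.2) (he.up hE.fst) hE.snd))))).congr fun a => by
    congr 1
    refine if_congr (and_congr_right fun _ => forall_congr' fun e' => ?_) rfl rfl
    tauto

theorem qNum (h : HasNet s i ends A den) :
    CompN s i (fun a => NetRel.qNum (ends a) (A a) (den a)) :=
  sum (f := fun a e => if Bottleneck (ends a) (A a) (den a) e then A a e else 0) h.E fun hE =>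
    iteN ((h.up hE.fst).bottleneck hE.snd) (get (h.num.up hE.fst) hE.snd) (const hE.pb_in 0)

theorem qDen (h : HasNet s i ends A den) :
    CompN s i (fun a => NetRel.qDen (ends a) (A a) (den a)) :=
  sum (f := fun a e => if Bottleneck (ends a) (A a) (den a) e then den a e else 0) h.E fun hE =>
    iteN ((h.up hE.fst).bottleneck hE.snd) (get (h.den.up hE.fst) hE.snd) (const hE.pb_in 0)

theorem pb_scl (h : HasNet s i ends A den) : PB s (fun a => scl (m a)) :=
  (PB.const 6).mul (h.E.pb_range.add (PB.const 1))

theorem pb_wtCap (h : HasNet s i ends A den) : PB s (fun a => wtCap (m a)) :=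
  h.pb_scl.mul (h.E.pb_range.add (PB.const 1))

theorem scl (h : HasNet s i ends A den) : CompN s i (fun a => NetRel.scl (m a)) :=
  (const h.E.pb_in 6).mul ((Comp.length h.E).add (const h.E.pb_in 1))

theorem wtCap (h : HasNet s i ends A den) : CompN s i (fun a => NetRel.wtCap (m a)) :=
  h.scl.mul ((Comp.length h.E).add (const h.E.pb_in 1))

theorem lwt (h : HasNet s i ends A den) :
    Comp s i (fun a => idx (NetRel.lwt (ends a) (A a) (den a))) := by
  have hr := Comp.range h.wtCap h.pb_wtCap
  refine mkIdx h.E fun hE => ?_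
  have hA := Comp.pow (get (h.num.up hE.fst) hE.snd) (h.scl.up hE.fst) h.pb_scl.up
  have hD := Comp.pow (get (h.den.up hE.fst) hE.snd) (h.scl.up hE.fst) h.pb_scl.up
  have hqn := h.qNum.up hE.fst
  have hqd := h.qDen.up hE.fst
  refine (sum (f := fun b j => if A b.1 b.2 ^ NetRel.scl (m b.1) *
    NetRel.qDen (ends b.1) (A b.1) (den b.1) ^ ((j : ℕ) + 1) ≤
    NetRel.qNum (ends b.1) (A b.1) (den b.1) ^ ((j : ℕ) + 1) * den b.1 b.2 ^ NetRel.scl (m b.1)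
    then 1 else 0) (hr.up hE.fst) fun hE' => ?_).congr fun b => by
      beta_reduce
      rw [NetRel.lwt, Finset.sum_range]
  have hj := hE'.snd.add (const hE'.pb_in 1)
  have hpj : PB (fun c : Σ b : Σ a, Fin (m a), Fin (NetRel.wtCap (m b.1)) => s c.1.1)
      (fun c => (c.2 : ℕ) + 1) := h.pb_wtCap.up.up.mono fun c => c.2.2
  exact ((hA.up hE'.fst).mul (Comp.pow (hqd.up hE'.fst) hj hpj)).le
    ((Comp.pow (hqn.up hE'.fst) hj hpj).mul (hD.up hE'.fst))

end HasNet


open NetRel.Comp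

/-! ### Sums of fractions over the digits of the random number -/

section sums

variable {α : Type} {s : α → ℕ} {i : α → Val} {N R x : α → ℕ} {u v : α → ℕ → ℕ}

/-- A function of the digits of a number. -/
abbrev CompDigit (s : α → ℕ) (i : α → Val) (N R x : α → ℕ) (v : α → ℕ → ℕ) : Prop :=
  CompN (fun b : Σ a, Fin (N a) => s b.1) (fun b => .pair (i b.1) (.num b.2))
    (fun b => v b.1 (x b.1 / R b.1 ^ (b.2 : ℕ) % R b.1))

theorem Comp.digit (hN : Comp s i (fun a => rangeV (N a))) (hR : CompN s i R) (hx : CompN s i x) :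
    CompDigit s i N R x (fun _ y => y) := by
  have hE := refl hN.pb_entry
  have hp := Comp.pow (hR.up hE.fst) hE.snd (hN.pb_range.up.mono fun b => (Fin.is_lt _).le)
  exact ((hx.up hE.fst).div hp).mod (hR.up hE.fst)

theorem Comp.sumDen (hN : Comp s i (fun a => rangeV (N a))) (hv : CompDigit s i N R x v) :
    CompN s i (fun a => NetRel.sumDen (v a) (R a) (N a) (x a)) :=
  prod (f := fun a (j : Fin (N a)) => v a (x a / R a ^ (j : ℕ) % R a)) hN fun _ => hv

theorem Comp.sumNum (hN : Comp s i (fun a => rangeV (N a))) (hu : CompDigit s i N R x u)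
    (hv : CompDigit s i N R x v) :
    CompN s i (fun a => NetRel.sumNum (u a) (v a) (R a) (N a) (x a)) :=
  sum (f := fun a (j : Fin (N a)) => u a (x a / R a ^ (j : ℕ) % R a) *
    (NetRel.sumDen (v a) (R a) (N a) (x a) / v a (x a / R a ^ (j : ℕ) % R a))) hN fun hE =>
      hu.mul (((Comp.sumDen hN hv).up hE.fst).div hv)

end sums

/-! ### Polynomial bounds and programs for the parameters -/

section parameters

variable {α : Type} {s : α → ℕ} {i : α → Val} {n m k : α → ℕ}

theorem PB.wtCap (hm : PB s m) : PB s (fun a => wtCap (m a)) :=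
  ((PB.const 6).mul (hm.add (PB.const 1))).mul (hm.add (PB.const 1))

theorem PB.thr (hn : PB s n) (hk : PB s k) : PB s (fun a => thr (n a) (k a)) :=
  (((PB.const 4096).mul (hn.pow 4)).mul hk).pow 5

theorem PB.samples (hn : PB s n) (hk : PB s k) : PB s (fun a => samples (n a) (k a)) :=
  (((PB.const (2 ^ 14)).mul (hk.pow 2)).mul (hn.pow 3)).mul (hn.thr hk)

theorem PB.digitBits (hn : PB s n) (hm : PB s m) (hk : PB s k) :
    PB s (fun a => digitBits (n a) (m a) (k a)) :=
  ((((((PB.const 128).mul hk).mul (hn.pow 4)).mul (hn.thr hk)).mul (hm.add (PB.const 1))).mul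
    (hm.wtCap.add (PB.const 1))).add hn

theorem Comp.powConst {f : α → ℕ} (hf : CompN s i f) (c : ℕ) : CompN s i (fun a => f a ^ c) :=
  Comp.pow hf (const hf.pb_in c) (PB.const c)

theorem Comp.thr (hn : CompN s i n) (hk : CompN s i k) :
    CompN s i (fun a => NetRel.thr (n a) (k a)) :=
  (((const hn.pb_in 4096).mul (hn.powConst 4)).mul hk).powConst 5

theorem Comp.samples (hn : CompN s i n) (hk : CompN s i k) :
    CompN s i (fun a => NetRel.samples (n a) (k a)) :=
  (((const hn.pb_in (2 ^ 14)).mul (hk.powConst 2)).mul (hn.powConst 3)).mul (hn.thr hk)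

theorem Comp.digitBits (hn : CompN s i n) (hm : CompN s i m) (hk : CompN s i k) :
    CompN s i (fun a => NetRel.digitBits (n a) (m a) (k a)) :=
  have h1 := hm.add (const hm.pb_in 1)
  ((((((const hn.pb_in 128).mul hk).mul (hn.powConst 4)).mul (hn.thr hk)).mul h1).mul
    ((((const hn.pb_in 6).mul h1).mul h1).add (const hn.pb_in 1))).add hn

end parameters

namespace HasNet

variable {α : Type} {s : α → ℕ} {i : α → Val} {n m : α → ℕ}
  {ends : ∀ a, Fin (m a) → Fin (n a) × Fin (n a)} {A den : ∀ a, Fin (m a) → ℕ}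
  {k x : α → ℕ}

theorem est (h : HasNet s i ends A den) (hk : CompN s i k) (hpk : PB s k) (hx : CompN s i x) :
    Comp s i (fun a => .pair (.num (estNum (ends a) (A a) (den a) (k a) (x a)))
      (.num (estDen (ends a) (A a) (den a) (k a) (x a)))) := by
  have hn := Comp.length h.V
  have hm := Comp.length h.E
  have hpn := h.V.pb_range
  have hpm := h.E.pb_range
  have hs := hn.samples hk
  have hps := hpn.samples hpk
  have hN := Comp.range hs hps
  have hbase : CompN s i (fun a => base (n a) (m a) (k a)) :=
    Comp.pow (const hn.pb_in 2) (hn.digitBits hm hk) (hpn.digitBits hpm hpk)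
  have hrad : CompN s i (fun a => radix (n a) (m a) (k a)) :=
    Comp.pow hbase (hn.add hm) (hpn.add hpm)
  have hw := h.lwt
  have hE := refl hN.pb_entry
  have hdig := Comp.digit hN hrad hx
  have hu : CompDigit s i (fun a => samples (n a) (k a)) (fun a => radix (n a) (m a) (k a)) x
      (fun a => NetRel.zNum (ends a)
      (NetRel.lwt (ends a) (A a) (den a)) (A a) (base (n a) (m a) (k a))) :=
    (h.up hE.fst).zNum (hw.up hE.fst) (hbase.up hE.fst) hdig
  have hv : CompDigit s i (fun a => samples (n a) (k a)) (fun a => radix (n a) (m a) (k a)) x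
      (fun a => NetRel.zDen (ends a)
      (NetRel.lwt (ends a) (A a) (den a)) (den a) (base (n a) (m a) (k a))) :=
    (h.up hE.fst).zDen (hw.up hE.fst) (hbase.up hE.fst) hdig
  have hzn : CompN s i (fun a => zSumNum (ends a) (A a) (den a) (k a) (x a)) :=
    Comp.sumNum hN hu hv
  have hzd : CompN s i (fun a => zSumDen (ends a) (A a) (den a) (k a) (x a)) := Comp.sumDen hN hv
  have hmc : CompN s i (fun a => mcSum (ends a) (A a) (den a) (k a) (x a)) :=
    sum (f := fun a (j : Fin (samples (n a) (k a))) => NetRel.mcVal (ends a) (A a) (den a)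
      (base (n a) (m a) (k a))
      (x a / radix (n a) (m a) (k a) ^ (j : ℕ) % radix (n a) (m a) (k a))) hN fun _ =>
        (h.up hE.fst).mcVal (hbase.up hE.fst) hdig
  have huse : CompN s i (fun a => ind (UseZ (ends a) (A a) (den a) (k a) (x a))) :=
    (((const hn.pb_in 0).lt h.qNum).and ((h.qNum.lt h.qDen).and
      ((((const hn.pb_in 4).mul (hn.thr hk)).mul hzn).lt (hs.mul hzd)))).congr fun a => by
        congr 1
  exact (iteN huse hzn hmc).pair (iteN huse (hs.mul hzd) hs)

end HasNet

/-! ### The input -/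

/-- Instances together with a positive error parameter. -/
abbrev Inst : Type := {z : Network × ℚ // 0 < z.2}

namespace Inst

/-- The input of the algorithm. -/
def input (z : Inst) : Val := schemeInput Network.encode z.1.1 z.1.2

/-- The length of the input plus the inverse of the error parameter. -/
def len (z : Inst) : ℕ := z.input.size + ⌈z.1.2⁻¹⌉₊

/-- An integer at least as large as the inverse of the error parameter. -/
def prec (z : Inst) : ℕ := z.1.2.den / z.1.2.num.toNat + 1

/-- The numerators of the failure probabilities. -/
def pnum (z : Inst) (e : Fin z.1.1.m) : ℕ := (z.1.1.prob e).num.toNat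

/-- The denominators of the failure probabilities. -/
def pden (z : Inst) (e : Fin z.1.1.m) : ℕ := (z.1.1.prob e).den

theorem comp_input : Comp len input input :=
  refl ((PB.self len).mono fun _ => Nat.le_add_right _ _)

theorem hasNet : HasNet len input (fun z => z.1.1.ends) pnum pden := by
  have hin : Comp len input (fun z => .pair (.pair (rangeV z.1.1.n)
      (Val.ofList (List.ofFn fun e : Fin z.1.1.m => .pair (.pair (.num (z.1.1.ends e).1)
        (.num (z.1.1.ends e).2)) (.pair (.num (z.pnum e)) (.num (z.pden e))))))
      (.pair (.num z.1.2.num.toNat) (.num z.1.2.den))) := comp_input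
  have hl := Comp.enum hin.fst.snd
  exact ⟨hin.fst.fst, map hl fun hE => hE.snd.fst,
    map hl fun hE => hE.snd.fst.pair hE.snd.snd.fst.fst,
    map hl fun hE => hE.snd.fst.pair hE.snd.snd.fst.snd,
    map hl fun hE => hE.snd.fst.pair hE.snd.snd.snd.fst,
    map hl fun hE => hE.snd.fst.pair hE.snd.snd.snd.snd⟩

theorem comp_prec : CompN len input prec := by
  have hin : Comp len input (fun z => .pair z.1.1.encode
    (.pair (.num z.1.2.num.toNat) (.num z.1.2.den))) := comp_input
  exact (hin.snd.snd.div hin.snd.fst).add (const hin.pb_in 1)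

theorem num_toNat_pos (z : Inst) : 0 < z.1.2.num.toNat := by
  have := Rat.num_pos.2 z.2
  omega

theorem eq_div (z : Inst) : z.1.2 = (z.1.2.num.toNat : ℚ) / z.1.2.den := by
  have h := Rat.num_pos.2 z.2
  conv_lhs => rw [← Rat.num_div_den z.1.2]
  congr 1
  have : ((z.1.2.num.toNat : ℤ) : ℚ) = z.1.2.num := by rw [Int.toNat_of_nonneg h.le]
  exact_mod_cast this.symm

/-- The rounded quotient of denominator by numerator is at most `1 / ε`. The term `⌈1 / ε⌉` in `len`
provides this bound on the value of `prec`. -/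
theorem pb_prec : PB len prec := by
  refine ((PB.self len).add (PB.const 1)).mono fun z => Nat.add_le_add_right ?_ 1
  refine le_trans ?_ (Nat.le_add_left _ _)
  have h1 : ((z.1.2.den / z.1.2.num.toNat : ℕ) : ℚ) ≤ z.1.2⁻¹ := by
    refine Nat.cast_div_le.trans (le_of_eq ?_)
    conv_rhs => rw [eq_div z, inv_div]
  exact_mod_cast h1.trans (Nat.le_ceil _)

theorem one_div_prec_le (z : Inst) : (1 : ℚ) / z.prec ≤ z.1.2 := by
  have h1 : (0 : ℚ) < z.1.2.num.toNat := by exact_mod_cast num_toNat_pos z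
  have h2 : (0 : ℚ) < z.1.2.den := by exact_mod_cast z.1.2.den_pos
  have h3 : (0 : ℚ) < z.prec := by exact_mod_cast Nat.succ_pos _
  conv_rhs => rw [eq_div z]
  rw [div_le_div_iff₀ h3 h2, one_mul]
  have := (Nat.lt_mul_div_succ z.1.2.den (num_toNat_pos z)).le
  exact_mod_cast this

/-- The number of coin flips. -/
def flips (z : Inst) : ℕ :=
  digitBits z.1.1.n z.1.1.m z.prec * (z.1.1.n + z.1.1.m) * samples z.1.1.n z.prec

theorem two_pow_flips (z : Inst) :
    2 ^ z.flips = radix z.1.1.n z.1.1.m z.prec ^ samples z.1.1.n z.prec := by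
  rw [flips, pow_mul, pow_mul]
  rfl

theorem pb_flips : PB len flips :=
  have hn := hasNet.V.pb_range
  have hm := hasNet.E.pb_range
  ((hn.digitBits hm pb_prec).mul (hn.add hm)).mul (hn.samples pb_prec)

theorem comp_flips : CompN len input flips :=
  have hn := Comp.length hasNet.V
  have hm := Comp.length hasNet.E
  ((hn.digitBits hm comp_prec).mul (hn.add hm)).mul (hn.samples comp_prec)

/-- The output of the algorithm when the coin flips are the binary digits of `x`. -/
noncomputable def out (z : Inst) (x : ℕ) : Val :=
  .pair (.num (estNum z.1.1.ends z.pnum z.pden z.prec x))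
    (.num (estDen z.1.1.ends z.pnum z.pden z.prec x))

theorem exists_prog : ∃ (P : Prog) (T : Inst → ℕ), PB len T ∧
    ∀ z : Inst, ∃ t : Fin (2 ^ z.flips) → ℕ, (∀ y, t y ≤ T z) ∧
      P.eval z.input = (PMF.uniformOfFintype (Fin (2 ^ z.flips))).map
        fun y : Fin (2 ^ z.flips) => (z.out y, t y) := by
  refine exists_prog_of_comp (out := fun b => out b.1 b.2) comp_flips pb_flips ?_
  have hE : Comp (fun b : Σ z : Inst, Fin (2 ^ z.flips) => b.1.len)
      (fun b => .pair b.1.input (.num b.2)) (fun b => .pair b.1.input (.num b.2)) := by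
    refine refl ((((PB.self len).up.add pb_flips.up).add (PB.const 2)).mono fun b => ?_)
    have h1 : b.1.input.size ≤ b.1.len := Nat.le_add_right _ _
    have h2 : Nat.size (b.2 : ℕ) ≤ b.1.flips := Nat.size_le.2 b.2.2
    simp only [Val.size]
    omega
  exact (hasNet.up hE.fst).est (comp_prec.up hE.fst) pb_prec.up hE.snd

end Inst


/-! ### Cuts and connectivity of the surviving graph -/

theorem mem_cutsIn {V ι : Type} [Fintype V] [DecidableEq V] [Fintype ι] [DecidableEq ι]
    {ends : ι → V × V} {S : Finset ι} {χ : V → Fin 2} :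
    χ ∈ cutsIn ends S ↔ Nonconst χ ∧ ∀ e ∉ S, ¬ Cross ends χ e := by
  simp [cutsIn]

namespace Network

variable (N : Network)

/-- A coloring not crossed by any surviving edge is constant along walks, hence constant if the
graph is connected. Conversely, the set reachable from one of two unconnected vertices is a cut
without surviving edges; self-loops cross nothing. -/
theorem cutsIn_nonempty_iff (S : Finset (Fin N.m)) :
    (cutsIn N.ends S).Nonempty ↔ ¬ (N.surviving S).Connected := by
  classical
  constructor
  · rintro ⟨χ, hχ⟩ hc
    obtain ⟨⟨x, y, hxy⟩, hcr⟩ := mem_cutsIn.1 hχ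
    refine hxy ?_
    have hadj : ∀ {u v}, (N.surviving S).Adj u v → χ u = χ v := fun {u v} h => by
      rw [surviving, SimpleGraph.fromEdgeSet_adj] at h
      obtain ⟨⟨e, he, hd⟩, -⟩ := h
      have h' : χ (N.ends e).1 = χ (N.ends e).2 := not_not.1 (hcr e he)
      rcases Sym2.eq_iff.1 hd with ⟨rfl, rfl⟩ | ⟨rfl, rfl⟩
      exacts [h', h'.symm]
    obtain ⟨p⟩ := hc.preconnected x y
    induction p with
    | nil => rfl
    | cons h _ ih =>
      rw [hadj h]
      by_contra hne
      exact hne (ih hne)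
  · intro hc
    have : Nonempty (Fin N.n) := ⟨⟨0, N.n_pos⟩⟩
    rw [SimpleGraph.connected_iff, not_and_or] at hc
    have hc := hc.resolve_right (not_not.2 this)
    unfold SimpleGraph.Preconnected at hc
    push Not at hc
    obtain ⟨u, v, huv⟩ := hc
    refine ⟨fun x => if (N.surviving S).Reachable u x then 0 else 1,
      mem_cutsIn.2 ⟨⟨u, v, ?_⟩, fun e he hcr => hcr ?_⟩⟩
    · simp [huv]
    · by_cases hne : (N.ends e).1 = (N.ends e).2
      · rw [hne]
      · have hadj : (N.surviving S).Adj (N.ends e).1 (N.ends e).2 := by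
          rw [surviving, SimpleGraph.fromEdgeSet_adj]
          exact ⟨⟨e, he, rfl⟩, hne⟩
        have : (N.surviving S).Reachable u (N.ends e).1 ↔ (N.surviving S).Reachable u (N.ends e).2 :=
          ⟨fun h => h.trans hadj.reachable, fun h => h.trans hadj.symm.reachable⟩
        simp only [this]

theorem failProb_eq : (N.failProb : ℝ) = failR N.ends fun e => (N.prob e : ℝ) := by
  classical
  rw [failR_eq, failProb]
  push_cast
  refine Finset.sum_congr rfl fun S _ => ?_
  by_cases h : (N.surviving S).Connected
  · rw [if_pos h, if_neg (fun h' => (N.cutsIn_nonempty_iff S).1 h' h)]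
    simp
  · rw [if_neg h, if_pos ((N.cutsIn_nonempty_iff S).2 h), mul_one, pw]
    push_cast
    rfl

end Network

/-! ### From accurate estimates to the success probability -/

namespace Inst

theorem prb_eq (z : Inst) : prb z.pnum z.pden = fun e => (z.1.1.prob e : ℝ) := by
  funext e
  have h : (0 : ℤ) ≤ (z.1.1.prob e).num := Rat.num_nonneg.2 (z.1.1.prob_nonneg e)
  have h1 : ((z.1.1.prob e).num.toNat : ℝ) = ((z.1.1.prob e).num : ℝ) := by
    exact_mod_cast congrArg (fun t : ℤ => (t : ℝ)) (Int.toNat_of_nonneg h)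
  rw [prb, pnum, pden, h1, Rat.cast_def]

theorem prec_pos (z : Inst) : 0 < z.prec := Nat.succ_pos _

theorem pden_pos (z : Inst) (e : Fin z.1.1.m) : 0 < z.pden e := (z.1.1.prob e).den_pos

theorem pnum_le (z : Inst) (e : Fin z.1.1.m) : z.pnum e ≤ z.pden e := by
  have h1 : (z.1.1.prob e).num ≤ (z.1.1.prob e).den := by
    have := z.1.1.prob_le_one e
    rw [← Rat.num_div_den (z.1.1.prob e),
      div_le_one (by exact_mod_cast (z.1.1.prob e).den_pos)] at this
    exact_mod_cast this
  unfold pnum pden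
  omega

theorem isApprox_out (z : Inst) {x : ℕ}
    (h : |est z.1.1.ends z.pnum z.pden z.prec x - failR z.1.1.ends (prb z.pnum z.pden)| ≤
      1 / z.prec * failR z.1.1.ends (prb z.pnum z.pden)) :
    IsApprox z.1.2 z.1.1.failProb (z.out x) := by
  have hF0 := failR_nonneg (ends := z.1.1.ends) z.pnum_le
  have hF := z.1.1.failProb_eq
  rw [← prb_eq] at hF
  have hε : (1 : ℝ) / z.prec ≤ (z.1.2 : ℝ) := by
    have := (Rat.cast_le (K := ℝ)).2 (one_div_prec_le z)
    push_cast at this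
    exact this
  rw [← hF] at h hF0
  have h1 := mul_le_mul_of_nonneg_right hε hF0
  obtain ⟨h2, h3⟩ := abs_le.1 (h.trans h1)
  rw [est] at h2 h3
  refine ⟨_, _, rfl, estDen_pos z.1.1.n_pos z.prec_pos z.pden_pos x, ?_, ?_⟩
  · have : ((1 : ℝ) - z.1.2) * z.1.1.failProb ≤ (estNum z.1.1.ends z.pnum z.pden z.prec x : ℝ) /
        estDen z.1.1.ends z.pnum z.pden z.prec x := by linarith
    refine (Rat.cast_le (K := ℝ)).1 ?_
    push_cast
    exact this
  · have : (estNum z.1.1.ends z.pnum z.pden z.prec x : ℝ) /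
        estDen z.1.1.ends z.pnum z.pden z.prec x ≤ ((1 : ℝ) + z.1.2) * z.1.1.failProb := by linarith
    refine (Rat.cast_le (K := ℝ)).1 ?_
    push_cast
    exact this

theorem three_quarters_le (z : Inst) (t : Fin (2 ^ z.flips) → ℕ) :
    (3 / 4 : ENNReal) ≤ ((PMF.uniformOfFintype (Fin (2 ^ z.flips))).map
      fun y : Fin (2 ^ z.flips) => (z.out y, t y)).toOuterMeasure
        {r | IsApprox z.1.2 z.1.1.failProb r.1} := by
  classical
  set good : ℕ → Prop := fun x =>
    |est z.1.1.ends z.pnum z.pden z.prec x - failR z.1.1.ends (prb z.pnum z.pden)| ≤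
      1 / z.prec * failR z.1.1.ends (prb z.pnum z.pden) with hgood
  have hcard := card_est_le (ends := z.1.1.ends) z.1.1.n_pos z.prec_pos
    z.pden_pos z.pnum_le
  rw [← Nat.cast_pow, ← two_pow_flips] at hcard
  have hcard : ((Finset.range (2 ^ z.flips)).filter fun x => ¬ good x).card * 4 ≤ 2 ^ z.flips := by
    have : ((((Finset.range (2 ^ z.flips)).filter fun x => ¬ good x).card : ℕ) : ℝ) * 4 ≤
        ((2 ^ z.flips : ℕ) : ℝ) := by
      convert hcard
    exact_mod_cast this
  have hsum := Finset.card_filter_add_card_filter_not (s := Finset.range (2 ^ z.flips)) good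
  rw [Finset.card_range] at hsum
  have hfin : Fintype.card {y : Fin (2 ^ z.flips) // good y} =
      ((Finset.range (2 ^ z.flips)).filter good).card := by
    rw [Fintype.card_subtype, ← Finset.card_map Fin.valEmbedding]
    congr 1
    ext x
    simp only [Finset.mem_map, Finset.mem_filter, Finset.mem_univ, true_and, Finset.mem_range,
      Fin.valEmbedding_apply]
    constructor
    · rintro ⟨y, hy, rfl⟩
      exact ⟨y.2, hy⟩
    · rintro ⟨hx, hg⟩
      exact ⟨⟨x, hx⟩, hg, rfl⟩
  rw [PMF.toOuterMeasure_map_apply]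
  refine le_trans ?_ (MeasureTheory.measure_mono
    (fun y hy => z.isApprox_out hy : {y : Fin (2 ^ z.flips) | good y} ⊆ _))
  rw [PMF.toOuterMeasure_uniformOfFintype_apply]
  have h1 : Fintype.card {y : Fin (2 ^ z.flips) | good y} =
      ((Finset.range (2 ^ z.flips)).filter good).card := by
    rw [← hfin]
    rfl
  rw [h1, Fintype.card_fin, ENNReal.le_div_iff_mul_le (by simp) (by simp)]
  have h2 : 3 * 2 ^ z.flips ≤ ((Finset.range (2 ^ z.flips)).filter good).card * 4 := by omega
  rw [← ENNReal.mul_div_right_comm, ENNReal.div_le_iff (by simp) (by simp)]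
  exact_mod_cast h2

end Inst

end NetRel

/-- There is a fully polynomial randomized approximation scheme for the probability that a network,
each of whose edges fails independently with its own probability, becomes disconnected. -/
theorem mainTheorem4 :
    ∃ A : NetRel.Prog,
      NetRel.IsFPRAS NetRel.Network.encode NetRel.Network.failProb A := by
  obtain ⟨A, T, ⟨P, hP⟩, hA⟩ := NetRel.Inst.exists_prog
  refine ⟨A, ⟨P, fun N ε hε r hr => ?_⟩, fun N ε hε => ?_⟩
  · obtain ⟨t, ht, h⟩ := hA ⟨(N, ε), hε⟩
    change r ∈ (A.eval (NetRel.Inst.input ⟨(N, ε), hε⟩)).support at hr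
    rw [h, PMF.support_map] at hr
    obtain ⟨y, -, rfl⟩ := hr
    exact (ht y).trans (hP _)
  · obtain ⟨t, -, h⟩ := hA ⟨(N, ε), hε⟩
    change _ ≤ (A.eval (NetRel.Inst.input ⟨(N, ε), hε⟩)).toOuterMeasure _
    rw [h]
    exact NetRel.Inst.three_quarters_le ⟨(N, ε), hε⟩ t
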